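/- **Graphs.** Consider Feynman graphs of the orientable $\bar\phi\star\phi\star\bar\phi\star\phi$ model: every vertex has four half-lines in cyclic order with alternating signs, every internal line joins a $+$ half-line to a $-$ half-line, and half-lines on no internal line are external legs. (After contraction we also allow vertices with another even number of half-lines.) At each vertex the half-lines are numbered $1,2,\dots$ in cyclic order, odd numbers for the sign $+$. Put $\varepsilon^V_{\ell i}=(-1)^{i+1}$ if the line $\ell$ hooks to $V$ at half-line $i$, and $0$ otherwise, $\eta=|\varepsilon|$, and $\omega(i,j)=1,-1,0$ for $i<j$, $i>j$, $i=j$. For a graph with lines $1,\dots,L$, a chosen root vertex $\bar V$ and a parameter $s\in\mathbb R$ (in the model $s=1/\Omega$) let $$HU_{G,\bar V}(t)=\det(A+B)\prod_{\ell}t_\ell ,\qquad A=\mathrm{diag}(t_\ell^{-1};\,t_\ell;\,0),\qquad B=\begin{pmatrix}sE&C\\-C^{t}&0\end{pmatrix},$$ with rows and columns indexed by short variables $u_\ell$, long variables $v_\ell$, and hypermomenta $p_V$, $V\ne\bar V$. Here $E$ has the blocks $E^{uu},E^{uv},E^{vu},E^{vv}$ with entries $\sum_V\sum_{i,j}(-1)^{i+j+1}\omega(i,j)\,a^V_{\ell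 i}\,b^V_{\ell' j}$ for $(a,b)=(\varepsilon,\varepsilon),(\varepsilon,\eta),(\eta,\varepsilon),(\eta,\eta)$, and $C$ has the entries $\sum_i(-1)^{i+1}\varepsilon^V_{\ell i}$ (row $u_\ell$) and $\sum_i(-1)^{i+1}\eta^V_{\ell i}$ (row $v_\ell$), $V\neq\bar V$. $HU_{G,\bar V}$ is a polynomial in the $t_\ell$. **Subgraphs.** Let $G$ be connected, and let $S$ be a primitively divergent subgraph: a set of lines of $G$, with the vertices they hook to, that is connected, has genus $0$ (that is, $n(S)-L(S)+F(S)=2$), exactly one face broken by external legs, and $N(S)=2$ or $4$ external legs (half-lines of vertices of $S$ that are not on lines of $S$). Let $G/S$ be $G$ with $S$ replaced by a single (Moyal) vertex, whose half-lines are the $N(S)$ legs of $S$ in the cyclic order in which they occur along the broken face of $S$. **Numbering.** Say that the numbering at a vertex of $S$ *starts in the broken face* if the sector between its last and its first half-line lies in the broken face of $S$ (for instance, because its first or last half-line is a leg of $S$). Let $\bar V_S$ be a vertex of $S$; when $HU_{S,\bar V_S}$ is formed, $\bar V_S$ is numbered so that its numbering starts in the broken face. Let $\bar V$ be any vertex of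 $G$; if $\bar V$ lies in $S$, assume that its numbering starts in the broken face of $S$. The root of $G/S$ is $\bar V$ if $\bar V\notin S$, and the contracted vertex if $\bar V\in S$. The legs at the contracted vertex are numbered along the broken face, beginning at a sector of that face between a $-$ half-line of a vertex of $S$ and its successor, arbitrary if $\bar V\notin S$ and the sector where the numbering of $\bar V$ starts if $\bar V\in S$. **Theorem.** Substitute $t_\alpha\mapsto\rho^2t_\alpha$ for all lines $\alpha$ of $S$; then $HU_{G,\bar V}$ and $HU_{S,\bar V_S}$ become polynomials in $\rho$, and $HU^{l(\rho)}$ denotes the term of minimal degree in $\rho$ (including the power of $\rho$). Then, for every $s\in\mathbb R$, $$HU^{l(\rho)}_{G,\bar V}=HU^{l(\rho)}_{S,\bar V_S}\cdot HU_{G/S,\bar V}.$$ -/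

import Mathlib

open scoped BigOperators

/-- Vertices `V`, half-lines (corners) `K`, internal lines `L`. Every vertex carries a numbering of
its half-lines; a half-line with number `i` has the sign `(-1)^(i+1)`. The internal line `ℓ` joins
the half-lines `plus ℓ` and `minus ℓ`; half-lines on no internal line are external legs.
Vertices may have any number of half-lines. -/
structure MoyalGraph (V K L : Type*) where
  vert : K → V
  num : K → ℕ
  plus : L → K
  minus : L → K

namespace MoyalGraph

variable {V K L : Type*}

/-- Connectedness of the underlying abstract graph. -/
def IsConnected (G : MoyalGraph V K L) : Prop :=
  (SimpleGraph.fromRel fun v w : V => ∃ ℓ, G.vert (G.plus ℓ) = v ∧ G.vert (G.minus ℓ) = w).Connected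

section Matrices

variable [Fintype V] [DecidableEq V] [Fintype K] [DecidableEq K] [Fintype L] [DecidableEq L]

/-- The half-lines of the vertex `v`. -/
def corners (G : MoyalGraph V K L) (v : V) : Finset K := Finset.univ.filter fun c => G.vert c = v

/-- The incidence matrix `ε_{ℓ i} = (-1)^(i+1)` if the line `ℓ` hooks at the half-line `i`. -/
def eps (G : MoyalGraph V K L) (ℓ : L) (c : K) : ℤ :=
  if c = G.plus ℓ ∨ c = G.minus ℓ then (-1) ^ (G.num c + 1) else 0

/-- `η = |ε|`. -/
def eta (G : MoyalGraph V K L) (ℓ : L) (c : K) : ℤ := |G.eps ℓ c|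

/-- `ω(i,j) = 1, -1, 0` for `i < j`, `j < i`, `i = j`, with `i, j` the numbers of the half-lines. -/
def omega (G : MoyalGraph V K L) (c d : K) : ℤ :=
  if G.num c < G.num d then 1 else if G.num d < G.num c then -1 else 0

/-- `∑_V ∑_{i,j} (-1)^(i+j+1) ω(i,j) a_{ℓ i} b_{ℓ' j}`, the sum over pairs of half-lines `i, j`
of the same vertex `V`. -/
def osc (G : MoyalGraph V K L) (a b : L → K → ℤ) : Matrix L L ℤ := fun ℓ ℓ' =>
  ∑ v, ∑ c ∈ G.corners v, ∑ d ∈ G.corners v,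
    (-1) ^ (G.num c + G.num d + 1) * G.omega c d * a ℓ c * b ℓ' d

/-- The oscillation matrix in the short variables `u` (first summand) and the long
variables `v` (second summand). -/
def E (G : MoyalGraph V K L) : Matrix (L ⊕ L) (L ⊕ L) ℤ :=
  Matrix.fromBlocks (G.osc G.eps G.eps) (G.osc G.eps G.eta)
    (G.osc G.eta G.eps) (G.osc G.eta G.eta)

/-- The coupling of `u` and `v` to the hypermomenta of all vertices but the root. -/
def C (G : MoyalGraph V K L) (root : V) : Matrix (L ⊕ L) {v : V // v ≠ root} ℤ :=
  fun x v => match x with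
    | Sum.inl ℓ => ∑ c ∈ G.corners v.1, (-1) ^ (G.num c + 1) * G.eps ℓ c
    | Sum.inr ℓ => ∑ c ∈ G.corners v.1, (-1) ^ (G.num c + 1) * G.eta ℓ c

/-- The index set of the quadratic form: `u` variables, `v` variables, hypermomenta. -/
abbrev Idx (_G : MoyalGraph V K L) (root : V) : Type _ := (L ⊕ L) ⊕ {v : V // v ≠ root}

/-- The antisymmetric part `B = (sE, C; -Cᵗ, 0)`. -/
noncomputable def B (G : MoyalGraph V K L) (root : V) (s : ℝ) :
    Matrix (G.Idx root) (G.Idx root) ℝ :=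
  Matrix.fromBlocks (s • G.E.map (Int.cast : ℤ → ℝ)) ((G.C root).map (Int.cast : ℤ → ℝ))
    (-((G.C root).map (Int.cast : ℤ → ℝ)).transpose) 0

/-- The diagonal part `A = diag(1/t, t, 0)`. -/
noncomputable def A (G : MoyalGraph V K L) (root : V) (t : L → ℝ) :
    Matrix (G.Idx root) (G.Idx root) ℝ :=
  Matrix.diagonal (Sum.elim (Sum.elim (fun ℓ => 1 / t ℓ) t) fun _ => 0)

/-- `M = A + B`. -/
noncomputable def M (G : MoyalGraph V K L) (root : V) (s : ℝ) (t : L → ℝ) :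
    Matrix (G.Idx root) (G.Idx root) ℝ :=
  G.A root t + G.B root s

/-- The first polynomial `HU = det M · ∏ t_ℓ` in the indeterminates `t_ℓ`: the factor `t_ℓ` is
multiplied into the row of `M` that belongs to `u_ℓ`, which leaves polynomial entries.
`eval_HU` says that this is `det M · ∏ t_ℓ`. -/
noncomputable def HU (G : MoyalGraph V K L) (root : V) (s : ℝ) : MvPolynomial L ℝ :=
  (Matrix.diagonal (Sum.elim (Sum.elim (fun _ => 1) MvPolynomial.X) fun _ => 0) +
    Matrix.diagonal (Sum.elim (Sum.elim MvPolynomial.X fun _ => 1) fun _ => 1) *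
      (G.B root s).map MvPolynomial.C : Matrix (G.Idx root) (G.Idx root) (MvPolynomial L ℝ)).det

theorem eval_HU (G : MoyalGraph V K L) (root : V) (s : ℝ) (t : L → ℝ) (ht : ∀ ℓ, t ℓ ≠ 0) :
    MvPolynomial.eval t (G.HU root s) = (G.M root s t).det * ∏ ℓ, t ℓ := by
  have h : (MvPolynomial.eval t).mapMatrix
      (Matrix.diagonal (Sum.elim (Sum.elim (fun _ => 1) MvPolynomial.X) fun _ => 0) +
        Matrix.diagonal (Sum.elim (Sum.elim MvPolynomial.X fun _ => 1) fun _ => 1) *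
        (G.B root s).map MvPolynomial.C : Matrix (G.Idx root) (G.Idx root) (MvPolynomial L ℝ)) =
      Matrix.diagonal (Sum.elim (Sum.elim t fun _ => 1) fun _ => 1) * G.M root s t := by
    ext i j
    rcases i with (i | i) | i <;> rcases j with (j | j) | j <;>
      simp [M, A, Matrix.diagonal_apply, Matrix.diagonal_mul] <;>
      split_ifs <;> simp_all [mul_add]
  rw [HU, RingHom.map_det, h, Matrix.det_mul, Matrix.det_diagonal, mul_comm]
  simp [Fintype.prod_sum_type]

end Matrices

end MoyalGraph

/-- Feynman graphs of the orientable `φ̄ ⋆ φ ⋆ φ̄ ⋆ φ` model. Every vertex has four half-lines in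
cyclic order, `(v, i)` with `i : Fin 4`; they carry alternating signs, `+` for `i = 0, 2`
and `-` for `i = 1, 3`. An internal line joins a `+` half-line to a `-` half-line;
half-lines on no internal line are external legs. -/
structure Phi4Graph (V L : Type*) where
  plus : L → V × Fin 4
  minus : L → V × Fin 4
  plus_injective : Function.Injective plus
  minus_injective : Function.Injective minus
  plus_even : ∀ ℓ, Even ((plus ℓ).2 : ℕ)
  minus_odd : ∀ ℓ, Odd ((minus ℓ).2 : ℕ)

namespace Phi4Graph

variable {V L : Type*}

/-- The number, in `{1, 2, 3, 4}`, of the half-line `c`. The `-` half-line `r` is a root mark: at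
its vertex the numbering starts with the half-line that follows `r` (so that `r` has number `4`). At
the other vertices `(v, i)` has number `i + 1`. -/
def number [DecidableEq V] (r c : V × Fin 4) : ℕ :=
  if c.1 = r.1 then ((c.2 - r.2 - 1 : Fin 4) : ℕ) + 1 else (c.2 : ℕ) + 1

/-- The graph `G` with its half-lines numbered according to the root mark `r`. -/
def toMoyal [DecidableEq V] (G : Phi4Graph V L) (r : V × Fin 4) : MoyalGraph V (V × Fin 4) L where
  vert := Prod.fst
  num := number r
  plus := G.plus
  minus := G.minus

variable [DecidableEq V]

/-- The half-lines on the lines of the set `S`. -/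
def hooked (G : Phi4Graph V L) (S : Finset L) : Finset (V × Fin 4) :=
  S.image G.plus ∪ S.image G.minus

/-- The vertices of the subgraph with line set `S`. -/
def verts (G : Phi4Graph V L) (S : Finset L) : Finset V := (G.hooked S).image Prod.fst

theorem plus_mem_hooked (G : Phi4Graph V L) {S : Finset L} {ℓ : L} :
    G.plus ℓ ∈ G.hooked S ↔ ℓ ∈ S := by
  constructor
  · intro h
    rcases Finset.mem_union.1 h with h | h
    · obtain ⟨m, hm, e⟩ := Finset.mem_image.1 h
      exact G.plus_injective e ▸ hm
    · obtain ⟨m, -, e⟩ := Finset.mem_image.1 h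
      have h1 := G.plus_even ℓ
      have h2 := G.minus_odd m
      rw [e] at h2
      exact absurd h1 (Nat.not_even_iff_odd.2 h2)
  · exact fun h => Finset.mem_union_left _ (Finset.mem_image_of_mem _ h)

theorem minus_mem_hooked (G : Phi4Graph V L) {S : Finset L} {ℓ : L} :
    G.minus ℓ ∈ G.hooked S ↔ ℓ ∈ S := by
  constructor
  · intro h
    rcases Finset.mem_union.1 h with h | h
    · obtain ⟨m, -, e⟩ := Finset.mem_image.1 h
      have h1 := G.plus_even m
      have h2 := G.minus_odd ℓ
      rw [← e] at h2
      exact absurd h1 (Nat.not_even_iff_odd.2 h2)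
    · obtain ⟨m, hm, e⟩ := Finset.mem_image.1 h
      exact G.minus_injective e ▸ hm
  · exact fun h => Finset.mem_union_right _ (Finset.mem_image_of_mem _ h)

/-- The subgraph with line set `S` as a graph of its own, with root mark `r`. -/
def sub (G : Phi4Graph V L) (S : Finset L) (r : V × Fin 4) :
    MoyalGraph {v : V // v ∈ G.verts S} {c : V × Fin 4 // c.1 ∈ G.verts S} {ℓ : L // ℓ ∈ S} where
  vert c := ⟨c.1.1, c.2⟩
  num c := number r c.1
  plus ℓ := ⟨G.plus ℓ.1, Finset.mem_image_of_mem _ (G.plus_mem_hooked.2 ℓ.2)⟩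
  minus ℓ := ⟨G.minus ℓ.1, Finset.mem_image_of_mem _ (G.minus_mem_hooked.2 ℓ.2)⟩

section Faces

variable [Fintype V]

/-- The external half-lines of the subgraph `S`: the half-lines of its vertices that are not on a
line of `S`. -/
def legs (G : Phi4Graph V L) (S : Finset L) : Finset (V × Fin 4) :=
  Finset.univ.filter fun c => c.1 ∈ G.verts S ∧ c ∉ G.hooked S

open Classical in
/-- The other end of the line of `S` at the half-line `c`; `c` itself if there is none. -/
noncomputable def across (G : Phi4Graph V L) (S : Finset L) (c : V × Fin 4) : V × Fin 4 :=
  if h : ∃ ℓ ∈ S, G.plus ℓ = c then G.minus h.choose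
  else if h : ∃ ℓ ∈ S, G.minus ℓ = c then G.plus h.choose
  else c

/-- One step along the boundary of the ribbon graph `S`. The half-line `c` stands for the angular
sector between `c` and the next half-line of its vertex. The boundary follows the next half-line
to the other end of its line; if that half-line is a leg of `S`, then the boundary passes
across it into the next sector. -/
noncomputable def faceStep (G : Phi4Graph V L) (S : Finset L) (c : V × Fin 4) : V × Fin 4 :=
  G.across S (c.1, c.2 + 1)

/-- The face of `S` that contains the sector after `c`, as a set of sectors. -/
def faceOf (G : Phi4Graph V L) (S : Finset L) (c : V × Fin 4) : Set (V × Fin 4) :=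
  {d | ∃ k : ℕ, (G.faceStep S)^[k] c = d}

/-- The faces of the subgraph `S`. -/
def faces (G : Phi4Graph V L) (S : Finset L) : Set (Set (V × Fin 4)) :=
  {f | ∃ c, c.1 ∈ G.verts S ∧ f = G.faceOf S c}

/-- The faces of `S` that are broken by an external leg of `S`. -/
def brokenFaces (G : Phi4Graph V L) (S : Finset L) : Set (Set (V × Fin 4)) :=
  {f ∈ G.faces S | ∃ c ∈ G.legs S, c ∈ f}

/-- The subgraph `S` has genus `g`: `2 - 2g = n - L + F`. -/
def HasGenus (G : Phi4Graph V L) (S : Finset L) (g : ℕ) : Prop :=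
  (2 : ℤ) - 2 * g = (G.verts S).card - S.card + (G.faces S).ncard

/-- Connected, planar, one broken face, two or four external legs. -/
def PrimitivelyDivergent (G : Phi4Graph V L) (S : Finset L) : Prop :=
  (SimpleGraph.fromRel fun v w : {v : V // v ∈ G.verts S} =>
      ∃ ℓ ∈ S, (G.plus ℓ).1 = v ∧ (G.minus ℓ).1 = w).Connected ∧
    G.HasGenus S 0 ∧ (G.brokenFaces S).ncard = 1 ∧ ((G.legs S).card = 2 ∨ (G.legs S).card = 4)

/-- `r` may serve as a root mark for `S`: `r` is a `-` half-line of a vertex of `S`, and the sector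
after `r`, where the numbering starts, lies in a broken face of `S`. -/
def IsRootMark (G : Phi4Graph V L) (S : Finset L) (r : V × Fin 4) : Prop :=
  r.1 ∈ G.verts S ∧ Odd (r.2 : ℕ) ∧ G.faceOf S r ∈ G.brokenFaces S

/-- The position of the half-line `c` on the walk along the face of `S` that starts after `r`. -/
noncomputable def firstVisit (G : Phi4Graph V L) (S : Finset L) (r c : V × Fin 4) : ℕ :=
  sInf {k : ℕ | 0 < k ∧ (G.faceStep S)^[k] r = c}

/-- The number (starting from `1`) of the leg `c` of `S` in the order in which the legs are met on
the walk along the face of `S` that starts after `r`. -/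
noncomputable def legNumber (G : Phi4Graph V L) (S : Finset L) (r c : V × Fin 4) : ℕ :=
  ((G.legs S).filter fun d => G.firstVisit S r d ≤ G.firstVisit S r c).card

/-- The graph `G/S`: the vertices and lines of `S` are replaced by one vertex `none`, whose
half-lines are the legs of `S` in the cyclic order in which they occur along the broken face of `S`,
numbered from the root mark `rS`. The rest of `G` is unchanged, and numbered with the root mark
`r`. -/
noncomputable def contract (G : Phi4Graph V L) (S : Finset L) (rS r : V × Fin 4) :
    MoyalGraph (Option {v : V // v ∉ G.verts S}) {c : V × Fin 4 // c ∉ G.hooked S}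
      {ℓ : L // ℓ ∉ S} where
  vert c := if h : c.1.1 ∈ G.verts S then none else some ⟨c.1.1, h⟩
  num c := if c.1.1 ∈ G.verts S then G.legNumber S rS c.1 else number r c.1
  plus ℓ := ⟨G.plus ℓ.1, fun h => ℓ.2 (G.plus_mem_hooked.1 h)⟩
  minus ℓ := ⟨G.minus ℓ.1, fun h => ℓ.2 (G.minus_mem_hooked.1 h)⟩

/-- The vertex of `G/S` that comes from the vertex `v` of `G`. -/
def contractVertex (G : Phi4Graph V L) (S : Finset L) (v : V) : Option {v : V // v ∉ G.verts S} :=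
  if h : v ∈ G.verts S then none else some ⟨v, h⟩

end Faces

end Phi4Graph

/-- The rescaling `t_ℓ ↦ ρ² t_ℓ` for `ℓ ∈ S`, which makes a polynomial in the `t_ℓ` a polynomial in
`ρ` with coefficients that are polynomials in the `t_ℓ`. -/
noncomputable def rescale {L : Type*} [DecidableEq L] (S : Finset L) :
    MvPolynomial L ℝ →ₐ[ℝ] Polynomial (MvPolynomial L ℝ) :=
  MvPolynomial.aeval fun ℓ =>
    if ℓ ∈ S then Polynomial.X ^ 2 * Polynomial.C (MvPolynomial.X ℓ)
    else Polynomial.C (MvPolynomial.X ℓ)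

/-- The term of minimal degree of a polynomial in `ρ` (including its power of `ρ`). -/
noncomputable def lowestTerm {R : Type*} [Semiring R] (p : Polynomial R) : Polynomial R :=
  Polynomial.monomial p.natTrailingDegree p.trailingCoeff

/-! Send `u_ℓ` to the sum and `v_ℓ` to the difference of the two ends of the line `ℓ`. The
antisymmetric part `B` is then the restriction of one antisymmetric form on half-lines and vertices
(`B_eq_congr_form`): half-lines of a vertex oscillate according to their order, and each half-line
is coupled to the hypermomentum of its vertex. The proof finds changes of variables in which the
rescaled determinant has a visible limit as `ρ → 0`.

For `S` itself, the long variables split orthogonally into cycles and cuts. Because `S` is planar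
with one broken face, the boundaries of the internal faces form a basis of the cycles: there are `L
- n + 1` of them (`card_internalFace`) and they are independent (`cycleMat_injective`). The
oscillation of a half-line with such a boundary telescopes, so that after adding suitable
hypermomenta the boundary oscillates with short variables only (`subForm_mul_cycle`). Scale short
variables by `ρ`, cycles by `ρ⁻¹`, and leave cuts and hypermomenta alone. The form converges, and
its limit splits into a block of short variables and cycles, whose symmetric part is positive
definite, and a block of cuts and hypermomenta, which contributes the square of a Laplacian
determinant. Hence `HU` of `S` behaves like `ρ` to twice the number of internal faces, times the
nonzero coefficient `leadCoeff` and the product of the `t_ℓ`. The coefficient contains no numbering,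
and it does not depend on the root, since all principal minors of the Laplacian agree.

For `G`, each leg of `S` is completed by the path along the broken face between the root mark and
the leg, and by hypermomenta; the contracted vertex receives the total hypermomentum of `S`. The
completed vectors do not oscillate with the long variables and hypermomenta of `S`
(`subIncl_transpose_mul_decoupledForm`), and among themselves they oscillate exactly like the
half-lines and vertices of `G/S` (`decoupled_transpose_mul`). This change of variables is
unitriangular, and the couplings that remain between `S` and `G/S` vanish in the limit
(`tendsto_det_blocks`). The limit of the determinant of `G` is therefore that of `S` times the
determinant of `G/S`.

Numberings away from the root may be rotated freely (`det_M_rotate`), so `S` may always be numbered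
from a sector of its broken face. Finally, limits at positive `t` determine the lowest coefficients,
because polynomials that agree on the positive orthant are equal (`lowestTerm_eq_mul_of_tendsto`).
-/

section

open Matrix Filter Topology

/-! ### Determinants and principal minors. -/

section LinearAlgebra

variable {m n : Type*} [Fintype m] [DecidableEq m] [Fintype n] [DecidableEq n]

theorem Matrix.det_ne_zero_of_mulVec_eq_zero {M : Matrix n n ℝ}
    (h : ∀ x, M *ᵥ x = 0 → x = 0) : M.det ≠ 0 := by
  intro h0
  obtain ⟨x, hx, hM⟩ := Matrix.exists_mulVec_eq_zero_iff.2 h0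
  exact hx (h x hM)

/-- A form that is the sum of a nonnegative and an antisymmetric one. -/
theorem Matrix.dotProduct_mulVec_self_eq_zero {B : Matrix n n ℝ} (hB : Bᵀ = -B) (x : n → ℝ) :
    x ⬝ᵥ B *ᵥ x = 0 := by
  have h : x ⬝ᵥ B *ᵥ x = -(x ⬝ᵥ B *ᵥ x) := by
    conv_lhs => rw [Matrix.dotProduct_mulVec, ← Matrix.mulVec_transpose, hB, dotProduct_comm]
    rw [Matrix.neg_mulVec, dotProduct_neg]
  linarith

/-- This evaluates the block of cuts and hypermomenta in the limit; the oscillation `Q` among the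
cuts drops out. -/
theorem Matrix.det_fromBlocks_neg_zero (Q R : Matrix n n ℝ) :
    (Matrix.fromBlocks Q R (-R) 0).det = R.det ^ 2 := by
  -- The product of the three unipotent factors is the quarter turn `(0, -1; 1, 0)`, which makes the
  -- matrix block triangular without a sign to keep track of.
  have h1 : Matrix.fromBlocks Q R (-R) 0 *
      (Matrix.fromBlocks 1 (-1) 0 1 * Matrix.fromBlocks 1 0 1 1 * Matrix.fromBlocks 1 (-1) 0 1) =
      (Matrix.fromBlocks R (-Q) 0 R : Matrix (n ⊕ n) (n ⊕ n) ℝ) := by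
    simp [Matrix.fromBlocks_multiply]
  have h2 := congrArg Matrix.det h1
  simp only [Matrix.det_mul, Matrix.det_fromBlocks_zero₂₁, Matrix.det_fromBlocks_zero₁₂,
    Matrix.det_one, mul_one] at h2
  rw [h2, sq]

theorem Matrix.det_transpose_mul_self_ne_zero {C : Matrix m n ℝ}
    (hC : ∀ x, C *ᵥ x = 0 → x = 0) : (Cᵀ * C).det ≠ 0 := by
  refine Matrix.det_ne_zero_of_mulVec_eq_zero fun x hx => hC x ?_
  have h : (C *ᵥ x) ⬝ᵥ (C *ᵥ x) = 0 := by
    rw [Matrix.dotProduct_mulVec, ← Matrix.mulVec_transpose, Matrix.mulVec_mulVec, hx,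
      zero_dotProduct]
  exact dotProduct_self_eq_zero.1 h

/-- The diagonal of the adjugate consists of the principal minors. -/
theorem Matrix.adjugate_self_apply (M : Matrix n n ℝ) (o : n) :
    M.adjugate o o = (M.submatrix (Subtype.val : {v // v ≠ o} → n) Subtype.val).det := by
  classical
  rw [Matrix.adjugate_apply]
  have h := Matrix.twoBlockTriangular_det (M.updateRow o (Pi.single o 1)) (fun v => v ≠ o) (by
    intro i hi j hj
    have hi' : i = o := not_not.1 hi
    subst hi'
    simp [Pi.single_apply, hj])
  rw [h]
  have h1 : (Matrix.toSquareBlockProp (M.updateRow o (Pi.single o 1)) fun v => ¬ v ≠ o).det = 1 := by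
    have : (Matrix.toSquareBlockProp (M.updateRow o (Pi.single o 1)) fun v => ¬ v ≠ o) = 1 := by
      ext ⟨i, hi⟩ ⟨j, hj⟩
      obtain rfl : i = o := not_not.1 hi
      obtain rfl : j = i := not_not.1 hj
      simp [Matrix.toSquareBlockProp]
    rw [this, Matrix.det_one]
  rw [h1, mul_one]
  congr 1
  ext ⟨i, hi⟩ ⟨j, hj⟩
  simp [Matrix.toSquareBlockProp, Matrix.updateRow_ne hi]

/-- All principal minors of a symmetric matrix whose kernel consists of constants agree. -/
theorem Matrix.det_minor_eq {M : Matrix n n ℝ} (hM : Mᵀ = M) (h1 : M *ᵥ 1 = 0)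
    (hker : ∀ x, M *ᵥ x = 0 → ∀ i j, x i = x j) (o b : n) :
    (M.submatrix (Subtype.val : {v // v ≠ o} → n) Subtype.val).det =
      (M.submatrix (Subtype.val : {v // v ≠ b} → n) Subtype.val).det := by
  rw [← Matrix.adjugate_self_apply, ← Matrix.adjugate_self_apply]
  have hd : M.det = 0 := by
    refine Matrix.exists_mulVec_eq_zero_iff.1 ⟨1, ?_, h1⟩
    intro h
    exact one_ne_zero (congrFun h o)
  -- Since the determinant vanishes, the columns of the adjugate lie in the kernel, hence are
  -- constant; with symmetry all its entries agree.
  have hcol : ∀ j i i', M.adjugate i j = M.adjugate i' j := by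
    intro j
    refine hker (fun i => M.adjugate i j) ?_
    have h := M.mul_adjugate
    rw [hd, zero_smul] at h
    ext i
    exact congrFun (congrFun h i) j
  have hsymm : ∀ i j, M.adjugate i j = M.adjugate j i := by
    intro i j
    have h := Matrix.adjugate_transpose M
    rw [hM] at h
    exact (congrFun (congrFun h i) j).symm
  rw [hcol o o b, hsymm, hcol b o b]

end LinearAlgebra

/-! ### The rescaled quadratic form and its limit. -/

section Scaling

variable {Λ Φ P : Type*} [Fintype Λ] [DecidableEq Λ] [Fintype Φ] [DecidableEq Φ]
  [Fintype P] [DecidableEq P]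

/-- The diagonal part of the quadratic form. -/
noncomputable def diagPart (P : Type*) [DecidableEq P] (t : Λ → ℝ) :
    Matrix ((Λ ⊕ Λ) ⊕ P) ((Λ ⊕ Λ) ⊕ P) ℝ :=
  Matrix.diagonal (Sum.elim (Sum.elim (fun ℓ => 1 / t ℓ) t) fun _ => 0)

/-- The vectors adapted to a splitting of the long variables into cycles `Z` and cuts `C`. -/
def adaptedBasis (Z : Matrix Λ Φ ℝ) (C : Matrix Λ P ℝ) (π : Matrix P Φ ℝ) :
    Matrix ((Λ ⊕ Λ) ⊕ P) ((Λ ⊕ Φ) ⊕ (P ⊕ P)) ℝ :=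
  Matrix.fromCols
    (Matrix.fromCols (Matrix.fromRows (Matrix.fromRows 1 0) 0)
      (Matrix.fromRows (Matrix.fromRows 0 Z) π))
    (Matrix.fromCols (Matrix.fromRows (Matrix.fromRows 0 C) 0) (Matrix.fromRows 0 1))

/-- The powers of `ρ` that scale the adapted vectors. -/
noncomputable def scaleVec (Λ Φ P : Type*) (ρ : ℝ) : (Λ ⊕ Φ) ⊕ (P ⊕ P) → ℝ :=
  Sum.elim (Sum.elim (fun _ => ρ) fun _ => ρ⁻¹) fun _ => 1

/-- The limit of the rescaled form in the adapted basis. -/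
noncomputable def limitForm (N Z : Matrix Λ Φ ℝ) (Q R : Matrix P P ℝ) (t : Λ → ℝ) :
    Matrix ((Λ ⊕ Φ) ⊕ (P ⊕ P)) ((Λ ⊕ Φ) ⊕ (P ⊕ P)) ℝ :=
  Matrix.fromBlocks
    (Matrix.fromBlocks (Matrix.diagonal fun ℓ => 1 / t ℓ) N (-Nᵀ) (Zᵀ * Matrix.diagonal t * Z))
    0 0 (Matrix.fromBlocks Q R (-R) 0)

theorem adapted_mul_apply {I J : Type*} [Fintype I] [DecidableEq J] [Fintype J] (T : Matrix I J ℝ) (M : Matrix I I ℝ)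
    (d : J → ℝ) (i j : J) :
    ((T * Matrix.diagonal d)ᵀ * M * (T * Matrix.diagonal d)) i j =
      d i * d j * (Tᵀ * M * T) i j := by
  have : (T * Matrix.diagonal d)ᵀ * M * (T * Matrix.diagonal d) =
      Matrix.diagonal d * (Tᵀ * M * T) * Matrix.diagonal d := by
    simp [Matrix.transpose_mul, Matrix.mul_assoc]
  rw [this, Matrix.mul_diagonal, Matrix.diagonal_mul]
  ring

theorem diagPart_congr_apply {J : Type*} [Fintype J] (T : Matrix ((Λ ⊕ Λ) ⊕ P) J ℝ) (t : Λ → ℝ)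
    (i j : J) :
    (Tᵀ * diagPart P t * T) i j =
      ∑ ℓ, 1 / t ℓ * (T (Sum.inl (Sum.inl ℓ)) i * T (Sum.inl (Sum.inl ℓ)) j) +
        ∑ ℓ, t ℓ * (T (Sum.inl (Sum.inr ℓ)) i * T (Sum.inl (Sum.inr ℓ)) j) := by
  rw [Matrix.mul_apply]
  simp only [diagPart, Matrix.mul_diagonal, Matrix.transpose_apply, Fintype.sum_sum_type,
    Sum.elim_inl, Sum.elim_inr, mul_zero, zero_mul, Finset.sum_const_zero, add_zero]
  congr 1 <;> exact Finset.sum_congr rfl fun _ _ => by ring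

/-- The only negative powers of `ρ` come from cycles and from `1 / t`. By `hz` a completed cycle
meets only short components, so its coupling to the short variables scales as `ρ⁻¹ * ρ`, while its
couplings by `B` to cycles, cuts and hypermomenta vanish. The factor `ρ²` of the long diagonal
compensates two cycles, and `ρ⁻²` of the short diagonal two short variables. -/
theorem tendsto_scaled_form {B : Matrix ((Λ ⊕ Λ) ⊕ P) ((Λ ⊕ Λ) ⊕ P) ℝ} (hB : Bᵀ = -B)
    (Z : Matrix Λ Φ ℝ) (C : Matrix Λ P ℝ) (π : Matrix P Φ ℝ) (N : Matrix Λ Φ ℝ)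
    (hvp : ∀ ℓ j, B (Sum.inl (Sum.inr ℓ)) (Sum.inr j) = C ℓ j)
    (hpp : ∀ i j, B (Sum.inr i) (Sum.inr j) = 0)
    (hz : B * Matrix.fromRows (Matrix.fromRows 0 Z) π =
      Matrix.fromRows (Matrix.fromRows N 0) 0) (t : Λ → ℝ) :
    ∃ Q : Matrix P P ℝ, Tendsto (fun ρ : ℝ =>
        (adaptedBasis Z C π * Matrix.diagonal (scaleVec Λ Φ P ρ))ᵀ *
          (diagPart P (fun ℓ => ρ ^ 2 * t ℓ) + B) *
          (adaptedBasis Z C π * Matrix.diagonal (scaleVec Λ Φ P ρ)))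
      (𝓝[>] 0) (𝓝 (limitForm N Z Q (Cᵀ * C) t)) := by
  set T := adaptedBasis Z C π with hT
  set B' := Tᵀ * B * T with hB'
  have hB'T : ∀ i j, B' i j = - B' j i := by
    intro i j
    have : B'ᵀ = -B' := by
      simp [hB', Matrix.transpose_mul, hB, Matrix.mul_assoc]
    have := congrFun (congrFun this j) i
    simpa using this
  have hzc : ∀ i f, B' i (Sum.inl (Sum.inr f)) =
      ∑ ℓ, T (Sum.inl (Sum.inl ℓ)) i * N ℓ f := by
    intro i f
    have h : ∀ k, (B * T) k (Sum.inl (Sum.inr f)) =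
        (Matrix.fromRows (Matrix.fromRows N 0) 0 : Matrix ((Λ ⊕ Λ) ⊕ P) Φ ℝ) k f := by
      intro k
      rw [← hz]
      rfl
    rw [hB', Matrix.mul_assoc, Matrix.mul_apply]
    simp only [h, Matrix.transpose_apply, Fintype.sum_sum_type]
    simp
  have hyp : ∀ i j, B' (Sum.inr (Sum.inl i)) (Sum.inr (Sum.inr j)) = (Cᵀ * C) i j := by
    intro i j
    have h : ∀ k, (B * T) k (Sum.inr (Sum.inr j)) = B k (Sum.inr j) := by
      intro k
      rw [Matrix.mul_apply, Fintype.sum_sum_type]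
      simp [hT, adaptedBasis, Matrix.one_apply]
    rw [hB', Matrix.mul_assoc, Matrix.mul_apply]
    simp only [h, Matrix.transpose_apply, Fintype.sum_sum_type]
    simp [hT, adaptedBasis, hvp, Matrix.mul_apply]
  have hpp' : ∀ i j, B' (Sum.inr (Sum.inr i)) (Sum.inr (Sum.inr j)) = 0 := by
    intro i j
    have h : ∀ k, (B * T) k (Sum.inr (Sum.inr j)) = B k (Sum.inr j) := by
      intro k
      rw [Matrix.mul_apply, Fintype.sum_sum_type]
      simp [hT, adaptedBasis, Matrix.one_apply]
    rw [hB', Matrix.mul_assoc, Matrix.mul_apply]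
    simp only [h, Matrix.transpose_apply, Fintype.sum_sum_type]
    simp [hT, adaptedBasis, hpp]
  refine ⟨fun i j => B' (Sum.inr (Sum.inl i)) (Sum.inr (Sum.inl j)), ?_⟩
  refine tendsto_pi_nhds.2 fun i => tendsto_pi_nhds.2 fun j => ?_
  have hpos : ∀ᶠ ρ : ℝ in 𝓝[>] 0, ρ ≠ 0 := by
    filter_upwards [self_mem_nhdsWithin] with ρ hρ using (ne_of_gt hρ)
  -- Each entry agrees for `ρ ≠ 0` with a polynomial in `ρ`, whose value at `0` is the limit.
  have key : ∀ (f g : ℝ → ℝ) (c : ℝ), (∀ ρ ≠ 0, f ρ = g ρ) → Continuous g → g 0 = c →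
      Tendsto f (𝓝[>] 0) (𝓝 c) := by
    intro f g c h hg hc
    have h1 : Tendsto g (𝓝[>] 0) (𝓝 c) := by
      rw [← hc]; exact hg.continuousAt.tendsto.mono_left nhdsWithin_le_nhds
    refine h1.congr' ?_
    filter_upwards [hpos] with ρ hρ using (h ρ hρ).symm
  simp only [adapted_mul_apply, Matrix.mul_add, Matrix.add_mul, Matrix.add_apply,
    diagPart_congr_apply, ← hB']
  have hs : ∀ (ρ : ℝ) (F : Λ → ℝ), ∑ ℓ, ρ ^ 2 * t ℓ * F ℓ = ρ ^ 2 * ∑ ℓ, t ℓ * F ℓ := by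
    intro ρ F; rw [Finset.mul_sum]; exact Finset.sum_congr rfl fun _ _ => by ring
  have hs' : ∀ (ρ : ℝ) (F : Λ → ℝ), ∑ ℓ, 1 / (ρ ^ 2 * t ℓ) * F ℓ =
      (ρ ^ 2)⁻¹ * ∑ ℓ, 1 / t ℓ * F ℓ := by
    intro ρ F; rw [Finset.mul_sum]; exact Finset.sum_congr rfl fun _ _ => by
      rw [one_div, mul_inv]; ring
  simp only [hs, hs']
  rcases i with (i | i) | (i | i) <;> rcases j with (j | j) | (j | j)
  · refine key _ (fun ρ => (Matrix.diagonal (fun ℓ => 1 / t ℓ) i j : ℝ) +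
      ρ ^ 2 * B' (Sum.inl (Sum.inl i)) (Sum.inl (Sum.inl j))) _ ?_ (by fun_prop)
      (by simp [limitForm])
    intro ρ hρ
    by_cases hij : i = j
    · subst hij
      simp [scaleVec, hT, adaptedBasis, Matrix.one_apply]
      field_simp
    · simp [scaleVec, hT, adaptedBasis, Matrix.one_apply, hij, Ne.symm hij, sq]
  · refine key _ (fun _ => N i j) _ ?_ (by fun_prop) (by simp [limitForm])
    intro ρ hρ
    rw [hzc]
    simp [scaleVec, hT, adaptedBasis, Matrix.one_apply, hρ]
  · refine key _ (fun ρ => ρ * B' (Sum.inl (Sum.inl i)) (Sum.inr (Sum.inl j))) _ ?_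
      (by fun_prop) (by simp [limitForm])
    intro ρ hρ
    simp [scaleVec, hT, adaptedBasis, Matrix.one_apply]
  · refine key _ (fun ρ => ρ * B' (Sum.inl (Sum.inl i)) (Sum.inr (Sum.inr j))) _ ?_
      (by fun_prop) (by simp [limitForm])
    intro ρ hρ
    simp [scaleVec, hT, adaptedBasis, Matrix.one_apply]
  · refine key _ (fun _ => - N j i) _ ?_ (by fun_prop) (by simp [limitForm])
    intro ρ hρ
    rw [hB'T, hzc]
    simp [scaleVec, hT, adaptedBasis, Matrix.one_apply, hρ]
  · refine key _ (fun ρ => (Zᵀ * Matrix.diagonal t * Z) i j) _ ?_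
      (by fun_prop) (by simp [limitForm])
    intro ρ hρ
    rw [hzc, Matrix.mul_apply]
    simp [scaleVec, hT, adaptedBasis, Matrix.one_apply]
    field_simp
    exact Finset.sum_congr rfl fun _ _ => by ring
  · refine key _ (fun ρ => ρ * ∑ ℓ, t ℓ * (Z ℓ i * C ℓ j)) _ ?_
      (by fun_prop) (by simp [limitForm])
    intro ρ hρ
    rw [hB'T, hzc]
    simp [scaleVec, hT, adaptedBasis, Matrix.one_apply]
    field_simp
  · refine key _ (fun ρ => 0) _ ?_ (by fun_prop) (by simp [limitForm])
    intro ρ hρ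
    rw [hB'T, hzc]
    simp [scaleVec, hT, adaptedBasis, Matrix.one_apply]
  · refine key _ (fun ρ => ρ * B' (Sum.inr (Sum.inl i)) (Sum.inl (Sum.inl j))) _ ?_
      (by fun_prop) (by simp [limitForm])
    intro ρ hρ
    simp [scaleVec, hT, adaptedBasis, Matrix.one_apply]
  · refine key _ (fun ρ => ρ * ∑ ℓ, t ℓ * (C ℓ i * Z ℓ j)) _ ?_
      (by fun_prop) (by simp [limitForm])
    intro ρ hρ
    rw [hzc]
    simp [scaleVec, hT, adaptedBasis, Matrix.one_apply]
    field_simp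
  · refine key _ (fun ρ => ρ ^ 2 * ∑ ℓ, t ℓ * (C ℓ i * C ℓ j) +
      B' (Sum.inr (Sum.inl i)) (Sum.inr (Sum.inl j))) _ ?_ (by fun_prop)
      (by simp [limitForm]; rfl)
    intro ρ hρ
    simp [scaleVec, hT, adaptedBasis, Matrix.one_apply]
  · refine key _ (fun ρ => (Cᵀ * C) i j) _ ?_ (by fun_prop) (by simp [limitForm]; rfl)
    intro ρ hρ
    rw [hyp]
    simp [scaleVec, hT, adaptedBasis, Matrix.one_apply]
  · refine key _ (fun ρ => ρ * B' (Sum.inr (Sum.inr i)) (Sum.inl (Sum.inl j))) _ ?_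
      (by fun_prop) (by simp [limitForm])
    intro ρ hρ
    simp [scaleVec, hT, adaptedBasis, Matrix.one_apply]
  · refine key _ (fun ρ => 0) _ ?_ (by fun_prop) (by simp [limitForm])
    intro ρ hρ
    rw [hzc]
    simp [scaleVec, hT, adaptedBasis, Matrix.one_apply]
  · refine key _ (fun ρ => - (Cᵀ * C) j i) _ ?_ (by fun_prop) (by
      have h : (Cᵀ * C)ᵀ = Cᵀ * C := by simp
      rw [show (Cᵀ * C) j i = (Cᵀ * C) i j from congrFun (congrFun h i) j]
      simp [limitForm]
      rfl)
    intro ρ hρ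
    rw [hB'T, hyp]
    simp [scaleVec, hT, adaptedBasis, Matrix.one_apply]
  · refine key _ (fun ρ => 0) _ ?_ (by fun_prop) (by simp [limitForm]; rfl)
    intro ρ hρ
    rw [hpp']
    simp [scaleVec, hT, adaptedBasis, Matrix.one_apply]

theorem det_limitForm (N Z : Matrix Λ Φ ℝ) (Q R : Matrix P P ℝ) (t : Λ → ℝ) :
    (limitForm N Z Q R t).det =
      (Matrix.fromBlocks (Matrix.diagonal fun ℓ => 1 / t ℓ) N (-Nᵀ)
        (Zᵀ * Matrix.diagonal t * Z)).det * R.det ^ 2 := by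
  rw [limitForm, Matrix.det_fromBlocks_zero₂₁, Matrix.det_fromBlocks_neg_zero]

/-- The matrix is a positive definite form plus an antisymmetric one; injectivity of `Z` makes the
cycle part definite. -/
theorem det_cycleBlock_ne_zero (N Z : Matrix Λ Φ ℝ) (hZ : ∀ x, Z *ᵥ x = 0 → x = 0)
    (t : Λ → ℝ) (ht : ∀ ℓ, 0 < t ℓ) :
    (Matrix.fromBlocks (Matrix.diagonal fun ℓ => 1 / t ℓ) N (-Nᵀ)
        (Zᵀ * Matrix.diagonal t * Z)).det ≠ 0 := by
  refine Matrix.det_ne_zero_of_mulVec_eq_zero fun x hx => ?_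
  have hsplit : Matrix.fromBlocks (Matrix.diagonal fun ℓ => 1 / t ℓ) N (-Nᵀ)
        (Zᵀ * Matrix.diagonal t * Z) =
      Matrix.fromBlocks (Matrix.diagonal fun ℓ => 1 / t ℓ) 0 0 (Zᵀ * Matrix.diagonal t * Z) +
      Matrix.fromBlocks 0 N (-Nᵀ) 0 := by
    simp [Matrix.fromBlocks_add]
  have hanti : (Matrix.fromBlocks 0 N (-Nᵀ) 0 : Matrix (Λ ⊕ Φ) (Λ ⊕ Φ) ℝ)ᵀ =
      -Matrix.fromBlocks 0 N (-Nᵀ) 0 := by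
    simp [Matrix.fromBlocks_transpose, Matrix.fromBlocks_neg]
  have h0 : x ⬝ᵥ (Matrix.fromBlocks (Matrix.diagonal fun ℓ => 1 / t ℓ) 0 0
      (Zᵀ * Matrix.diagonal t * Z) *ᵥ x) = 0 := by
    have h := congrArg (fun y => x ⬝ᵥ y) hx
    simp only [hsplit, Matrix.add_mulVec, dotProduct_add, dotProduct_zero,
      Matrix.dotProduct_mulVec_self_eq_zero hanti, add_zero] at h
    exact h
  obtain ⟨a, b, rfl⟩ : ∃ a b, x = Sum.elim a b :=
    ⟨x ∘ Sum.inl, x ∘ Sum.inr, (Sum.elim_comp_inl_inr x).symm⟩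
  rw [Matrix.fromBlocks_mulVec] at h0
  have hb : b ⬝ᵥ ((Zᵀ * Matrix.diagonal t * Z) *ᵥ b) =
      ∑ ℓ, t ℓ * (Z *ᵥ b) ℓ ^ 2 := by
    rw [← Matrix.mulVec_mulVec, ← Matrix.mulVec_mulVec, Matrix.dotProduct_mulVec,
      ← Matrix.mulVec_transpose, Matrix.transpose_transpose]
    simp only [dotProduct, Matrix.mulVec_diagonal]
    exact Finset.sum_congr rfl fun _ _ => by ring
  have ha : a ⬝ᵥ ((Matrix.diagonal fun ℓ => 1 / t ℓ) *ᵥ a) = ∑ ℓ, 1 / t ℓ * a ℓ ^ 2 := by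
    simp only [dotProduct, Matrix.mulVec_diagonal]
    exact Finset.sum_congr rfl fun _ _ => by ring
  have h1 : ∑ ℓ, 1 / t ℓ * a ℓ ^ 2 + ∑ ℓ, t ℓ * (Z *ᵥ b) ℓ ^ 2 = 0 := by
    rw [← ha, ← hb, ← h0]
    simp [dotProduct]
  have hpa : ∀ ℓ, 0 ≤ 1 / t ℓ * a ℓ ^ 2 := fun ℓ =>
    mul_nonneg (one_div_pos.2 (ht ℓ)).le (sq_nonneg _)
  have hpb : ∀ ℓ, 0 ≤ t ℓ * (Z *ᵥ b) ℓ ^ 2 := fun ℓ => mul_nonneg (ht ℓ).le (sq_nonneg _)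
  have hsa := Finset.sum_nonneg fun ℓ (_ : ℓ ∈ Finset.univ) => hpa ℓ
  have hsb := Finset.sum_nonneg fun ℓ (_ : ℓ ∈ Finset.univ) => hpb ℓ
  have ha0 : a = 0 := by
    ext ℓ
    have h := (Finset.sum_eq_zero_iff_of_nonneg fun ℓ _ => hpa ℓ).1 (by linarith) ℓ
      (Finset.mem_univ _)
    simpa [(ht ℓ).ne'] using h
  have hb0 : b = 0 := by
    refine hZ b ?_
    ext ℓ
    have h := (Finset.sum_eq_zero_iff_of_nonneg fun ℓ _ => hpb ℓ).1 (by linarith) ℓ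
      (Finset.mem_univ _)
    simpa [(ht ℓ).ne'] using h
  subst ha0 hb0
  exact Sum.elim_zero_zero

/-- The Gram matrix of an orthogonal splitting is block diagonal. Taking the square removes the sign
that the arbitrary bijection `ε` would introduce. -/
theorem det_splitting_sq (Z : Matrix Λ Φ ℝ) (C : Matrix Λ P ℝ) (hCZ : Cᵀ * Z = 0)
    (ε : Λ ≃ Φ ⊕ P) :
    ((Matrix.fromCols Z C).submatrix id ε).det ^ 2 = (Zᵀ * Z).det * (Cᵀ * C).det := by
  have hZC : Zᵀ * C = 0 := by
    have := congrArg Matrix.transpose hCZ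
    simpa [Matrix.transpose_mul] using this
  have h : ((Matrix.fromCols Z C).submatrix id ε)ᵀ * (Matrix.fromCols Z C).submatrix id ε =
      (Matrix.fromBlocks (Zᵀ * Z) 0 0 (Cᵀ * C)).submatrix ε ε := by
    rw [Matrix.transpose_submatrix, Matrix.submatrix_mul _ _ ε id ε Function.bijective_id
      |>.symm, Matrix.transpose_fromCols, Matrix.fromRows_mul_fromCols, hZC, hCZ]
  have h2 := congrArg Matrix.det h
  rw [Matrix.det_mul, Matrix.det_transpose, Matrix.det_submatrix_equiv_self,
    Matrix.det_fromBlocks_zero₂₁] at h2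
  rw [sq, h2]

/-- The reindexing of the variables along a splitting of the long variables. -/
def splitEquiv (ε : Λ ≃ Φ ⊕ P) : (Λ ⊕ Λ) ⊕ P ≃ (Λ ⊕ Φ) ⊕ (P ⊕ P) :=
  ((Equiv.sumCongr (Equiv.sumCongr (Equiv.refl Λ) ε) (Equiv.refl P)).trans
    (Equiv.sumCongr (Equiv.sumAssoc Λ Φ P).symm (Equiv.refl P))).trans
    (Equiv.sumAssoc (Λ ⊕ Φ) P P)

/-- The adapted basis, scaled with powers of `ρ` and turned into a square matrix. -/
noncomputable def scaledBasis (Z : Matrix Λ Φ ℝ) (C : Matrix Λ P ℝ) (π : Matrix P Φ ℝ)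
    (ε : Λ ≃ Φ ⊕ P) (ρ : ℝ) : Matrix ((Λ ⊕ Λ) ⊕ P) ((Λ ⊕ Λ) ⊕ P) ℝ :=
  (adaptedBasis Z C π * Matrix.diagonal (scaleVec Λ Φ P ρ)).submatrix id
    (splitEquiv ε)

/-- The short variables contribute `ρ` to the power `|Λ|` and the cycles `ρ⁻¹` to the power `|Φ|`;
the surplus `|Λ| - |Φ| = |P|` is the number of cuts. -/
theorem det_scaledBasis_sq (Z : Matrix Λ Φ ℝ) (C : Matrix Λ P ℝ) (π : Matrix P Φ ℝ)
    (hCZ : Cᵀ * Z = 0) (ε : Λ ≃ Φ ⊕ P) (ρ : ℝ) (hρ : ρ ≠ 0) :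
    (scaledBasis Z C π ε ρ).det ^ 2 =
      ρ ^ (2 * Fintype.card P) * ((Zᵀ * Z).det * (Cᵀ * C).det) := by
  have hV : ((Matrix.fromCols (ρ⁻¹ • Z) C).submatrix id ε).det =
      ρ⁻¹ ^ Fintype.card Φ * ((Matrix.fromCols Z C).submatrix id ε).det := by
    have : (Matrix.fromCols (ρ⁻¹ • Z) C).submatrix id ε =
        (Matrix.fromCols Z C).submatrix id ε *
          (Matrix.diagonal (Sum.elim (fun _ => ρ⁻¹) fun _ => 1)).submatrix ε ε := by
      rw [Matrix.submatrix_mul_equiv]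
      ext i j
      rcases h : ε j with k | k <;> simp [Matrix.mul_diagonal, h, mul_comm]
    rw [this, Matrix.det_mul, Matrix.det_submatrix_equiv_self, Matrix.det_diagonal]
    simp [Fintype.prod_sum_type, mul_comm]
  -- The hypermomenta that complete the cycles sit in the lower left block `R`, which does not
  -- affect the determinant.
  have hblock : ∃ R, scaledBasis Z C π ε ρ =
      Matrix.fromBlocks (Matrix.fromBlocks (Matrix.diagonal fun _ => ρ) 0 0
        ((Matrix.fromCols (ρ⁻¹ • Z) C).submatrix id ε)) 0 R 1 := by
    refine ⟨(scaledBasis Z C π ε ρ).toBlocks₂₁, ?_⟩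
    ext i j
    rcases i with (i | i) | i <;> rcases j with (j | j) | j
    · simp [scaledBasis, splitEquiv, adaptedBasis, scaleVec, Matrix.one_apply, Matrix.diagonal_apply]
    · rcases h : ε j with k | k <;> simp [scaledBasis, splitEquiv, adaptedBasis, scaleVec, h]
    · simp [scaledBasis, splitEquiv, adaptedBasis, scaleVec]
    · simp [scaledBasis, splitEquiv, adaptedBasis, scaleVec]
    · rcases h : ε j with k | k <;> simp [scaledBasis, splitEquiv, adaptedBasis, scaleVec, h, mul_comm]
    · simp [scaledBasis, splitEquiv, adaptedBasis, scaleVec]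
    · simp [Matrix.toBlocks₂₁]
    · simp [Matrix.toBlocks₂₁]
    · simp [scaledBasis, splitEquiv, adaptedBasis, scaleVec]
  obtain ⟨R, hR⟩ := hblock
  rw [hR, Matrix.det_fromBlocks_zero₁₂, Matrix.det_fromBlocks_zero₂₁, Matrix.det_one, mul_one,
    Matrix.det_diagonal, hV, ← det_splitting_sq Z C hCZ ε]
  have hc : Fintype.card Λ = Fintype.card Φ + Fintype.card P := by
    rw [Fintype.card_congr ε, Fintype.card_sum]
  rw [Finset.prod_const, Finset.card_univ, hc, pow_add, two_mul, pow_add]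
  have h1 : ρ ^ Fintype.card Φ * ρ⁻¹ ^ Fintype.card Φ = 1 := by
    rw [← mul_pow, mul_inv_cancel₀ hρ, one_pow]
  calc _ = (ρ ^ Fintype.card Φ * ρ⁻¹ ^ Fintype.card Φ) ^ 2 *
        (ρ ^ Fintype.card P * ρ ^ Fintype.card P) *
        ((Matrix.fromCols Z C).submatrix id ε).det ^ 2 := by ring
    _ = _ := by rw [h1]; ring

theorem tendsto_scaledBasis_congr {B : Matrix ((Λ ⊕ Λ) ⊕ P) ((Λ ⊕ Λ) ⊕ P) ℝ} (hB : Bᵀ = -B)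
    (Z : Matrix Λ Φ ℝ) (C : Matrix Λ P ℝ) (π : Matrix P Φ ℝ) (N : Matrix Λ Φ ℝ)
    (hvp : ∀ ℓ j, B (Sum.inl (Sum.inr ℓ)) (Sum.inr j) = C ℓ j)
    (hpp : ∀ i j, B (Sum.inr i) (Sum.inr j) = 0)
    (hz : B * Matrix.fromRows (Matrix.fromRows 0 Z) π =
      Matrix.fromRows (Matrix.fromRows N 0) 0) (ε : Λ ≃ Φ ⊕ P) (t : Λ → ℝ) :
    ∃ N₀ : Matrix ((Λ ⊕ Λ) ⊕ P) ((Λ ⊕ Λ) ⊕ P) ℝ,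
      Tendsto (fun ρ : ℝ => (scaledBasis Z C π ε ρ)ᵀ *
          (diagPart P (fun ℓ => ρ ^ 2 * t ℓ) + B) * scaledBasis Z C π ε ρ) (𝓝[>] 0) (𝓝 N₀) ∧
      N₀.det = (Matrix.fromBlocks (Matrix.diagonal fun ℓ => 1 / t ℓ) N (-Nᵀ)
        (Zᵀ * Matrix.diagonal t * Z)).det * (Cᵀ * C).det ^ 2 := by
  obtain ⟨Q, hQ⟩ := tendsto_scaled_form hB Z C π N hvp hpp hz t
  refine ⟨(limitForm N Z Q (Cᵀ * C) t).submatrix (splitEquiv ε) (splitEquiv ε), ?_,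
    (Matrix.det_submatrix_equiv_self _ _).trans (det_limitForm N Z Q (Cᵀ * C) t)⟩
  refine tendsto_pi_nhds.2 fun i => tendsto_pi_nhds.2 fun j => ?_
  exact tendsto_pi_nhds.1 (tendsto_pi_nhds.1 hQ _) _

/-- Together with `tendsto_scaledBasis_long` this is all that is needed about the basis to kill the
couplings between `S` and the rest of the graph. -/
theorem tendsto_scaledBasis_short (Z : Matrix Λ Φ ℝ) (C : Matrix Λ P ℝ) (π : Matrix P Φ ℝ)
    (ε : Λ ≃ Φ ⊕ P) (ℓ : Λ) (k) :
    Tendsto (fun ρ => scaledBasis Z C π ε ρ (Sum.inl (Sum.inl ℓ)) k) (𝓝[>] 0) (𝓝 0) := by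
  have h0 : Tendsto (fun ρ : ℝ => ρ) (𝓝[>] 0) (𝓝 0) :=
    tendsto_id.mono_left nhdsWithin_le_nhds
  rcases k with (k | k) | k
  · have := h0.const_mul ((1 : Matrix Λ Λ ℝ) ℓ k)
    simpa [scaledBasis, splitEquiv, adaptedBasis, scaleVec] using this
  · rcases h : ε k with j | j <;> simp [scaledBasis, splitEquiv, adaptedBasis, scaleVec, h]
  · simp [scaledBasis, splitEquiv, adaptedBasis, scaleVec]

theorem tendsto_scaledBasis_long (Z : Matrix Λ Φ ℝ) (C : Matrix Λ P ℝ) (π : Matrix P Φ ℝ)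
    (ε : Λ ≃ Φ ⊕ P) (ℓ : Λ) (k) :
    Tendsto (fun ρ => ρ ^ 2 * scaledBasis Z C π ε ρ (Sum.inl (Sum.inr ℓ)) k) (𝓝[>] 0) (𝓝 0) := by
  have h0 : Tendsto (fun ρ : ℝ => ρ) (𝓝[>] 0) (𝓝 0) :=
    tendsto_id.mono_left nhdsWithin_le_nhds
  rcases k with (k | k) | k
  · simp [scaledBasis, splitEquiv, adaptedBasis, scaleVec]
  · rcases h : ε k with j | j
    · have h1 := h0.const_mul (Z ℓ j)
      rw [mul_zero] at h1
      refine h1.congr' ?_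
      filter_upwards [self_mem_nhdsWithin] with ρ hρ
      have : ρ ≠ 0 := ne_of_gt hρ
      simp [scaledBasis, splitEquiv, adaptedBasis, scaleVec, h]
      field_simp
    · have h1 := (h0.pow 2).mul_const (C ℓ j)
      simpa [scaledBasis, splitEquiv, adaptedBasis, scaleVec, h] using h1
  · simp [scaledBasis, splitEquiv, adaptedBasis, scaleVec]

end Scaling

/-! ### Lowest coefficients from asymptotics. -/

section LowestTerm

theorem Polynomial.tendsto_eval_div_pow (p : Polynomial ℝ) (n : ℕ) (h : ∀ k < n, p.coeff k = 0) :
    Tendsto (fun ρ : ℝ => p.eval ρ / ρ ^ n) (𝓝[>] 0) (𝓝 (p.coeff n)) := by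
  obtain ⟨q, rfl⟩ := Polynomial.X_pow_dvd_iff.2 h
  have h1 : Tendsto (fun ρ : ℝ => q.eval ρ) (𝓝[>] 0) (𝓝 (q.eval 0)) :=
    q.continuous.continuousAt.tendsto.mono_left nhdsWithin_le_nhds
  have h2 : (Polynomial.X ^ n * q).coeff n = q.eval 0 := by
    rw [Polynomial.coeff_X_pow_mul', if_pos le_rfl, Nat.sub_self, Polynomial.coeff_zero_eq_eval_zero]
  rw [h2]
  refine h1.congr' ?_
  filter_upwards [self_mem_nhdsWithin] with ρ hρ
  have : ρ ^ n ≠ 0 := pow_ne_zero _ (ne_of_gt hρ)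
  rw [Polynomial.eval_mul, Polynomial.eval_pow, Polynomial.eval_X, mul_div_cancel_left₀ _ this]

/-- A nonzero coefficient below `n` would make the quotient unbounded near `0`. The induction
removes the coefficients one at a time: the quotient by `ρ ^ k` is the convergent quotient times a
positive power of `ρ`. -/
theorem Polynomial.coeff_of_tendsto_eval_div_pow (p : Polynomial ℝ) (n : ℕ) (a : ℝ)
    (h : Tendsto (fun ρ : ℝ => p.eval ρ / ρ ^ n) (𝓝[>] 0) (𝓝 a)) :
    (∀ k < n, p.coeff k = 0) ∧ p.coeff n = a := by
  have hlow : ∀ k < n, p.coeff k = 0 := by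
    intro k
    induction k using Nat.strong_induction_on with
    | _ k ih =>
      intro hk
      have h1 := p.tendsto_eval_div_pow k fun j hj => ih j hj (hj.trans hk)
      have h0 : Tendsto (fun ρ : ℝ => ρ ^ (n - k)) (𝓝[>] 0) (𝓝 0) := by
        have : Tendsto (fun ρ : ℝ => ρ ^ (n - k)) (𝓝 0) (𝓝 (0 ^ (n - k))) :=
          (continuous_pow _).continuousAt
        rw [zero_pow (by omega)] at this
        exact this.mono_left nhdsWithin_le_nhds
      have h2 := h.mul h0
      rw [mul_zero] at h2
      refine tendsto_nhds_unique (h1.congr' ?_) h2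
      filter_upwards [self_mem_nhdsWithin] with ρ hρ
      have hρ' : ρ ≠ 0 := ne_of_gt hρ
      have : ρ ^ n = ρ ^ k * ρ ^ (n - k) := by rw [← pow_add]; congr 1; omega
      rw [this]
      field_simp
  exact ⟨hlow, tendsto_nhds_unique (p.tendsto_eval_div_pow n hlow) h⟩

variable {L : Type*}

theorem MvPolynomial.eq_of_eval_eq_of_pos [Finite L] {p q : MvPolynomial L ℝ}
    (h : ∀ t : L → ℝ, (∀ ℓ, 0 < t ℓ) → MvPolynomial.eval t p = MvPolynomial.eval t q) : p = q := by
  refine MvPolynomial.funext_set (fun _ => Set.Ioi 0) (fun _ => Set.Ioi_infinite _) ?_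
  intro t ht
  exact h t fun ℓ => ht ℓ (Set.mem_univ _)

theorem lowestTerm_eq {R : Type*} [Semiring R] {p : Polynomial R} {n : ℕ} {a : R} (ha : a ≠ 0)
    (hlow : ∀ k < n, p.coeff k = 0) (hn : p.coeff n = a) :
    lowestTerm p = Polynomial.monomial n a := by
  have hp : p.natTrailingDegree = n := by
    refine le_antisymm (Polynomial.natTrailingDegree_le_of_ne_zero (hn ▸ ha)) ?_
    by_contra hlt
    have hp0 : p ≠ 0 := by
      rintro rfl
      exact ha (by simpa using hn.symm)
    exact Polynomial.trailingCoeff_nonzero_iff_nonzero.2 hp0 (hlow _ (not_le.1 hlt))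
  rw [lowestTerm, Polynomial.trailingCoeff, hp, hn]

/-- The lowest terms are determined by the asymptotics at positive arguments. -/
theorem lowestTerm_eq_mul_of_tendsto [Finite L] {p q : Polynomial (MvPolynomial L ℝ)}
    {b : MvPolynomial L ℝ} (n : ℕ) (a : (L → ℝ) → ℝ)
    (ha : ∀ t : L → ℝ, (∀ ℓ, 0 < t ℓ) → a t ≠ 0)
    (hb : ∀ t : L → ℝ, (∀ ℓ, 0 < t ℓ) → MvPolynomial.eval t b ≠ 0)
    (hq : ∀ t : L → ℝ, (∀ ℓ, 0 < t ℓ) → Tendsto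
      (fun ρ : ℝ => (q.map (MvPolynomial.eval t)).eval ρ / ρ ^ n) (𝓝[>] 0) (𝓝 (a t)))
    (hp : ∀ t : L → ℝ, (∀ ℓ, 0 < t ℓ) → Tendsto
      (fun ρ : ℝ => (p.map (MvPolynomial.eval t)).eval ρ / ρ ^ n) (𝓝[>] 0)
      (𝓝 (a t * MvPolynomial.eval t b))) :
    lowestTerm p = lowestTerm q * Polynomial.C b := by
  have hqc := fun t ht => Polynomial.coeff_of_tendsto_eval_div_pow _ n _ (hq t ht)
  have hpc := fun t ht => Polynomial.coeff_of_tendsto_eval_div_pow _ n _ (hp t ht)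
  simp only [Polynomial.coeff_map] at hqc hpc
  have hql : ∀ k < n, q.coeff k = 0 := fun k hk =>
    MvPolynomial.eq_of_eval_eq_of_pos fun t ht => by rw [(hqc t ht).1 k hk, map_zero]
  have hpl : ∀ k < n, p.coeff k = 0 := fun k hk =>
    MvPolynomial.eq_of_eval_eq_of_pos fun t ht => by rw [(hpc t ht).1 k hk, map_zero]
  have hpq : p.coeff n = q.coeff n * b :=
    MvPolynomial.eq_of_eval_eq_of_pos fun t ht => by rw [(hpc t ht).2, map_mul, (hqc t ht).2]
  have hone : ∀ ℓ : L, (0 : ℝ) < (fun _ => 1 : L → ℝ) ℓ := fun _ => one_pos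
  have hq0 : q.coeff n ≠ 0 := fun h => ha _ hone (by rw [← (hqc _ hone).2, h, map_zero])
  have hp0 : q.coeff n * b ≠ 0 := mul_ne_zero hq0 fun h => hb _ hone (by rw [h, map_zero])
  rw [lowestTerm_eq hp0 hpl hpq, lowestTerm_eq hq0 hql rfl, Polynomial.monomial_mul_C]

theorem eval_rescale [DecidableEq L] (S : Finset L) (p : MvPolynomial L ℝ) (t : L → ℝ) (ρ : ℝ) :
    ((rescale S p).map (MvPolynomial.eval t)).eval ρ =
      MvPolynomial.eval (fun ℓ => if ℓ ∈ S then ρ ^ 2 * t ℓ else t ℓ) p := by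
  have h : ((Polynomial.evalRingHom ρ).comp ((Polynomial.mapRingHom (MvPolynomial.eval t)).comp
      (rescale S : MvPolynomial L ℝ →+* Polynomial (MvPolynomial L ℝ)))) =
      MvPolynomial.eval (fun ℓ => if ℓ ∈ S then ρ ^ 2 * t ℓ else t ℓ) := by
    refine MvPolynomial.ringHom_ext (fun x => ?_) fun ℓ => ?_
    · simp [rescale, Polynomial.algebraMap_apply, MvPolynomial.algebraMap_eq]
    · by_cases hℓ : ℓ ∈ S <;> simp [rescale, hℓ, mul_comm (t ℓ)]
  exact congrFun (congrArg DFunLike.coe h) p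

end LowestTerm

/-- A kernel vector pairs with itself to zero, so positivity of the symmetric part kills its short
and long components. The rows of the long variables then say that its hypermomenta lie in the kernel
of the incidence matrix. -/
theorem det_diagPart_add_ne_zero {Λ P : Type*} [Fintype Λ] [DecidableEq Λ] [Fintype P]
    [DecidableEq P] {B : Matrix ((Λ ⊕ Λ) ⊕ P) ((Λ ⊕ Λ) ⊕ P) ℝ} (hB : Bᵀ = -B)
    (hC : ∀ x : P → ℝ, (∀ ℓ, ∑ j, B (Sum.inl (Sum.inr ℓ)) (Sum.inr j) * x j = 0) → x = 0)
    {t : Λ → ℝ} (ht : ∀ ℓ, 0 < t ℓ) : (diagPart P t + B).det ≠ 0 := by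
  refine Matrix.det_ne_zero_of_mulVec_eq_zero fun x hx => ?_
  have h0 : x ⬝ᵥ (diagPart P t *ᵥ x) = 0 := by
    have h := congrArg (fun y => x ⬝ᵥ y) hx
    simpa only [Matrix.add_mulVec, dotProduct_add, dotProduct_zero,
      Matrix.dotProduct_mulVec_self_eq_zero hB, add_zero] using h
  have h1 : ∑ ℓ, 1 / t ℓ * x (Sum.inl (Sum.inl ℓ)) ^ 2 +
      ∑ ℓ, t ℓ * x (Sum.inl (Sum.inr ℓ)) ^ 2 = 0 := by
    rw [← h0]
    simp only [dotProduct, diagPart, Matrix.mulVec_diagonal, Fintype.sum_sum_type, Sum.elim_inl,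
      Sum.elim_inr, zero_mul, mul_zero, Finset.sum_const_zero, add_zero]
    congr 1 <;> exact Finset.sum_congr rfl fun _ _ => by ring
  have hpa : ∀ ℓ, 0 ≤ 1 / t ℓ * x (Sum.inl (Sum.inl ℓ)) ^ 2 := fun ℓ =>
    mul_nonneg (one_div_pos.2 (ht ℓ)).le (sq_nonneg _)
  have hpb : ∀ ℓ, 0 ≤ t ℓ * x (Sum.inl (Sum.inr ℓ)) ^ 2 := fun ℓ =>
    mul_nonneg (ht ℓ).le (sq_nonneg _)
  have hsa := Finset.sum_nonneg fun ℓ (_ : ℓ ∈ Finset.univ) => hpa ℓ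
  have hsb := Finset.sum_nonneg fun ℓ (_ : ℓ ∈ Finset.univ) => hpb ℓ
  have hu : ∀ ℓ, x (Sum.inl (Sum.inl ℓ)) = 0 := fun ℓ => by
    have h := (Finset.sum_eq_zero_iff_of_nonneg fun ℓ _ => hpa ℓ).1 (by linarith) ℓ
      (Finset.mem_univ _)
    simpa [(ht ℓ).ne'] using h
  have hv : ∀ ℓ, x (Sum.inl (Sum.inr ℓ)) = 0 := fun ℓ => by
    have h := (Finset.sum_eq_zero_iff_of_nonneg fun ℓ _ => hpb ℓ).1 (by linarith) ℓ
      (Finset.mem_univ _)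
    simpa [(ht ℓ).ne'] using h
  have hp : (fun j => x (Sum.inr j)) = 0 := by
    refine hC _ fun ℓ => ?_
    have h := congrFun hx (Sum.inl (Sum.inr ℓ))
    rw [Matrix.add_mulVec, Pi.add_apply, diagPart, Matrix.mulVec_diagonal] at h
    simpa [Matrix.mulVec, dotProduct, Fintype.sum_sum_type, hu, hv] using h
  ext i
  rcases i with (i | i) | i
  exacts [hu i, hv i, congrFun hp i]

/-! ### The antisymmetric form on half-lines and vertices. -/

namespace MoyalGraph

variable {V K L : Type*}

/-- Every line joins a half-line of sign `+` to a half-line of sign `-`. -/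
def IsOriented (G : MoyalGraph V K L) : Prop :=
  (∀ ℓ, Odd (G.num (G.plus ℓ))) ∧ ∀ ℓ, Even (G.num (G.minus ℓ))

variable [DecidableEq V]

/-- The oscillation between two half-lines. -/
noncomputable def coupling (G : MoyalGraph V K L) (s : ℝ) (c d : K) : ℝ :=
  if G.vert c = G.vert d then -(s * (G.omega c d : ℝ)) else 0

theorem coupling_swap (G : MoyalGraph V K L) (s : ℝ) (c d : K) :
    G.coupling s c d = -G.coupling s d c := by
  unfold coupling omega
  by_cases h : G.vert c = G.vert d
  · rw [if_pos h, if_pos h.symm]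
    rcases lt_trichotomy (G.num c) (G.num d) with h | h | h
    · simp [h, h.not_gt]
    · simp [h]
    · simp [h, h.not_gt]
  · rw [if_neg h, if_neg (Ne.symm h), neg_zero]

/-- The antisymmetric form on half-lines and hypermomenta. -/
noncomputable def form (G : MoyalGraph V K L) (s : ℝ) : Matrix (K ⊕ V) (K ⊕ V) ℝ :=
  Matrix.fromBlocks (fun c d => G.coupling s c d) (fun c v => if G.vert c = v then 1 else 0)
    (fun v c => if G.vert c = v then -1 else 0) 0

section
variable (G : MoyalGraph V K L) (s : ℝ) (c d : K) (v w : V)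

@[simp] theorem form_inl_inl : G.form s (Sum.inl c) (Sum.inl d) = G.coupling s c d := rfl

@[simp] theorem form_inl_inr :
    G.form s (Sum.inl c) (Sum.inr v) = if G.vert c = v then 1 else 0 := rfl

@[simp] theorem form_inr_inl :
    G.form s (Sum.inr v) (Sum.inl c) = if G.vert c = v then -1 else 0 := rfl

@[simp] theorem form_inr_inr : G.form s (Sum.inr v) (Sum.inr w) = 0 := rfl

end

theorem form_transpose (G : MoyalGraph V K L) (s : ℝ) : (G.form s)ᵀ = -G.form s := by
  ext (c | v) (d | w)
  · exact G.coupling_swap s d c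
  · simp only [Matrix.transpose_apply, Matrix.neg_apply, form_inl_inr, form_inr_inl]
    split_ifs <;> simp
  · simp only [Matrix.transpose_apply, Matrix.neg_apply, form_inl_inr, form_inr_inl]
    split_ifs <;> simp
  · simp

variable [Fintype V] [Fintype K] [DecidableEq K] [Fintype L] [DecidableEq L]

/-- The short and long variables as combinations of the positions of half-lines. -/
def incl (G : MoyalGraph V K L) (root : V) : Matrix (K ⊕ V) (G.Idx root) ℝ :=
  Matrix.fromBlocks
    (Matrix.fromCols
      (fun c ℓ => (if c = G.plus ℓ then 1 else 0) + if c = G.minus ℓ then 1 else 0)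
      (fun c ℓ => (if c = G.plus ℓ then 1 else 0) - if c = G.minus ℓ then 1 else 0))
    0 0 (fun v w => if v = w.1 then 1 else 0)

section
variable (G : MoyalGraph V K L) (root : V) (c : K) (v : V) (ℓ : L) (w : {v // v ≠ root})

@[simp] theorem incl_short : G.incl root (Sum.inl c) (Sum.inl (Sum.inl ℓ)) =
    (if c = G.plus ℓ then 1 else 0) + if c = G.minus ℓ then 1 else 0 := rfl

@[simp] theorem incl_long : G.incl root (Sum.inl c) (Sum.inl (Sum.inr ℓ)) =
    (if c = G.plus ℓ then 1 else 0) - if c = G.minus ℓ then 1 else 0 := rfl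

@[simp] theorem incl_inl_inr : G.incl root (Sum.inl c) (Sum.inr w) = 0 := rfl

@[simp] theorem incl_inr_inl (x : L ⊕ L) : G.incl root (Sum.inr v) (Sum.inl x) = 0 := rfl

@[simp] theorem incl_inr_inr :
    G.incl root (Sum.inr v) (Sum.inr w) = if v = w.1 then 1 else 0 := rfl

end

/-- Here and in `sign_mul_eta` orientability is what matters: the signs cancel at both ends for
`eps`, and only at the `+` end for `eta`. So `u` is a sum and `v` a difference of ends. -/
theorem sign_mul_eps {G : MoyalGraph V K L} (hG : G.IsOriented) (ℓ : L) (c : K) :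
    (-1) ^ (G.num c + 1) * G.eps ℓ c =
      (if c = G.plus ℓ then 1 else 0) + if c = G.minus ℓ then 1 else 0 := by
  have hne : G.plus ℓ ≠ G.minus ℓ := fun h =>
    Nat.not_even_iff_odd.2 (hG.1 ℓ) (h ▸ hG.2 ℓ)
  unfold eps
  by_cases h1 : c = G.plus ℓ
  · subst h1
    simp [hne, ← mul_pow]
  · by_cases h2 : c = G.minus ℓ
    · subst h2
      simp [hne.symm, ← mul_pow]
    · simp [h1, h2]

theorem sign_mul_eta {G : MoyalGraph V K L} (hG : G.IsOriented) (ℓ : L) (c : K) :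
    (-1) ^ (G.num c + 1) * G.eta ℓ c =
      (if c = G.plus ℓ then 1 else 0) - if c = G.minus ℓ then 1 else 0 := by
  have hne : G.plus ℓ ≠ G.minus ℓ := fun h =>
    Nat.not_even_iff_odd.2 (hG.1 ℓ) (h ▸ hG.2 ℓ)
  unfold eta eps
  by_cases h1 : c = G.plus ℓ
  · subst h1
    simp [hne, (hG.1 ℓ).add_one.neg_one_pow]
  · by_cases h2 : c = G.minus ℓ
    · subst h2
      simp [hne.symm, (hG.2 ℓ).add_one.neg_one_pow]
    · simp [h1, h2]

/-- The factor `(-1)^(i+j+1)` is minus the product of the signs `(-1)^(i+1)` and `(-1)^(j+1)`,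
whence the minus sign in `coupling`. -/
theorem osc_apply (G : MoyalGraph V K L) (a b : L → K → ℤ) (s : ℝ) (ℓ ℓ' : L) :
    s * (G.osc a b ℓ ℓ' : ℝ) = ∑ c, ∑ d, (((-1) ^ (G.num c + 1) * a ℓ c : ℤ) : ℝ) *
      G.coupling s c d * (((-1) ^ (G.num d + 1) * b ℓ' d : ℤ) : ℝ) := by
  have h : G.osc a b ℓ ℓ' = ∑ c, ∑ d, if G.vert c = G.vert d then
      (-1) ^ (G.num c + G.num d + 1) * G.omega c d * a ℓ c * b ℓ' d else 0 := by
    unfold osc corners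
    simp only [Finset.sum_filter]
    rw [Finset.sum_comm]
    refine Finset.sum_congr rfl fun c _ => ?_
    rw [Finset.sum_ite_eq Finset.univ (G.vert c), if_pos (Finset.mem_univ _)]
    exact Finset.sum_congr rfl fun d _ => by simp only [eq_comm]
  rw [h]
  push_cast
  rw [Finset.mul_sum]
  refine Finset.sum_congr rfl fun c _ => ?_
  rw [Finset.mul_sum]
  refine Finset.sum_congr rfl fun d _ => ?_
  unfold coupling
  split_ifs
  · rw [show G.num c + G.num d + 1 = G.num c + (G.num d + 1) by ring, pow_add, pow_succ]
    ring
  · simp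

theorem C_apply (G : MoyalGraph V K L) (root : V) (a : L → K → ℤ) (ℓ : L) (v : V) :
    ((∑ c ∈ G.corners v, (-1) ^ (G.num c + 1) * a ℓ c : ℤ) : ℝ) =
      ∑ c, (((-1) ^ (G.num c + 1) * a ℓ c : ℤ) : ℝ) * if G.vert c = v then 1 else 0 := by
  unfold corners
  rw [Finset.sum_filter, Int.cast_sum]
  refine Finset.sum_congr rfl fun c _ => ?_
  split_ifs <;> simp

theorem congr_form_inl_inl (G : MoyalGraph V K L) (s : ℝ) (root : V) (x y : L ⊕ L) :
    ((G.incl root)ᵀ * G.form s * G.incl root) (Sum.inl x) (Sum.inl y) =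
      ∑ c, ∑ d, G.incl root (Sum.inl c) (Sum.inl x) * G.coupling s c d *
        G.incl root (Sum.inl d) (Sum.inl y) := by
  rw [Matrix.mul_assoc, Matrix.mul_apply, Fintype.sum_sum_type]
  simp only [Matrix.transpose_apply, Matrix.mul_apply, Fintype.sum_sum_type]
  simp [Finset.mul_sum, mul_assoc]

theorem congr_form_inl_inr (G : MoyalGraph V K L) (s : ℝ) (root : V) (x : L ⊕ L)
    (v : {v // v ≠ root}) :
    ((G.incl root)ᵀ * G.form s * G.incl root) (Sum.inl x) (Sum.inr v) =
      ∑ c, G.incl root (Sum.inl c) (Sum.inl x) * if G.vert c = v.1 then 1 else 0 := by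
  rw [Matrix.mul_assoc, Matrix.mul_apply, Fintype.sum_sum_type]
  simp only [Matrix.transpose_apply, Matrix.mul_apply, Fintype.sum_sum_type]
  simp

theorem incl_inl (G : MoyalGraph V K L) (hG : G.IsOriented) (root : V) (c : K) (ℓ : L) :
    G.incl root (Sum.inl c) (Sum.inl (Sum.inl ℓ)) =
        (((-1) ^ (G.num c + 1) * G.eps ℓ c : ℤ) : ℝ) ∧
      G.incl root (Sum.inl c) (Sum.inl (Sum.inr ℓ)) =
        (((-1) ^ (G.num c + 1) * G.eta ℓ c : ℤ) : ℝ) := by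
  rw [sign_mul_eps hG, sign_mul_eta hG]
  simp

/-- From here on every change of variables can be computed on half-lines, where the form is local at
the vertices. -/
theorem B_eq_congr_form (G : MoyalGraph V K L) (hG : G.IsOriented) (root : V) (s : ℝ) :
    G.B root s = (G.incl root)ᵀ * G.form s * G.incl root := by
  have hanti : ((G.incl root)ᵀ * G.form s * G.incl root)ᵀ =
      -((G.incl root)ᵀ * G.form s * G.incl root) := by
    simp [Matrix.transpose_mul, form_transpose, Matrix.mul_assoc]
  have hC : ∀ (x : L ⊕ L) (v : {v // v ≠ root}), ((G.C root x v : ℤ) : ℝ) =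
      ((G.incl root)ᵀ * G.form s * G.incl root) (Sum.inl x) (Sum.inr v) := by
    intro x v
    rw [congr_form_inl_inr]
    rcases x with ℓ | ℓ
    · simp only [(G.incl_inl hG root _ ℓ).1]
      exact G.C_apply root G.eps ℓ v.1
    · simp only [(G.incl_inl hG root _ ℓ).2]
      exact G.C_apply root G.eta ℓ v.1
  ext (x | v) (y | w)
  · rw [congr_form_inl_inl, B, Matrix.fromBlocks_apply₁₁]
    simp only [Matrix.smul_apply, Matrix.map_apply, smul_eq_mul]
    rcases x with ℓ | ℓ <;> rcases y with m | m <;>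
      simp only [(G.incl_inl hG root _ _).1, (G.incl_inl hG root _ _).2]
    · exact G.osc_apply G.eps G.eps s ℓ m
    · exact G.osc_apply G.eps G.eta s ℓ m
    · exact G.osc_apply G.eta G.eps s ℓ m
    · exact G.osc_apply G.eta G.eta s ℓ m
  · exact hC x w
  · have h := congrFun (congrFun hanti (Sum.inr v)) (Sum.inl y)
    rw [Matrix.transpose_apply, ← hC, Matrix.neg_apply] at h
    rw [← neg_eq_iff_eq_neg.2 h]
    rfl
  · rw [Matrix.mul_assoc, Matrix.mul_apply, Fintype.sum_sum_type]
    simp [B, Matrix.mul_apply, Fintype.sum_sum_type]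

theorem B_transpose (G : MoyalGraph V K L) (hG : G.IsOriented) (root : V) (s : ℝ) :
    (G.B root s)ᵀ = -G.B root s := by
  rw [G.B_eq_congr_form hG]
  simp [Matrix.transpose_mul, form_transpose, Matrix.mul_assoc]

theorem B_long_momentum (G : MoyalGraph V K L) (hG : G.IsOriented) (root : V) (s : ℝ) (ℓ : L)
    (v : {v // v ≠ root}) : G.B root s (Sum.inl (Sum.inr ℓ)) (Sum.inr v) =
      (if G.vert (G.plus ℓ) = v.1 then 1 else 0) -
        if G.vert (G.minus ℓ) = v.1 then 1 else 0 := by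
  rw [G.B_eq_congr_form hG, congr_form_inl_inr]
  simp only [incl_long, sub_mul, Finset.sum_sub_distrib, ite_mul, one_mul, zero_mul,
    Finset.sum_ite_eq', Finset.mem_univ, if_true]

/-- Functions on the vertices that agree at the ends of every line are constant. -/
theorem B_long_momentum_injective (G : MoyalGraph V K L) (hG : G.IsOriented) (root : V) (s : ℝ)
    (hconn : ∀ g : V → ℝ, (∀ ℓ, g (G.vert (G.plus ℓ)) = g (G.vert (G.minus ℓ))) →
      ∀ v w, g v = g w)
    (x : {v // v ≠ root} → ℝ)
    (hx : ∀ ℓ, ∑ j, G.B root s (Sum.inl (Sum.inr ℓ)) (Sum.inr j) * x j = 0) : x = 0 := by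
  set g : V → ℝ := fun v => if h : v ≠ root then x ⟨v, h⟩ else 0 with hg
  have hsum : ∀ v, ∑ j : {v // v ≠ root}, (if v = j.1 then 1 else 0) * x j = g v := by
    intro v
    by_cases h : v = root
    · rw [hg]
      simp only [dif_neg (not_not.2 h)]
      exact Finset.sum_eq_zero fun j _ => by rw [if_neg fun e => j.2 (e.symm.trans h), zero_mul]
    · rw [hg]
      simp only [dif_pos h]
      rw [Finset.sum_eq_single (⟨v, h⟩ : {v // v ≠ root})]
      · simp
      · intro j _ hj
        rw [if_neg fun e => hj (Subtype.ext e.symm), zero_mul]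
      · simp
  have h := hconn g fun ℓ => by
    have := hx ℓ
    simp only [G.B_long_momentum hG, sub_mul, Finset.sum_sub_distrib, hsum] at this
    linarith
  ext v
  have h1 := h v.1 root
  simpa [hg, v.2] using h1

theorem det_M_ne_zero (G : MoyalGraph V K L) (hG : G.IsOriented) (root : V) (s : ℝ)
    (hconn : ∀ g : V → ℝ, (∀ ℓ, g (G.vert (G.plus ℓ)) = g (G.vert (G.minus ℓ))) →
      ∀ v w, g v = g w) {t : L → ℝ} (ht : ∀ ℓ, 0 < t ℓ) : (G.M root s t).det ≠ 0 :=
  det_diagPart_add_ne_zero (G.B_transpose hG root s)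
    (G.B_long_momentum_injective hG root s hconn) ht

theorem IsConnected.eq_of_lines {G : MoyalGraph V K L} (h : G.IsConnected) {α : Type*}
    (g : V → α) (hg : ∀ ℓ, g (G.vert (G.plus ℓ)) = g (G.vert (G.minus ℓ))) (v w : V) :
    g v = g w := by
  obtain ⟨p⟩ := h.preconnected v w
  induction p with
  | nil => rfl
  | cons hadj _ ih =>
    refine Eq.trans ?_ ih
    rw [SimpleGraph.fromRel_adj] at hadj
    rcases hadj.2 with ⟨ℓ, rfl, rfl⟩ | ⟨ℓ, rfl, rfl⟩
    exacts [hg ℓ, (hg ℓ).symm]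

end MoyalGraph

/-! ### Faces of the subgraph and the walk along the broken face. -/

namespace Phi4Graph

variable {V L : Type*} [DecidableEq V] (G : Phi4Graph V L) (S : Finset L)

theorem plus_ne_minus (ℓ m : L) : G.plus ℓ ≠ G.minus m := fun h =>
  Nat.not_even_iff_odd.2 (G.minus_odd m) (h ▸ G.plus_even ℓ)

theorem mem_hooked_iff {c : V × Fin 4} :
    c ∈ G.hooked S ↔ (∃ ℓ ∈ S, G.plus ℓ = c) ∨ ∃ ℓ ∈ S, G.minus ℓ = c := by
  simp [hooked]

theorem plus_mem_verts {ℓ : L} (h : ℓ ∈ S) : (G.plus ℓ).1 ∈ G.verts S :=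
  Finset.mem_image_of_mem _ (G.plus_mem_hooked.2 h)

theorem minus_mem_verts {ℓ : L} (h : ℓ ∈ S) : (G.minus ℓ).1 ∈ G.verts S :=
  Finset.mem_image_of_mem _ (G.minus_mem_hooked.2 h)

section Faces

variable [Fintype V]

theorem across_plus {ℓ : L} (h : ℓ ∈ S) : G.across S (G.plus ℓ) = G.minus ℓ := by
  have h1 : ∃ m ∈ S, G.plus m = G.plus ℓ := ⟨ℓ, h, rfl⟩
  rw [across, dif_pos h1, G.plus_injective h1.choose_spec.2]

theorem across_minus {ℓ : L} (h : ℓ ∈ S) : G.across S (G.minus ℓ) = G.plus ℓ := by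
  have h0 : ¬∃ m ∈ S, G.plus m = G.minus ℓ := by
    rintro ⟨m, -, e⟩
    exact G.plus_ne_minus _ _ e
  have h1 : ∃ m ∈ S, G.minus m = G.minus ℓ := ⟨ℓ, h, rfl⟩
  rw [across, dif_neg h0, dif_pos h1, G.minus_injective h1.choose_spec.2]

theorem across_of_notMem {c : V × Fin 4} (h : c ∉ G.hooked S) : G.across S c = c := by
  rw [mem_hooked_iff, not_or] at h
  rw [across, dif_neg h.1, dif_neg h.2]

theorem across_across (c : V × Fin 4) : G.across S (G.across S c) = c := by
  by_cases h : c ∈ G.hooked S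
  · rcases (G.mem_hooked_iff S).1 h with ⟨ℓ, hℓ, rfl⟩ | ⟨ℓ, hℓ, rfl⟩
    · rw [G.across_plus S hℓ, G.across_minus S hℓ]
    · rw [G.across_minus S hℓ, G.across_plus S hℓ]
  · rw [G.across_of_notMem S h, G.across_of_notMem S h]

theorem across_mem_hooked {c : V × Fin 4} : G.across S c ∈ G.hooked S ↔ c ∈ G.hooked S := by
  have key : ∀ c, c ∈ G.hooked S → G.across S c ∈ G.hooked S := by
    intro c h
    rcases (G.mem_hooked_iff S).1 h with ⟨ℓ, hℓ, rfl⟩ | ⟨ℓ, hℓ, rfl⟩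
    · rw [G.across_plus S hℓ]; exact G.minus_mem_hooked.2 hℓ
    · rw [G.across_minus S hℓ]; exact G.plus_mem_hooked.2 hℓ
  refine ⟨fun h => ?_, key c⟩
  have := key _ h
  rwa [across_across] at this

theorem across_mem_verts {c : V × Fin 4} :
    (G.across S c).1 ∈ G.verts S ↔ c.1 ∈ G.verts S := by
  by_cases h : c ∈ G.hooked S
  · exact iff_of_true (Finset.mem_image_of_mem _ ((G.across_mem_hooked S).2 h))
      (Finset.mem_image_of_mem _ h)
  · rw [G.across_of_notMem S h]

theorem across_eq_iff_eq_across {c d : V × Fin 4} : G.across S c = d ↔ c = G.across S d := by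
  constructor <;> rintro rfl <;> rw [across_across]

/-- The previous half-line of the same vertex. -/
def prev (c : V × Fin 4) : V × Fin 4 := (c.1, c.2 - 1)

theorem faceStep_prev (c : V × Fin 4) : G.faceStep S (prev c) = G.across S c := by
  simp [faceStep, prev]

theorem faceStep_mem_verts {c : V × Fin 4} :
    (G.faceStep S c).1 ∈ G.verts S ↔ c.1 ∈ G.verts S := by
  rw [faceStep, across_mem_verts]

theorem faceStep_injective : Function.Injective (G.faceStep S) := by
  intro c d h
  have h1 := congrArg (G.across S) h
  simp only [faceStep, across_across, Prod.mk.injEq, add_left_inj] at h1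
  exact Prod.ext h1.1 h1.2

theorem self_mem_faceOf (c : V × Fin 4) : c ∈ G.faceOf S c := ⟨0, rfl⟩

theorem exists_iterate_faceStep_eq_self (c : V × Fin 4) :
    ∃ n, 0 < n ∧ (G.faceStep S)^[n] c = c := by
  obtain ⟨n, hn, h⟩ := (G.faceStep_injective S).mem_periodicPts c
  exact ⟨n, hn, h⟩

theorem mem_faceOf_symm {c d : V × Fin 4} (h : d ∈ G.faceOf S c) : c ∈ G.faceOf S d := by
  obtain ⟨k, rfl⟩ := h
  obtain ⟨n, hn, hc⟩ := G.exists_iterate_faceStep_eq_self S c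
  -- The face has a period `n`, so `n * k - k` further steps complete `n * k` steps, which lead back
  -- to `c`.
  refine ⟨n * k - k, ?_⟩
  rw [← Function.iterate_add_apply, Nat.sub_add_cancel (Nat.le_mul_of_pos_left k hn),
    Function.iterate_mul]
  exact Function.iterate_fixed hc k

theorem mem_faceOf_trans {c d e : V × Fin 4} (h : d ∈ G.faceOf S c) (h' : e ∈ G.faceOf S d) :
    e ∈ G.faceOf S c := by
  obtain ⟨k, rfl⟩ := h
  obtain ⟨m, rfl⟩ := h'
  exact ⟨m + k, Function.iterate_add_apply _ _ _ _⟩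

theorem faceOf_eq {c d : V × Fin 4} (h : d ∈ G.faceOf S c) : G.faceOf S d = G.faceOf S c :=
  Set.ext fun _ => ⟨G.mem_faceOf_trans S h, G.mem_faceOf_trans S (G.mem_faceOf_symm S h)⟩

theorem faceStep_mem_faceOf {c d : V × Fin 4} :
    G.faceStep S d ∈ G.faceOf S c ↔ d ∈ G.faceOf S c := by
  have h : G.faceStep S d ∈ G.faceOf S d := ⟨1, rfl⟩
  exact ⟨fun h' => G.mem_faceOf_trans S h' (G.mem_faceOf_symm S h),
    fun h' => G.mem_faceOf_trans S h' h⟩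

theorem prev_mem_faceOf {c d : V × Fin 4} :
    prev d ∈ G.faceOf S c ↔ G.across S d ∈ G.faceOf S c := by
  rw [← G.faceStep_prev S, faceStep_mem_faceOf]

theorem mem_verts_of_mem_faceOf {c d : V × Fin 4} (h : d ∈ G.faceOf S c) :
    d.1 ∈ G.verts S ↔ c.1 ∈ G.verts S := by
  obtain ⟨k, rfl⟩ := h
  induction k with
  | zero => rfl
  | succ k ih => rw [Function.iterate_succ_apply', faceStep_mem_verts, ih]

theorem mem_legs {c : V × Fin 4} : c ∈ G.legs S ↔ c.1 ∈ G.verts S ∧ c ∉ G.hooked S := by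
  simp [legs]

section FirstVisit

variable {G S} {q c d : V × Fin 4}

theorem firstVisit_spec (h : c ∈ G.faceOf S q) :
    0 < G.firstVisit S q c ∧ (G.faceStep S)^[G.firstVisit S q c] q = c := by
  have hne : {k : ℕ | 0 < k ∧ (G.faceStep S)^[k] q = c}.Nonempty := by
    obtain ⟨n, hn, hq⟩ := G.exists_iterate_faceStep_eq_self S q
    obtain ⟨k, hk⟩ := h
    -- A full period is added because a visit needs a positive number of steps.
    exact ⟨k + n, by omega, by rw [Function.iterate_add_apply, hq, hk]⟩
  exact Nat.sInf_mem hne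

theorem firstVisit_le {k : ℕ} (hk : 0 < k) (h : (G.faceStep S)^[k] q = c) :
    G.firstVisit S q c ≤ k :=
  Nat.sInf_le ⟨hk, h⟩

theorem firstVisit_injOn (hc : c ∈ G.faceOf S q) (hd : d ∈ G.faceOf S q)
    (h : G.firstVisit S q c = G.firstVisit S q d) : c = d := by
  rw [← (firstVisit_spec hc).2, h, (firstVisit_spec hd).2]

theorem firstVisit_faceStep_self : G.firstVisit S q (G.faceStep S q) = 1 := by
  have h1 : G.firstVisit S q (G.faceStep S q) ≤ 1 := firstVisit_le one_pos rfl
  have h2 := (firstVisit_spec (q := q) ((G.faceStep_mem_faceOf S).2 (G.self_mem_faceOf S q))).1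
  omega

theorem firstVisit_faceStep (hc : c ∈ G.faceOf S q) (hne : c ≠ q) :
    G.firstVisit S q (G.faceStep S c) = G.firstVisit S q c + 1 := by
  have hs := firstVisit_spec hc
  refine le_antisymm (firstVisit_le (Nat.succ_pos _) ?_) ?_
  · rw [Function.iterate_succ_apply', hs.2]
  · obtain ⟨hk, hk'⟩ := firstVisit_spec ((G.faceStep_mem_faceOf S).2 hc)
    obtain ⟨k, hkk⟩ := Nat.exists_eq_succ_of_ne_zero hk.ne'
    rw [hkk, Function.iterate_succ_apply'] at hk'
    have hk0 := G.faceStep_injective S hk'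
    rcases Nat.eq_zero_or_pos k with rfl | hpos
    · exact absurd hk0.symm hne
    · have := firstVisit_le hpos hk0
      omega

/-- The walk returns to its start only after a full turn. Thus `q` comes last, as it should if `q`
is itself a leg. -/
theorem firstVisit_le_self (hc : c ∈ G.faceOf S q) :
    G.firstVisit S q c ≤ G.firstVisit S q q := by
  by_contra hlt
  push Not at hlt
  obtain ⟨h0, hq⟩ := firstVisit_spec (G.self_mem_faceOf S q)
  have h1 : (G.faceStep S)^[G.firstVisit S q c - G.firstVisit S q q] q = c := by
    have h2 := (firstVisit_spec hc).2
    rw [← Nat.sub_add_cancel hlt.le, Function.iterate_add_apply, hq] at h2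
    exact h2
  have := firstVisit_le (by omega) h1
  omega

/-- Along the broken face, the legs alternate in sign. -/
theorem odd_card_legs_firstVisit (hq : Odd (q.2 : ℕ)) (hlegs : ∀ x ∈ G.legs S, x ∈ G.faceOf S q)
    (hqS : q.1 ∈ G.verts S) (n : ℕ) :
    ∀ c ∈ G.faceOf S q, G.firstVisit S q c = n →
      (Odd ((G.legs S).filter fun x => G.firstVisit S q x ≤ n).card ↔ Even (c.2 : ℕ)) := by
  induction n with
  | zero =>
    intro c hc h0
    have := (firstVisit_spec hc).1
    omega
  | succ n ih =>
    intro c hc hcn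
    have hvS := (G.mem_verts_of_mem_faceOf S hc).2 hqS
    have hstep : G.faceStep S ((G.faceStep S)^[n] q) = c := by
      have h := (firstVisit_spec hc).2
      rwa [hcn, Function.iterate_succ_apply'] at h
    -- the sector visited before `c`
    obtain ⟨b, hb, hbq, hcb⟩ : ∃ b, b ∈ G.faceOf S q ∧ (Odd ((G.legs S).filter fun x =>
        G.firstVisit S q x ≤ n).card ↔ Even (b.2 : ℕ)) ∧ G.faceStep S b = c := by
      refine ⟨(G.faceStep S)^[n] q, ⟨n, rfl⟩, ?_, ?_⟩
      -- At the start no leg has been counted and `q` is a `-` half-line. This case is separate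
      -- because the first visit of `q` itself is recorded only at the end of the turn.
      · rcases Nat.eq_zero_or_pos n with rfl | hn
        · have : ((G.legs S).filter fun x => G.firstVisit S q x ≤ 0) = ∅ := by
            refine Finset.filter_eq_empty_iff.2 fun x hx h => ?_
            have := (firstVisit_spec (hlegs x hx)).1
            omega
          rw [this]
          simpa using hq
        · refine ih _ ⟨n, rfl⟩ (le_antisymm (firstVisit_le hn rfl) ?_)
          have hmem : (G.faceStep S)^[n] q ∈ G.faceOf S q := ⟨n, rfl⟩
          have h2 := firstVisit_le (c := c) (q := q) (G := G) (S := S) (Nat.succ_pos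
            (G.firstVisit S q ((G.faceStep S)^[n] q))) (by
              rw [Function.iterate_succ_apply', (firstVisit_spec hmem).2, hstep])
          omega
      · exact hstep
    -- Turning to the next half-line flips the sign. Crossing a line of `S` flips it back and counts
    -- no leg; stopping at a leg keeps the flip and counts one leg.
    have hflip : ∀ i : Fin 4, (Even ((i + 1 : Fin 4) : ℕ) ↔ ¬Even (i : ℕ)) := by decide
    have hacc : c = G.across S (b.1, b.2 + 1) := hcb.symm
    by_cases hleg : c ∈ G.hooked S
    · have h1 : ((G.legs S).filter fun x => G.firstVisit S q x ≤ n + 1) =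
          (G.legs S).filter fun x => G.firstVisit S q x ≤ n := by
        refine Finset.filter_congr fun x hx => ⟨fun h => ?_, fun h => h.trans n.le_succ⟩
        refine Nat.le_of_lt_succ (lt_of_le_of_ne h fun e => ?_)
        have := firstVisit_injOn (hlegs x hx) hc (e.trans hcn.symm)
        exact ((G.mem_legs S).1 hx).2 (this ▸ hleg)
      rw [h1, hbq]
      have h2 : ¬Even (b.2 : ℕ) ↔ Even ((b.2 + 1 : Fin 4) : ℕ) := (hflip b.2).symm
      rcases (G.mem_hooked_iff S).1 hleg with ⟨ℓ, hℓ, rfl⟩ | ⟨ℓ, hℓ, rfl⟩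
      · rw [← G.across_eq_iff_eq_across S, G.across_plus S hℓ] at hacc
        have h3 := G.minus_odd ℓ
        rw [hacc] at h3
        have h4 := G.plus_even ℓ
        simp only [← Nat.not_even_iff_odd, ← h2, not_not] at h3
        exact iff_of_true h3 h4
      · rw [← G.across_eq_iff_eq_across S, G.across_minus S hℓ] at hacc
        have h3 := G.plus_even ℓ
        rw [hacc] at h3
        have h4 := Nat.not_even_iff_odd.2 (G.minus_odd ℓ)
        exact iff_of_false (h2.2 h3) h4
    · have hcl : c ∈ G.legs S := (G.mem_legs S).2 ⟨hvS, hleg⟩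
      have h1 : ((G.legs S).filter fun x => G.firstVisit S q x ≤ n + 1) =
          insert c ((G.legs S).filter fun x => G.firstVisit S q x ≤ n) := by
        ext x
        simp only [Finset.mem_insert, Finset.mem_filter]
        constructor
        · rintro ⟨hx, h⟩
          rcases Nat.lt_or_ge (G.firstVisit S q x) (n + 1) with h' | h'
          · exact Or.inr ⟨hx, Nat.le_of_lt_succ h'⟩
          · exact Or.inl (firstVisit_injOn (hlegs x hx) hc ((le_antisymm h h').trans hcn.symm))
        · rintro (rfl | ⟨hx, h⟩)
          · exact ⟨hcl, hcn.le⟩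
          · exact ⟨hx, h.trans n.le_succ⟩
      rw [h1, Finset.card_insert_of_notMem (by simp [hcn]), Nat.odd_add_one, hbq]
      rw [← G.across_eq_iff_eq_across S, G.across_of_notMem S hleg] at hacc
      rw [hacc]
      exact (hflip b.2).symm

theorem legNumber_lt_iff (hlegs : ∀ x ∈ G.legs S, x ∈ G.faceOf S q) (hc : c ∈ G.legs S)
    (hd : d ∈ G.legs S) :
    G.legNumber S q c < G.legNumber S q d ↔ G.firstVisit S q c < G.firstVisit S q d := by
  have mono : ∀ {c d}, G.firstVisit S q c ≤ G.firstVisit S q d →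
      G.legNumber S q c ≤ G.legNumber S q d := by
    intro c d h
    exact Finset.card_le_card (Finset.monotone_filter_right _ fun x _ hx => le_trans hx h)
  constructor
  · intro h
    by_contra h'
    exact absurd (mono (not_lt.1 h')) (not_le.2 h)
  · intro h
    refine Finset.card_lt_card (Finset.ssubset_iff_of_subset
      (Finset.monotone_filter_right _ fun x _ hx => le_trans hx h.le) |>.2 ⟨d, ?_, ?_⟩)
    · simp [hd]
    · simp [h]

end FirstVisit

section Divergent

variable {G S}

theorem PrimitivelyDivergent.eq_of_lines (hS : G.PrimitivelyDivergent S) {α : Type*}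
    (g : V → α) (hg : ∀ ℓ ∈ S, g (G.plus ℓ).1 = g (G.minus ℓ).1) {v w : V}
    (hv : v ∈ G.verts S) (hw : w ∈ G.verts S) : g v = g w := by
  obtain ⟨p⟩ := hS.1.preconnected ⟨v, hv⟩ ⟨w, hw⟩
  suffices h : ∀ x y : {v : V // v ∈ G.verts S}, (SimpleGraph.fromRel fun v w :
      {v : V // v ∈ G.verts S} => ∃ ℓ ∈ S, (G.plus ℓ).1 = v ∧ (G.minus ℓ).1 = w).Walk x y →
      g x = g y from h _ _ p
  intro x y p
  induction p with
  | nil => rfl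
  | cons hadj _ ih =>
    refine Eq.trans ?_ ih
    rw [SimpleGraph.fromRel_adj] at hadj
    rcases hadj.2 with ⟨ℓ, hℓ, h1, h2⟩ | ⟨ℓ, hℓ, h1, h2⟩
    · rw [← h1, ← h2, hg ℓ hℓ]
    · rw [← h1, ← h2, hg ℓ hℓ]

theorem PrimitivelyDivergent.eq_of_mem_brokenFaces (hS : G.PrimitivelyDivergent S)
    {f f' : Set (V × Fin 4)} (hf : f ∈ G.brokenFaces S) (hf' : f' ∈ G.brokenFaces S) : f = f' := by
  obtain ⟨a, ha⟩ := Set.ncard_eq_one.1 hS.2.2.1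
  rw [ha] at hf hf'
  exact hf.trans hf'.symm

/-- This is where a single broken face is needed: the walk from the root mark meets every leg. -/
theorem PrimitivelyDivergent.mem_faceOf_of_mem_legs (hS : G.PrimitivelyDivergent S)
    {q : V × Fin 4} (hq : G.IsRootMark S q) {x : V × Fin 4} (hx : x ∈ G.legs S) :
    x ∈ G.faceOf S q := by
  have h : G.faceOf S x ∈ G.brokenFaces S :=
    ⟨⟨x, ((G.mem_legs S).1 hx).1, rfl⟩, x, hx, G.self_mem_faceOf S x⟩
  rw [← hS.eq_of_mem_brokenFaces h hq.2.2]
  exact G.self_mem_faceOf S x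

variable (G S) in
/-- The faces that are not broken. -/
abbrev InternalFace : Type _ :=
  {f : Set (V × Fin 4) // f ∈ G.faces S ∧ f ∉ G.brokenFaces S}

noncomputable instance : Fintype (G.InternalFace S) := Fintype.ofFinite _

noncomputable instance : DecidableEq (G.InternalFace S) := Classical.decEq _

/-- Euler's relation `n - L + F = 2` with exactly one of the `F` faces broken. It is the only use of
genus `0`: the cycles and cuts have the right number to form a basis of the long variables. -/
theorem PrimitivelyDivergent.card_internalFace (hS : G.PrimitivelyDivergent S)
    (o : {v : V // v ∈ G.verts S}) :
    Fintype.card {ℓ : L // ℓ ∈ S} =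
      Fintype.card (G.InternalFace S) + Fintype.card {v : {v : V // v ∈ G.verts S} // v ≠ o} := by
  have h1 : Fintype.card (G.InternalFace S) = (G.faces S \ G.brokenFaces S).ncard := by
    rw [← Nat.card_eq_fintype_card, ← Nat.card_coe_set_eq]
    rfl
  have h2 : (G.faces S \ G.brokenFaces S).ncard + (G.brokenFaces S).ncard = (G.faces S).ncard :=
    Set.ncard_sdiff_add_ncard_of_subset (fun f hf => hf.1) (Set.toFinite _)
  have h3 : Fintype.card {v : {v : V // v ∈ G.verts S} // v ≠ o} = (G.verts S).card - 1 := by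
    rw [Fintype.card_subtype_compl, Fintype.card_coe, Fintype.card_subtype_eq]
  have h4 : 0 < (G.verts S).card := Finset.card_pos.2 ⟨o.1, o.2⟩
  have h5 := hS.2.1
  rw [HasGenus] at h5
  rw [Fintype.card_coe, h1, h3]
  have h6 := hS.2.2.1
  omega

theorem InternalFace.mem_iff {f : G.InternalFace S} {c : V × Fin 4} (h : c ∈ f.1) :
    f.1 = G.faceOf S c := by
  obtain ⟨⟨b, -, hb⟩, -⟩ := f.2
  rw [hb] at h ⊢
  exact (G.faceOf_eq S h).symm

/-- From the sector before `c` the boundary passes along the half-line `c` into the sector after its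
other end. -/
theorem InternalFace.prev_mem (f : G.InternalFace S) (c : V × Fin 4) :
    prev c ∈ f.1 ↔ G.across S c ∈ f.1 := by
  obtain ⟨⟨b, -, hb⟩, -⟩ := f.2
  rw [hb, prev_mem_faceOf]

end Divergent

end Faces

end Phi4Graph

theorem Matrix.congr_one_submatrix {I J : Type*} [Fintype I] [DecidableEq I] (e : J → I)
    (H : Matrix I I ℝ) :
    ((1 : Matrix I I ℝ).submatrix id e)ᵀ * H * (1 : Matrix I I ℝ).submatrix id e =
      H.submatrix e e := by
  ext i j
  simp [Matrix.mul_apply, Matrix.one_apply]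

theorem Finset.sum_ite_eq_ite {X Y : Type*} [Fintype X] [DecidableEq X] [DecidableEq Y] (f : X → Y)
    (c : Y) (y : X) :
    ∑ x, (if c = f x then if x = y then (1 : ℝ) else 0 else 0) = if c = f y then 1 else 0 := by
  rw [Finset.sum_eq_single y]
  · simp
  · intro x _ hx
    simp [hx]
  · simp

/-! ### Rotated numberings and the oscillation of chains of sectors. -/

namespace Phi4Graph

variable {V L : Type*} [DecidableEq V]

/-- The graph `G` with half-lines numbered so that `(v, a v)` is the last half-line of `v`. -/
def marked (G : Phi4Graph V L) (a : V → Fin 4) : MoyalGraph V (V × Fin 4) L where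
  vert := Prod.fst
  num c := ((c.2 - a c.1 - 1 : Fin 4) : ℕ) + 1
  plus := G.plus
  minus := G.minus

/-- The last half-lines when only the numbering of one vertex is changed. -/
def rootMarks (r : V × Fin 4) : V → Fin 4 := Function.update (fun _ => 3) r.1 r.2

theorem number_eq (r c : V × Fin 4) :
    number r c = ((c.2 - rootMarks r c.1 - 1 : Fin 4) : ℕ) + 1 := by
  by_cases h : c.1 = r.1
  · rw [number, if_pos h, h, rootMarks, Function.update_self]
  · rw [number, if_neg h, rootMarks, Function.update_of_ne h]
    -- The default mark `3` makes the half-line `0` the first one.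
    have : ∀ i : Fin 4, i - 3 - 1 = i := by decide
    rw [this]

theorem toMoyal_eq (G : Phi4Graph V L) (r : V × Fin 4) :
    G.toMoyal r = G.marked (rootMarks r) := by
  unfold toMoyal marked
  congr 1
  ext c
  exact number_eq r c

theorem odd_rootMarks {r : V × Fin 4} (hr : Odd (r.2 : ℕ)) (v : V) :
    Odd (rootMarks r v : ℕ) := by
  by_cases h : v = r.1
  · rwa [h, rootMarks, Function.update_self]
  · rw [rootMarks, Function.update_of_ne h]
    decide

theorem marked_num_even_iff {a i : Fin 4} (ha : Odd (a : ℕ)) :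
    Odd (((i - a - 1 : Fin 4) : ℕ) + 1) ↔ Even (i : ℕ) := by
  revert a i
  decide

theorem marked_isOriented (G : Phi4Graph V L) {a : V → Fin 4} (ha : ∀ v, Odd (a v : ℕ)) :
    (G.marked a).IsOriented := by
  refine ⟨fun ℓ => (marked_num_even_iff (ha _)).2 (G.plus_even ℓ), fun ℓ => ?_⟩
  rw [← Nat.not_odd_iff_even]
  exact fun h => Nat.not_even_iff_odd.2 (G.minus_odd ℓ) ((marked_num_even_iff (ha _)).1 h)

theorem marked_coupling (G : Phi4Graph V L) (a : V → Fin 4) (s : ℝ) (c d : V × Fin 4) :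
    (G.marked a).coupling s c d = if c.1 = d.1 then -(s * (((if c.2 - a c.1 - 1 < d.2 - a d.1 - 1
      then 1 else if d.2 - a d.1 - 1 < c.2 - a c.1 - 1 then -1 else 0 : ℤ)) : ℝ)) else 0 := by
  simp only [MoyalGraph.coupling, MoyalGraph.omega, marked, add_lt_add_iff_right, Fin.val_fin_lt]

theorem marked_coupling_congr (G : Phi4Graph V L) {a b : V → Fin 4} (s : ℝ) {c : V × Fin 4}
    (h : a c.1 = b c.1) (d : V × Fin 4) :
    (G.marked a).coupling s c d = (G.marked b).coupling s c d := by
  rw [marked_coupling, marked_coupling]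
  by_cases hcd : c.1 = d.1
  · rw [h, show a d.1 = b d.1 by rw [← hcd, h]]
  · rw [if_neg hcd, if_neg hcd]

theorem marked_coupling_same (G : Phi4Graph V L) (a : V → Fin 4) (s : ℝ) (v : V) (i j : Fin 4) :
    (G.marked a).coupling s (v, i) (v, j) =
      -(s * if i - a v - 1 < j - a v - 1 then 1 else if j - a v - 1 < i - a v - 1 then -1 else 0) := by
  rw [marked_coupling, if_pos rfl]
  push_cast
  rfl

/-- Summation by parts around a vertex: `ω(i, ·)` jumps at `i`, which produces the two sectors
beside `i`, and between the last half-line `k` and the first one, which produces `2 * m k`. The last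
term does not depend on `i`, so a hypermomentum can absorb it. -/
theorem sum_omega_cycle (k : Fin 4) (m : Fin 4 → ℝ) (i : Fin 4) :
    ∑ j, (if i - k - 1 < j - k - 1 then (1 : ℝ) else if j - k - 1 < i - k - 1 then -1 else 0) *
      (m j - m (j - 1)) = -(m i + m (i - 1)) + 2 * m k := by
  have e : (0 : Fin 4) - 1 = 3 ∧ (1 : Fin 4) - 1 = 0 ∧ (2 : Fin 4) - 1 = 1 ∧ (3 : Fin 4) - 1 = 2 := by
    decide
  obtain ⟨e0, e1, e2, e3⟩ := e
  rw [Fin.sum_univ_four]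
  have hlt : ∀ x y : Fin 4, (x - k - 1 < y - k - 1) = (((x - k - 1 : Fin 4) : ℕ) <
      ((y - k - 1 : Fin 4) : ℕ)) := fun _ _ => rfl
  simp only [e0, e1, e2, e3]
  obtain rfl | rfl | rfl | rfl : k = 0 ∨ k = 1 ∨ k = 2 ∨ k = 3 := by revert k; decide
  all_goals
    obtain rfl | rfl | rfl | rfl : i = 0 ∨ i = 1 ∨ i = 2 ∨ i = 3 := by revert i; decide
  all_goals
    simp +decide only [e0, e1, e2, e3, if_true, if_false]
    ring

section Sums

variable [Fintype V]

/-- The oscillation of a half-line with a chain of sectors. -/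
theorem sum_coupling_chain (G : Phi4Graph V L) (a : V → Fin 4) (s : ℝ) (m : V × Fin 4 → ℝ)
    (d : V × Fin 4) :
    ∑ c, (G.marked a).coupling s d c * (m c - m (prev c)) =
      s * (m d + m (prev d)) - 2 * s * m (d.1, a d.1) := by
  obtain ⟨v, i⟩ := d
  rw [Fintype.sum_prod_type, Finset.sum_eq_single v]
  · have h := sum_omega_cycle (a v) (fun j => m (v, j)) i
    simp only [marked_coupling_same]
    have : ∀ j : Fin 4, -(s * (if i - a v - 1 < j - a v - 1 then (1 : ℝ)
        else if j - a v - 1 < i - a v - 1 then -1 else 0)) * (m (v, j) - m (prev (v, j))) =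
        -s * ((if i - a v - 1 < j - a v - 1 then (1 : ℝ)
        else if j - a v - 1 < i - a v - 1 then -1 else 0) * (m (v, j) - m (v, j - 1))) := by
      intro j
      rw [prev]
      ring
    simp only [this]
    rw [← Finset.mul_sum, h, prev]
    ring
  · intro w _ hw
    refine Finset.sum_eq_zero fun j _ => ?_
    rw [marked_coupling, if_neg (show ¬(v = w) from hw.symm), zero_mul]
  · simp

/-- The differences telescope around the vertex, so chains of sectors are not coupled to
hypermomenta. -/
theorem sum_chain_vertex (m : V × Fin 4 → ℝ) (v : V) :
    ∑ c : V × Fin 4, (if c.1 = v then 1 else 0) * (m c - m (prev c)) = 0 := by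
  rw [Fintype.sum_prod_type, Finset.sum_eq_single v]
  · simp only [if_true, one_mul, prev, Finset.sum_sub_distrib]
    rw [sub_eq_zero]
    exact (Equiv.sum_comp (Equiv.subRight (1 : Fin 4)) fun j => m (v, j)).symm
  · intro w _ hw
    simp [hw]
  · simp

/-- This turns coordinates on the long variables into positions of half-lines; it serves both the
cycles and the paths. At a half-line on no line of `S` both sides vanish, by the convention for
`across`. -/
theorem sum_lines (G : Phi4Graph V L) (S : Finset L) (g : V × Fin 4 → ℝ) (d : V × Fin 4) :
    ∑ ℓ : {ℓ : L // ℓ ∈ S}, ((if d = G.plus ℓ then 1 else 0) - if d = G.minus ℓ then 1 else 0) *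
      (g (G.plus ℓ) - g (G.minus ℓ)) = g d - g (G.across S d) := by
  by_cases hd : d ∈ G.hooked S
  · rcases (G.mem_hooked_iff S).1 hd with ⟨ℓ, hℓ, rfl⟩ | ⟨ℓ, hℓ, rfl⟩
    · rw [Finset.sum_eq_single (⟨ℓ, hℓ⟩ : {ℓ : L // ℓ ∈ S})]
      · simp [G.plus_ne_minus, G.across_plus S hℓ]
      · intro m _ hm
        have : G.plus ℓ ≠ G.plus m := fun e => hm (Subtype.ext (G.plus_injective e).symm)
        simp [this, G.plus_ne_minus]
      · simp
    · rw [Finset.sum_eq_single (⟨ℓ, hℓ⟩ : {ℓ : L // ℓ ∈ S})]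
      · simp [(G.plus_ne_minus _ _).symm, G.across_minus S hℓ]
      · intro m _ hm
        have : G.minus ℓ ≠ G.minus m := fun e => hm (Subtype.ext (G.minus_injective e).symm)
        simp [this, (G.plus_ne_minus _ _).symm]
      · simp
  · rw [G.across_of_notMem S hd, sub_self]
    refine Finset.sum_eq_zero fun ℓ _ => ?_
    have h1 : d ≠ G.plus ℓ := fun e => hd (e ▸ G.plus_mem_hooked.2 ℓ.2)
    have h2 : d ≠ G.minus ℓ := fun e => hd (e ▸ G.minus_mem_hooked.2 ℓ.2)
    simp [h1, h2]

end Sums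

/-! ### The form of the subgraph in terms of the half-lines of the whole graph. -/

section Sub

variable (G : Phi4Graph V L) (S : Finset L)

theorem sub_isOriented {r : V × Fin 4} (hr : Odd (r.2 : ℕ)) : (G.sub S r).IsOriented := by
  have h := G.marked_isOriented (odd_rootMarks hr)
  constructor
  · intro ℓ
    have := h.1 ℓ.1
    simp only [marked, ← number_eq] at this
    exact this
  · intro ℓ
    have := h.2 ℓ.1
    simp only [marked, ← number_eq] at this
    exact this

/-- The variables of the subgraph as combinations of the positions of the half-lines of `G`. -/
def subIncl (o : {v : V // v ∈ G.verts S}) :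
    Matrix ((V × Fin 4) ⊕ V) (({ℓ : L // ℓ ∈ S} ⊕ {ℓ : L // ℓ ∈ S}) ⊕
      {v : {v : V // v ∈ G.verts S} // v ≠ o}) ℝ :=
  Matrix.fromBlocks
    (Matrix.fromCols
      (Matrix.of fun c ℓ => (if c = G.plus ℓ then 1 else 0) + if c = G.minus ℓ then 1 else 0)
      (Matrix.of fun c ℓ => (if c = G.plus ℓ then 1 else 0) - if c = G.minus ℓ then 1 else 0))
    0 0 (Matrix.of fun v w => if v = w.1.1 then 1 else 0)

section
variable (o : {v : V // v ∈ G.verts S}) (c : V × Fin 4) (v : V) (ℓ : {ℓ : L // ℓ ∈ S})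
  (w : {v : {v : V // v ∈ G.verts S} // v ≠ o})

@[simp] theorem subIncl_short : G.subIncl S o (Sum.inl c) (Sum.inl (Sum.inl ℓ)) =
    (if c = G.plus ℓ then 1 else 0) + if c = G.minus ℓ then 1 else 0 := rfl

@[simp] theorem subIncl_long : G.subIncl S o (Sum.inl c) (Sum.inl (Sum.inr ℓ)) =
    (if c = G.plus ℓ then 1 else 0) - if c = G.minus ℓ then 1 else 0 := rfl

@[simp] theorem subIncl_inl_inr : G.subIncl S o (Sum.inl c) (Sum.inr w) = 0 := rfl

@[simp] theorem subIncl_inr_inl (x) : G.subIncl S o (Sum.inr v) (Sum.inl x) = 0 := rfl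

@[simp] theorem subIncl_inr_inr :
    G.subIncl S o (Sum.inr v) (Sum.inr w) = if v = w.1.1 then 1 else 0 := rfl

end

variable [Fintype V] [Fintype L] [DecidableEq L]

/-- The half-lines and vertices of the subgraph among those of `G`. -/
def subEmb : Matrix ((V × Fin 4) ⊕ V)
    ({c : V × Fin 4 // c.1 ∈ G.verts S} ⊕ {v : V // v ∈ G.verts S}) ℝ :=
  (1 : Matrix ((V × Fin 4) ⊕ V) ((V × Fin 4) ⊕ V) ℝ).submatrix id
    (Sum.map Subtype.val Subtype.val)

/-- The variables of the numbered subgraph, in terms of the half-lines of `G`. -/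
def subEmbIncl (r : V × Fin 4) (o : {v : V // v ∈ G.verts S}) :
    Matrix ((V × Fin 4) ⊕ V) ((G.sub S r).Idx o) ℝ :=
  G.subEmb S * (G.sub S r).incl o

/-- The antisymmetric form of `G` in the variables of the subgraph. -/
noncomputable def subForm (a : V → Fin 4) (o : {v : V // v ∈ G.verts S}) (s : ℝ) :
    Matrix (({ℓ : L // ℓ ∈ S} ⊕ {ℓ : L // ℓ ∈ S}) ⊕ {v : {v : V // v ∈ G.verts S} // v ≠ o})
      (({ℓ : L // ℓ ∈ S} ⊕ {ℓ : L // ℓ ∈ S}) ⊕ {v : {v : V // v ∈ G.verts S} // v ≠ o}) ℝ :=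
  (G.subIncl S o)ᵀ * (G.marked a).form s * G.subIncl S o

theorem subEmbIncl_eq (r : V × Fin 4) (o : {v : V // v ∈ G.verts S}) :
    G.subEmbIncl S r o = G.subIncl S o := by
  ext (c | v) ((ℓ | ℓ) | w)
  · have h : ∀ x : {c : V × Fin 4 // c.1 ∈ G.verts S}, ∀ α β : ℝ,
        (if c = x.1 then α + β else 0) = (if c = x.1 then α else 0) + if c = x.1 then β else 0 := by
      intro x α β
      split_ifs <;> simp
    simp only [subEmbIncl, subEmb, Matrix.mul_apply, Matrix.one_apply, Fintype.sum_sum_type,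
      Matrix.submatrix_apply, id, Sum.map_inl, Sum.map_inr, Sum.inl.injEq, reduceCtorEq, if_false,
      MoyalGraph.incl_short, MoyalGraph.incl_inr_inl, mul_zero, Finset.sum_const_zero, add_zero,
      ite_mul, one_mul, zero_mul, h, Finset.sum_add_distrib, Finset.sum_ite_eq_ite]
    rfl
  · have h : ∀ x : {c : V × Fin 4 // c.1 ∈ G.verts S}, ∀ α β : ℝ,
        (if c = x.1 then α - β else 0) = (if c = x.1 then α else 0) - if c = x.1 then β else 0 := by
      intro x α β
      split_ifs <;> simp
    simp only [subEmbIncl, subEmb, Matrix.mul_apply, Matrix.one_apply, Fintype.sum_sum_type,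
      Matrix.submatrix_apply, id, Sum.map_inl, Sum.map_inr, Sum.inl.injEq, reduceCtorEq, if_false,
      MoyalGraph.incl_long, MoyalGraph.incl_inr_inl, mul_zero, Finset.sum_const_zero, add_zero,
      ite_mul, one_mul, zero_mul, h, Finset.sum_sub_distrib, Finset.sum_ite_eq_ite]
    rfl
  · simp [subEmbIncl, subEmb, Matrix.mul_apply, Matrix.one_apply]
  · simp [subEmbIncl, subEmb, Matrix.mul_apply, Matrix.one_apply]
  · simp [subEmbIncl, subEmb, Matrix.mul_apply, Matrix.one_apply]
  · simp [subEmbIncl, subEmb, Matrix.mul_apply, Matrix.one_apply, -Finset.univ_eq_attach,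
      Finset.sum_ite_eq_ite]

theorem sub_form (r : V × Fin 4) {a : V → Fin 4} (ha : ∀ v ∈ G.verts S, a v = rootMarks r v)
    (s : ℝ) : (G.sub S r).form s =
      ((G.marked a).form s).submatrix (Sum.map Subtype.val Subtype.val)
        (Sum.map Subtype.val Subtype.val) := by
  ext (c | v) (d | w)
  · rw [Matrix.submatrix_apply, Sum.map_inl, Sum.map_inl, MoyalGraph.form_inl_inl,
      MoyalGraph.form_inl_inl, G.marked_coupling_congr s (ha _ c.2), marked_coupling]
    simp only [MoyalGraph.coupling, MoyalGraph.omega, sub, number_eq, Subtype.mk.injEq,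
      add_lt_add_iff_right, Fin.val_fin_lt]
  · simp [sub, marked, Subtype.ext_iff]
  · simp [sub, marked, Subtype.ext_iff]
  · simp

/-- Only the numbering at the vertices of `S` enters, so the same `subForm` serves for `S` alone and
for the corresponding block of `G`. -/
theorem sub_B (r : V × Fin 4) (hr : Odd (r.2 : ℕ)) {a : V → Fin 4}
    (ha : ∀ v ∈ G.verts S, a v = rootMarks r v) (o : {v : V // v ∈ G.verts S}) (s : ℝ) :
    (G.sub S r).B o s = G.subForm S a o s := by
  rw [MoyalGraph.B_eq_congr_form _ (G.sub_isOriented S hr), G.sub_form S r ha,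
    ← Matrix.congr_one_submatrix, subForm, ← G.subEmbIncl_eq S r o, subEmbIncl,
    Matrix.transpose_mul]
  simp only [Matrix.mul_assoc]
  rfl

end Sub

end Phi4Graph

/-! ### Cycles around internal faces, and cuts. -/

namespace Phi4Graph

variable {V L : Type*} [DecidableEq V] [Fintype V] (G : Phi4Graph V L) (S : Finset L)

/-- The indicator function of an internal face. -/
noncomputable def InternalFace.ind {G : Phi4Graph V L} {S : Finset L} (f : G.InternalFace S) :
    V × Fin 4 → ℝ :=
  Set.indicator f.1 1

theorem InternalFace.ind_prev {G : Phi4Graph V L} {S : Finset L} (f : G.InternalFace S)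
    (c : V × Fin 4) : f.ind (prev c) = f.ind (G.across S c) := by
  classical
  simp only [InternalFace.ind, Set.indicator_apply, f.prev_mem, Pi.one_apply]

theorem InternalFace.ind_eq_zero {G : Phi4Graph V L} {S : Finset L} (f : G.InternalFace S)
    {c : V × Fin 4} (hc : c.1 ∉ G.verts S) : f.ind c = 0 := by
  refine Set.indicator_of_notMem (fun h => hc ?_) _
  obtain ⟨⟨b, hb, hfb⟩, -⟩ := f.2
  rw [hfb] at h
  exact (G.mem_verts_of_mem_faceOf S h).2 hb

/-- The cycles of the long variables around the internal faces. -/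
noncomputable def cycleMat : Matrix {ℓ : L // ℓ ∈ S} (G.InternalFace S) ℝ :=
  Matrix.of fun ℓ f => f.ind (G.plus ℓ) - f.ind (G.minus ℓ)

/-- The incidence of lines and vertices. -/
def cutMat : Matrix {ℓ : L // ℓ ∈ S} {v : V // v ∈ G.verts S} ℝ :=
  Matrix.of fun ℓ v =>
    (if (G.plus ℓ).1 = v.1 then 1 else 0) - if (G.minus ℓ).1 = v.1 then 1 else 0

/-- The incidence of lines and vertices other than `o`. -/
def cutMatNe (o : {v : V // v ∈ G.verts S}) :
    Matrix {ℓ : L // ℓ ∈ S} {v : {v : V // v ∈ G.verts S} // v ≠ o} ℝ :=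
  (G.cutMat S).submatrix id Subtype.val

/-- The vertices whose numbering starts in a given internal face. -/
noncomputable def windMat (a : V → Fin 4) (o : {v : V // v ∈ G.verts S}) (s : ℝ) :
    Matrix {v : {v : V // v ∈ G.verts S} // v ≠ o} (G.InternalFace S) ℝ :=
  Matrix.of fun v f => 2 * s * f.ind (v.1.1, a v.1.1)

/-- The incidence of lines and internal faces. -/
noncomputable def adjMat (s : ℝ) : Matrix {ℓ : L // ℓ ∈ S} (G.InternalFace S) ℝ :=
  Matrix.of fun ℓ f => 2 * s * (f.ind (G.plus ℓ) + f.ind (G.minus ℓ))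

/-- The coordinates of the cycles around the internal faces, completed by hypermomenta. -/
noncomputable def cycleCols (a : V → Fin 4) (o : {v : V // v ∈ G.verts S}) (s : ℝ) :
    Matrix (({ℓ : L // ℓ ∈ S} ⊕ {ℓ : L // ℓ ∈ S}) ⊕ {v : {v : V // v ∈ G.verts S} // v ≠ o})
      (G.InternalFace S) ℝ :=
  Matrix.fromRows (Matrix.fromRows 0 (G.cycleMat S)) (G.windMat S a o s)

/-- The cycles around the internal faces in terms of half-lines. -/
noncomputable def cycleChain (a : V → Fin 4) (s : ℝ) :
    Matrix ((V × Fin 4) ⊕ V) (G.InternalFace S) ℝ :=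
  Matrix.fromRows (Matrix.of fun c f => f.ind c - f.ind (prev c))
    (Matrix.of fun v f => 2 * s * f.ind (v, a v))

@[simp] theorem marked_form_inl_inr (a : V → Fin 4) (s : ℝ) (c : V × Fin 4) (v : V) :
    (G.marked a).form s (Sum.inl c) (Sum.inr v) = if c.1 = v then 1 else 0 := rfl

@[simp] theorem marked_form_inr_inl (a : V → Fin 4) (s : ℝ) (c : V × Fin 4) (v : V) :
    (G.marked a).form s (Sum.inr v) (Sum.inl c) = if c.1 = v then -1 else 0 := rfl

variable [Fintype L] [DecidableEq L]

/-- Along a face `across` may be replaced by `prev`, which turns the cycle into a chain of sectors.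
The root has no hypermomentum; by `ho` none is needed there, since its numbering starts outside the
internal faces. -/
theorem subIncl_mul_cycle (a : V → Fin 4) (o : {v : V // v ∈ G.verts S}) (s : ℝ)
    (ho : ∀ f : G.InternalFace S, (o.1, a o.1) ∉ f.1) :
    G.subIncl S o * G.cycleCols S a o s = G.cycleChain S a s := by
  ext (c | v) f
  · rw [Matrix.mul_apply, Fintype.sum_sum_type, Fintype.sum_sum_type]
    simp only [cycleCols, cycleChain, Matrix.fromRows_apply_inl, Matrix.fromRows_apply_inr, Matrix.zero_apply, mul_zero,
      Finset.sum_const_zero, zero_add, subIncl_inl_inr, zero_mul, add_zero, subIncl_long,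
      cycleMat, Matrix.of_apply]
    rw [G.sum_lines S f.ind c, f.ind_prev]
  · rw [Matrix.mul_apply, Fintype.sum_sum_type, Fintype.sum_sum_type]
    simp only [cycleCols, cycleChain, Matrix.fromRows_apply_inl, Matrix.fromRows_apply_inr, Matrix.zero_apply, mul_zero,
      Finset.sum_const_zero, zero_add, subIncl_inr_inl, subIncl_inr_inr, zero_mul,
      windMat, Matrix.of_apply]
    by_cases hv : v ∈ G.verts S
    · by_cases hvo : (⟨v, hv⟩ : {v : V // v ∈ G.verts S}) = o
      · have h0 : f.ind (v, a v) = 0 := by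
          have : v = o.1 := congrArg Subtype.val hvo
          rw [this]
          exact Set.indicator_of_notMem (ho f) _
        rw [h0, mul_zero]
        refine Finset.sum_eq_zero fun w _ => ?_
        rw [if_neg, zero_mul]
        rintro rfl
        exact w.2 hvo
      · rw [Finset.sum_eq_single ⟨⟨v, hv⟩, hvo⟩]
        · simp
        · intro w _ hw
          rw [if_neg, zero_mul]
          rintro rfl
          exact hw rfl
        · simp
    · rw [f.ind_eq_zero (show (v, a v).1 ∉ G.verts S from hv), mul_zero]
      refine Finset.sum_eq_zero fun w _ => ?_
      rw [if_neg, zero_mul]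
      rintro rfl
      exact hv w.1.2

/-- The hypermomenta cancel the wrap-around term of the chain. What is left takes equal values at
the two ends of a line of `S`, so it vanishes on long variables and survives only on short ones. -/
theorem subForm_mul_cycle (a : V → Fin 4) (o : {v : V // v ∈ G.verts S}) (s : ℝ)
    (ho : ∀ f : G.InternalFace S, (o.1, a o.1) ∉ f.1) :
    G.subForm S a o s * G.cycleCols S a o s =
      Matrix.fromRows (Matrix.fromRows (G.adjMat S s) 0) 0 := by
  have h : (G.marked a).form s * G.cycleChain S a s =
      Matrix.fromRows (Matrix.of fun c f => s * (f.ind c + f.ind (G.across S c))) 0 := by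
    ext (c | v) f
    · rw [Matrix.mul_apply, Fintype.sum_sum_type]
      simp only [cycleCols, cycleChain, Matrix.fromRows_apply_inl, Matrix.fromRows_apply_inr, Matrix.of_apply,
        MoyalGraph.form_inl_inl, marked_form_inl_inr]
      rw [sum_coupling_chain, f.ind_prev]
      simp
    · rw [Matrix.mul_apply, Fintype.sum_sum_type]
      simp only [cycleCols, cycleChain, Matrix.fromRows_apply_inl, Matrix.fromRows_apply_inr, Matrix.of_apply,
        marked_form_inr_inl, MoyalGraph.form_inr_inr, zero_mul, Finset.sum_const_zero, add_zero,
        Matrix.zero_apply]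
      have h := sum_chain_vertex f.ind v
      rw [← neg_eq_zero, ← Finset.sum_neg_distrib]
      refine Eq.trans (Finset.sum_congr rfl fun c _ => ?_) h
      split_ifs <;> ring
  rw [subForm, Matrix.mul_assoc, G.subIncl_mul_cycle S a o s ho, Matrix.mul_assoc, h]
  ext ((ℓ | ℓ) | w) f
  · rw [Matrix.mul_apply, Fintype.sum_sum_type]
    simp only [Matrix.transpose_apply, subIncl_short, subIncl_inr_inl, zero_mul,
      Finset.sum_const_zero, add_zero, Matrix.fromRows_apply_inl, Matrix.of_apply, add_mul, ite_mul,
      one_mul, Finset.sum_add_distrib, Finset.sum_ite_eq', Finset.mem_univ, if_true, adjMat,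
      G.across_plus S ℓ.2, G.across_minus S ℓ.2]
    ring
  · rw [Matrix.mul_apply, Fintype.sum_sum_type]
    simp only [Matrix.transpose_apply, subIncl_long, subIncl_inr_inl, zero_mul,
      Finset.sum_const_zero, add_zero, Matrix.fromRows_apply_inl, Matrix.fromRows_apply_inr,
      Matrix.of_apply, sub_mul, ite_mul, one_mul, Finset.sum_sub_distrib, Finset.sum_ite_eq',
      Finset.mem_univ, if_true, G.across_plus S ℓ.2, G.across_minus S ℓ.2, Matrix.zero_apply]
    ring
  · rw [Matrix.mul_apply, Fintype.sum_sum_type]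
    simp

theorem subForm_transpose (a : V → Fin 4) (o : {v : V // v ∈ G.verts S}) (s : ℝ) :
    (G.subForm S a o s)ᵀ = -G.subForm S a o s := by
  simp [subForm, Matrix.transpose_mul, MoyalGraph.form_transpose, Matrix.mul_assoc]

theorem subForm_long_momentum (a : V → Fin 4) (o : {v : V // v ∈ G.verts S}) (s : ℝ)
    (ℓ : {ℓ : L // ℓ ∈ S}) (w : {v : {v : V // v ∈ G.verts S} // v ≠ o}) :
    G.subForm S a o s (Sum.inl (Sum.inr ℓ)) (Sum.inr w) = G.cutMatNe S o ℓ w := by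
  rw [subForm, Matrix.mul_assoc, Matrix.mul_apply, Fintype.sum_sum_type]
  simp only [Matrix.transpose_apply, subIncl_long, subIncl_inr_inl, zero_mul,
      Finset.sum_const_zero, add_zero, sub_mul, ite_mul, one_mul, Finset.sum_sub_distrib,
      Finset.sum_ite_eq', Finset.mem_univ, if_true, Matrix.mul_apply, Fintype.sum_sum_type,
      subIncl_inl_inr, mul_zero, zero_add, subIncl_inr_inr, marked_form_inl_inr]
  simp [cutMatNe, cutMat]

theorem subForm_momentum (a : V → Fin 4) (o : {v : V // v ∈ G.verts S}) (s : ℝ)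
    (w w' : {v : {v : V // v ∈ G.verts S} // v ≠ o}) :
    G.subForm S a o s (Sum.inr w) (Sum.inr w') = 0 := by
  rw [subForm, Matrix.mul_assoc, Matrix.mul_apply, Fintype.sum_sum_type]
  simp [Matrix.mul_apply, Fintype.sum_sum_type]

theorem cutMatNe_transpose_mul_cycleMat {a : V → Fin 4} {o : {v : V // v ∈ G.verts S}}
    (ho : ∀ f : G.InternalFace S, (o.1, a o.1) ∉ f.1) :
    (G.cutMatNe S o)ᵀ * G.cycleMat S = 0 := by
  ext w f
  -- The rows of the hypermomenta of the previous identity give the orthogonality; the value of `s`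
  -- plays no role there.
  have h := congrFun (congrFun (G.subForm_mul_cycle S a o 0 ho) (Sum.inr w)) f
  rw [Matrix.mul_apply, Fintype.sum_sum_type, Fintype.sum_sum_type] at h
  have h1 : ∀ ℓ, G.subForm S a o 0 (Sum.inr w) (Sum.inl (Sum.inr ℓ)) =
      -G.cutMatNe S o ℓ w := by
    intro ℓ
    rw [← G.subForm_long_momentum S a o 0 ℓ w]
    exact congrFun (congrFun (G.subForm_transpose S a o 0) (Sum.inl (Sum.inr ℓ))) (Sum.inr w)
  simp only [cycleCols, cycleChain, Matrix.fromRows_apply_inl, Matrix.fromRows_apply_inr, Matrix.zero_apply, mul_zero,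
    Finset.sum_const_zero, zero_add, h1, G.subForm_momentum, zero_mul, add_zero, neg_mul,
    Finset.sum_neg_distrib, neg_eq_zero] at h
  rw [Matrix.mul_apply, Matrix.zero_apply, ← h]
  rfl

theorem cutMat_mulVec (x : {v : V // v ∈ G.verts S} → ℝ) (ℓ : {ℓ : L // ℓ ∈ S}) :
    (G.cutMat S *ᵥ x) ℓ = x ⟨(G.plus ℓ).1, G.plus_mem_verts S ℓ.2⟩ -
      x ⟨(G.minus ℓ).1, G.minus_mem_verts S ℓ.2⟩ := by
  have h : ∀ y : {v : V // v ∈ G.verts S},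
      ∑ v : {v : V // v ∈ G.verts S}, (if y.1 = v.1 then 1 else 0) * x v = x y := by
    intro y
    rw [Finset.sum_eq_single y]
    · simp
    · intro z _ hz
      rw [if_neg fun e => hz (Subtype.ext e.symm), zero_mul]
    · simp
  simp only [Matrix.mulVec, dotProduct, cutMat, Matrix.of_apply, sub_mul, Finset.sum_sub_distrib]
  rw [← h ⟨(G.plus ℓ).1, G.plus_mem_verts S ℓ.2⟩, ← h ⟨(G.minus ℓ).1, G.minus_mem_verts S ℓ.2⟩]

variable {G S}

theorem PrimitivelyDivergent.eq_of_cutMat_mulVec (hS : G.PrimitivelyDivergent S)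
    (x : {v : V // v ∈ G.verts S} → ℝ) (hx : G.cutMat S *ᵥ x = 0)
    (v w : {v : V // v ∈ G.verts S}) : x v = x w := by
  have h := hS.eq_of_lines (fun v => if h : v ∈ G.verts S then x ⟨v, h⟩ else 0) (fun ℓ hℓ => by
    have h1 := congrFun hx ⟨ℓ, hℓ⟩
    rw [cutMat_mulVec, Pi.zero_apply, sub_eq_zero] at h1
    simpa only [dif_pos (G.plus_mem_verts S hℓ), dif_pos (G.minus_mem_verts S hℓ)] using h1) v.2 w.2
  simpa using h

theorem PrimitivelyDivergent.cutMatNe_injective (hS : G.PrimitivelyDivergent S)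
    (o : {v : V // v ∈ G.verts S}) (x : {v : {v : V // v ∈ G.verts S} // v ≠ o} → ℝ)
    (hx : G.cutMatNe S o *ᵥ x = 0) : x = 0 := by
  set y : {v : V // v ∈ G.verts S} → ℝ := fun v => if h : v ≠ o then x ⟨v, h⟩ else 0 with hy
  have h1 : G.cutMat S *ᵥ y = G.cutMatNe S o *ᵥ x := by
    ext ℓ
    simp only [Matrix.mulVec, dotProduct, cutMatNe, Matrix.submatrix_apply, id]
    rw [← Finset.sum_subset (Finset.subset_univ (Finset.univ.filter fun v => v ≠ o)),
      Finset.sum_subtype (Finset.univ.filter fun v => v ≠ o) (p := fun v => v ≠ o) (by simp)]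
    · refine Finset.sum_congr rfl fun v _ => ?_
      rw [hy]
      simp only [dif_pos v.2]
    · intro v _ hv
      have : ¬v ≠ o := by simpa using hv
      rw [hy]
      simp only [dif_neg this, mul_zero]
  have h2 := hS.eq_of_cutMat_mulVec y (h1.trans hx)
  ext v
  have h3 := h2 v.1 o
  simpa [hy, v.2] using h3

/-- A combination of face indicators that gives no cycle is a function on sectors with equal values
at the ends of all lines. It is then constant around each vertex, hence on `S` by connectedness, and
it is zero on the broken face. -/
theorem PrimitivelyDivergent.cycleMat_injective (hS : G.PrimitivelyDivergent S)
    {q : V × Fin 4} (hq : G.IsRootMark S q) (x : G.InternalFace S → ℝ)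
    (hx : G.cycleMat S *ᵥ x = 0) : x = 0 := by
  set g : V × Fin 4 → ℝ := fun c => ∑ f : G.InternalFace S, f.ind c * x f with hg
  have hline : ∀ ℓ ∈ S, g (G.plus ℓ) = g (G.minus ℓ) := by
    intro ℓ hℓ
    have h := congrFun hx ⟨ℓ, hℓ⟩
    simp only [Matrix.mulVec, dotProduct, cycleMat, Matrix.of_apply, sub_mul,
      Finset.sum_sub_distrib, Pi.zero_apply, sub_eq_zero] at h
    exact h
  have hacross : ∀ c, g (G.across S c) = g c := by
    intro c
    by_cases hc : c ∈ G.hooked S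
    · rcases (G.mem_hooked_iff S).1 hc with ⟨ℓ, hℓ, rfl⟩ | ⟨ℓ, hℓ, rfl⟩
      · rw [G.across_plus S hℓ, hline ℓ hℓ]
      · rw [G.across_minus S hℓ, hline ℓ hℓ]
    · rw [G.across_of_notMem S hc]
  have hprev : ∀ c, g (prev c) = g c := by
    intro c
    rw [← hacross c, hg]
    simp only [InternalFace.ind_prev]
  have hvert : ∀ c, g c = g (c.1, 0) := by
    have h1 : ∀ v (i : Fin 4), g (v, i - 1) = g (v, i) := fun v i => hprev (v, i)
    rintro ⟨v, i⟩
    have h01 := h1 v 1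
    have h12 := h1 v 2
    have h23 := h1 v 3
    have e : (1 : Fin 4) - 1 = 0 ∧ (2 : Fin 4) - 1 = 1 ∧ (3 : Fin 4) - 1 = 2 := by decide
    rw [e.1] at h01
    rw [e.2.1] at h12
    rw [e.2.2] at h23
    obtain rfl | rfl | rfl | rfl : i = 0 ∨ i = 1 ∨ i = 2 ∨ i = 3 := by revert i; decide
    · rfl
    · exact h01.symm
    · exact h12.symm.trans h01.symm
    · exact (h23.symm.trans h12.symm).trans h01.symm
  have hconst : ∀ c d, c.1 ∈ G.verts S → d.1 ∈ G.verts S → g c = g d := by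
    intro c d hc hd
    rw [hvert c, hvert d]
    refine hS.eq_of_lines (fun v => g (v, 0)) (fun ℓ hℓ => ?_) hc hd
    change g (_, 0) = g (_, 0)
    rw [← hvert, ← hvert, hline ℓ hℓ]
  have hq0 : g q = 0 := by
    refine Finset.sum_eq_zero fun f _ => ?_
    have : f.ind q = 0 := Set.indicator_of_notMem (fun h => f.2.2 (f.mem_iff h ▸ hq.2.2)) _
    rw [this, zero_mul]
  ext f
  obtain ⟨⟨b, hb, hfb⟩, -⟩ := f.2
  have hbf : b ∈ f.1 := hfb ▸ G.self_mem_faceOf S b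
  have h1 : g b = x f := by
    rw [hg]
    simp only
    rw [Finset.sum_eq_single f]
    · rw [InternalFace.ind, Set.indicator_of_mem hbf, Pi.one_apply, one_mul]
    · intro f' _ hne
      have : f'.ind b = 0 := Set.indicator_of_notMem
        (fun h => hne (Subtype.ext ((f'.mem_iff h).trans (f.mem_iff hbf).symm))) _
      rw [this, zero_mul]
    · simp
  rw [← h1, Pi.zero_apply, ← hq0]
  exact hconst b q hb hq.1

/-- These are principal minors of the Laplacian of `S`, whose kernel consists of constants because
`S` is connected. -/
theorem PrimitivelyDivergent.det_laplacian_eq (hS : G.PrimitivelyDivergent S)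
    (o o' : {v : V // v ∈ G.verts S}) :
    ((G.cutMatNe S o)ᵀ * G.cutMatNe S o).det = ((G.cutMatNe S o')ᵀ * G.cutMatNe S o').det := by
  have h : ∀ o, (G.cutMatNe S o)ᵀ * G.cutMatNe S o =
      ((G.cutMat S)ᵀ * G.cutMat S).submatrix Subtype.val Subtype.val := by
    intro o
    ext i j
    simp [cutMatNe, Matrix.mul_apply]
  rw [h, h]
  have hone : G.cutMat S *ᵥ 1 = 0 := by
    ext ℓ
    rw [cutMat_mulVec]
    simp
  refine Matrix.det_minor_eq (by simp [Matrix.transpose_mul]) ?_ ?_ o o'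
  · rw [← Matrix.mulVec_mulVec, hone, Matrix.mulVec_zero]
  · intro x hx
    refine hS.eq_of_cutMat_mulVec x ?_
    have h1 : (G.cutMat S *ᵥ x) ⬝ᵥ (G.cutMat S *ᵥ x) = 0 := by
      rw [Matrix.dotProduct_mulVec, ← Matrix.mulVec_transpose, Matrix.mulVec_mulVec, hx,
        zero_dotProduct]
    exact dotProduct_self_eq_zero.1 h1

theorem IsRootMark.notMem_internalFace {q : V × Fin 4} (hq : G.IsRootMark S q)
    (f : G.InternalFace S) : (q.1, rootMarks q q.1) ∉ f.1 := by
  rw [rootMarks, Function.update_self]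
  exact fun h => f.2.2 (f.mem_iff h ▸ hq.2.2)

/-! ### The asymptotics of the determinant of the subgraph. -/

/-- The leading coefficient of the subgraph, up to the product of the parameters. -/
noncomputable def leadCoeff (G : Phi4Graph V L) (S : Finset L) (o : {v : V // v ∈ G.verts S})
    (s : ℝ) (t : {ℓ : L // ℓ ∈ S} → ℝ) : ℝ :=
  (Matrix.fromBlocks (Matrix.diagonal fun ℓ => 1 / t ℓ) (G.adjMat S s) (-(G.adjMat S s)ᵀ)
    ((G.cycleMat S)ᵀ * Matrix.diagonal t * G.cycleMat S)).det *
    ((G.cutMatNe S o)ᵀ * G.cutMatNe S o).det / ((G.cycleMat S)ᵀ * G.cycleMat S).det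

theorem PrimitivelyDivergent.leadCoeff_eq (hS : G.PrimitivelyDivergent S)
    (o o' : {v : V // v ∈ G.verts S}) (s : ℝ) (t : {ℓ : L // ℓ ∈ S} → ℝ) :
    G.leadCoeff S o s t = G.leadCoeff S o' s t := by
  rw [leadCoeff, leadCoeff, hS.det_laplacian_eq o o']

/-- This guarantees that the computed limit is the coefficient of the lowest power of `ρ` and not a
zero above it. -/
theorem PrimitivelyDivergent.leadCoeff_ne_zero (hS : G.PrimitivelyDivergent S)
    {q : V × Fin 4} (hq : G.IsRootMark S q) (o : {v : V // v ∈ G.verts S}) (s : ℝ)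
    {t : {ℓ : L // ℓ ∈ S} → ℝ} (ht : ∀ ℓ, 0 < t ℓ) : G.leadCoeff S o s t ≠ 0 :=
  div_ne_zero (mul_ne_zero (det_cycleBlock_ne_zero _ _ (hS.cycleMat_injective hq) t ht)
    (Matrix.det_transpose_mul_self_ne_zero (hS.cutMatNe_injective o)))
    (Matrix.det_transpose_mul_self_ne_zero (hS.cycleMat_injective hq))

/-- A rescaled change of variables in which the form of the subgraph has a limit; the last two
properties control the coupling with the rest of the graph. -/
theorem PrimitivelyDivergent.exists_rescaling (hS : G.PrimitivelyDivergent S)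
    {q : V × Fin 4} (hq : G.IsRootMark S q) {a : V → Fin 4} (ha : ∀ v ∈ G.verts S, a v = rootMarks q v)
    (s : ℝ) (t : {ℓ : L // ℓ ∈ S} → ℝ) :
    ∃ (T : ℝ → Matrix (({ℓ : L // ℓ ∈ S} ⊕ {ℓ : L // ℓ ∈ S}) ⊕
          {v : {v : V // v ∈ G.verts S} // v ≠ ⟨q.1, hq.1⟩})
        (({ℓ : L // ℓ ∈ S} ⊕ {ℓ : L // ℓ ∈ S}) ⊕
          {v : {v : V // v ∈ G.verts S} // v ≠ ⟨q.1, hq.1⟩}) ℝ) (κ : ℝ) (N₀ : Matrix _ _ ℝ), κ ≠ 0 ∧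
      (∀ ρ ≠ 0, (T ρ).det ^ 2 = ρ ^ (2 * Fintype.card
        {v : {v : V // v ∈ G.verts S} // v ≠ ⟨q.1, hq.1⟩}) * κ) ∧
      Tendsto (fun ρ => (T ρ)ᵀ * (diagPart _ (fun ℓ => ρ ^ 2 * t ℓ) +
        G.subForm S a ⟨q.1, hq.1⟩ s) * T ρ) (𝓝[>] 0) (𝓝 N₀) ∧
      N₀.det = κ * G.leadCoeff S ⟨q.1, hq.1⟩ s t ∧
      (∀ ℓ k, Tendsto (fun ρ => T ρ (Sum.inl (Sum.inl ℓ)) k) (𝓝[>] 0) (𝓝 0)) ∧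
      ∀ ℓ k, Tendsto (fun ρ => ρ ^ 2 * T ρ (Sum.inl (Sum.inr ℓ)) k) (𝓝[>] 0) (𝓝 0) := by
  set o : {v : V // v ∈ G.verts S} := ⟨q.1, hq.1⟩ with ho'
  have ho : ∀ f : G.InternalFace S, (o.1, a o.1) ∉ f.1 := by
    intro f
    rw [ha _ hq.1]
    exact hq.notMem_internalFace f
  have hCZ := G.cutMatNe_transpose_mul_cycleMat S ho
  have hZ := Matrix.det_transpose_mul_self_ne_zero (hS.cycleMat_injective hq)
  have hC := Matrix.det_transpose_mul_self_ne_zero (hS.cutMatNe_injective o)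
  have hcard := hS.card_internalFace o
  rw [← Fintype.card_sum] at hcard
  let ε := Fintype.equivOfCardEq hcard
  obtain ⟨N₀, hN, hdet⟩ := tendsto_scaledBasis_congr (G.subForm_transpose S a o s)
    (G.cycleMat S) (G.cutMatNe S o) (G.windMat S a o s) (G.adjMat S s)
    (G.subForm_long_momentum S a o s) (G.subForm_momentum S a o s)
    (G.subForm_mul_cycle S a o s ho) ε t
  refine ⟨scaledBasis (G.cycleMat S) (G.cutMatNe S o) (G.windMat S a o s) ε, _, N₀,
    mul_ne_zero hZ hC, fun ρ hρ => det_scaledBasis_sq _ _ _ hCZ ε ρ hρ, hN, ?_,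
    tendsto_scaledBasis_short _ _ _ ε, tendsto_scaledBasis_long _ _ _ ε⟩
  rw [hdet, leadCoeff]
  field_simp

theorem PrimitivelyDivergent.tendsto_det_sub (hS : G.PrimitivelyDivergent S)
    {q : V × Fin 4} (hq : G.IsRootMark S q) (s : ℝ) (t : {ℓ : L // ℓ ∈ S} → ℝ) :
    Tendsto (fun ρ : ℝ => ((G.sub S q).M ⟨q.1, hq.1⟩ s (fun ℓ => ρ ^ 2 * t ℓ)).det *
        ρ ^ (2 * Fintype.card {v : {v : V // v ∈ G.verts S} // v ≠ ⟨q.1, hq.1⟩}))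
      (𝓝[>] 0) (𝓝 (G.leadCoeff S ⟨q.1, hq.1⟩ s t)) := by
  obtain ⟨T, κ, N₀, hκ, hT, hN, hdet, -, -⟩ := hS.exists_rescaling hq (fun _ _ => rfl) s t
  have h1 := ((continuous_id.matrix_det).tendsto N₀).comp hN
  have h2 := h1.mul_const κ⁻¹
  rw [id, hdet, mul_comm κ, mul_assoc, mul_inv_cancel₀ hκ, mul_one] at h2
  refine h2.congr' ?_
  filter_upwards [self_mem_nhdsWithin] with ρ hρ
  have hM : (G.sub S q).M ⟨q.1, hq.1⟩ s (fun ℓ => ρ ^ 2 * t ℓ) =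
      diagPart _ (fun ℓ => ρ ^ 2 * t ℓ) + G.subForm S (rootMarks q) ⟨q.1, hq.1⟩ s := by
    rw [MoyalGraph.M, G.sub_B S q hq.2.1 (fun _ _ => rfl)]
    rfl
  have h3 := hT ρ (ne_of_gt hρ)
  rw [hM, Function.comp_apply, id, Matrix.det_mul, Matrix.det_mul, Matrix.det_transpose]
  calc _ = (diagPart _ (fun ℓ => ρ ^ 2 * t ℓ) +
        G.subForm S (rootMarks q) ⟨q.1, hq.1⟩ s).det * (T ρ).det ^ 2 * κ⁻¹ := by ring
    _ = _ := by rw [h3]; field_simp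

end Phi4Graph

/-! ### Paths along the broken face. -/

namespace Phi4Graph

variable {V L : Type*} [DecidableEq V] [Fintype V] (G : Phi4Graph V L) (S : Finset L)

open Classical in
/-- The sectors that the walk from `q` visits up to the leg `c`. -/
noncomputable def visited (q c d : V × Fin 4) : ℝ :=
  if d ∈ G.faceOf S q ∧ G.firstVisit S q d ≤ G.firstVisit S q c then 1 else 0

/-- The sectors that the walk from `q` leaves before it meets the leg `c`. -/
noncomputable def left (q c d : V × Fin 4) : ℝ := G.visited S q c (G.faceStep S d)

theorem left_prev (q c d : V × Fin 4) :
    G.left S q c (prev d) = G.visited S q c (G.across S d) := by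
  rw [left, faceStep_prev]

variable {G S}

theorem left_self {q c : V × Fin 4} (hc : c ∈ G.faceOf S q) : G.left S q c q = 1 := by
  rw [left, visited, if_pos]
  refine ⟨(G.faceStep_mem_faceOf S).2 (G.self_mem_faceOf S q), ?_⟩
  rw [firstVisit_faceStep_self]
  exact (firstVisit_spec hc).1

theorem left_eq_zero {q c d : V × Fin 4} (hq : q.1 ∈ G.verts S) (hd : d.1 ∉ G.verts S) :
    G.left S q c d = 0 := by
  rw [left, visited, if_neg]
  rintro ⟨h, -⟩
  exact hd ((G.mem_verts_of_mem_faceOf S ((G.faceStep_mem_faceOf S).1 h)).2 hq)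

/-- The two sets of sectors on the walk differ at its ends: the start `q` is left but not yet
visited, the end `c` is visited but not left. For `c = q` the walk is a full turn and the
corrections cancel. -/
theorem visited_eq {q c : V × Fin 4} (hc : c ∈ G.faceOf S q) (d : V × Fin 4) :
    G.visited S q c d =
      G.left S q c d - (if d = q then 1 else 0) + if d = c then 1 else 0 := by
  by_cases hd : d ∈ G.faceOf S q
  · by_cases hdq : d = q
    · subst hdq
      rw [left_self hc, visited]
      have h := firstVisit_le_self hc
      by_cases hdc : d = c
      · subst hdc
        simp [hd]
      · have : ¬G.firstVisit S d d ≤ G.firstVisit S d c := fun h' =>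
          hdc (firstVisit_injOn hd hc (le_antisymm h' h))
        simp [hdc, this]
    · rw [left, visited, visited, firstVisit_faceStep hd hdq]
      have hs := (G.faceStep_mem_faceOf S (c := q) (d := d)).2 hd
      by_cases hdc : d = c
      · subst hdc
        simp [hd, hdq]
      · have h1 : G.firstVisit S q d ≠ G.firstVisit S q c := fun h =>
          hdc (firstVisit_injOn hd hc h)
        have h2 : G.firstVisit S q d + 1 ≤ G.firstVisit S q c ↔
            G.firstVisit S q d ≤ G.firstVisit S q c := by omega
        simp [hd, hdq, hdc, hs, h2]
  · have h1 : d ≠ q := fun h => hd (h ▸ G.self_mem_faceOf S q)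
    have h2 : d ≠ c := fun h => hd (h ▸ hc)
    have h3 : G.faceStep S d ∉ G.faceOf S q := fun h => hd ((G.faceStep_mem_faceOf S).1 h)
    simp [left, visited, hd, h1, h2, h3]

variable (G S)

/-- The coordinates of the path from the start of the walk to the leg `c`. -/
noncomputable def pathFun (q c d : V × Fin 4) : ℝ :=
  (if d = q then 1 else 0) - G.left S q c d

/-- The hypermomenta that complete the path to the leg `c`. -/
noncomputable def pathMomentum (a : V → Fin 4) (s : ℝ) (q c : V × Fin 4) (v : V) : ℝ :=
  if v ∈ G.verts S then s * (1 + (if v = q.1 then 1 else 0) - 2 * G.left S q c (v, a v)) else 0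

/-- The oscillation of the completed path to the leg `c` with the half-line `d`. -/
noncomputable def pathCoupling (q c d : V × Fin 4) : ℝ :=
  if d.1 ∈ G.verts S then
    1 + (if d = c then 1 else 0) - G.visited S q c d - G.visited S q c (G.across S d) else 0

variable {G S}

/-- The leg together with its path is the half-line `q` minus a chain of sectors. The oscillation of
both is known, by `marked_coupling_last` and `sum_coupling_chain`. -/
theorem pathFun_sub_across {q c : V × Fin 4} (hc : c ∈ G.faceOf S q) (hcl : c ∈ G.legs S)
    (d : V × Fin 4) :
    (if d = c then 1 else 0) + (G.pathFun S q c d - G.pathFun S q c (G.across S d)) =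
      (if d = q then 1 else 0) - (G.left S q c d - G.left S q c (prev d)) := by
  have h : (G.across S d = c) = (d = c) := by
    rw [G.across_eq_iff_eq_across S, G.across_of_notMem S ((G.mem_legs S).1 hcl).2]
  rw [left_prev, visited_eq hc (G.across S d), pathFun, pathFun]
  simp only [h]
  ring

/-- Equal values at the ends of each line of `S` mean that the completed path is decoupled from the
long variables of `S`. -/
theorem pathCoupling_across {q c : V × Fin 4} (hcl : c ∈ G.legs S) (d : V × Fin 4) :
    G.pathCoupling S q c (G.across S d) = G.pathCoupling S q c d := by
  have h : (G.across S d = c) = (d = c) := by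
    rw [G.across_eq_iff_eq_across S, G.across_of_notMem S ((G.mem_legs S).1 hcl).2]
  rw [pathCoupling, pathCoupling, across_across]
  simp only [h, G.across_mem_verts S]
  split_ifs <;> ring

theorem marked_coupling_last (a : V → Fin 4) (s : ℝ) (d : V × Fin 4) {q : V × Fin 4}
    (hq : a q.1 = q.2) : (G.marked a).coupling s d q =
      s * ((if d = q then 1 else 0) - if d.1 = q.1 then 1 else 0) := by
  rw [marked_coupling]
  by_cases h : d.1 = q.1
  · obtain ⟨v, i⟩ := d
    obtain ⟨w, j⟩ := q
    simp only at h hq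
    subst h
    have key : ∀ i j : Fin 4, ¬(j - j - 1 < i - j - 1) ∧ (i - j - 1 < j - j - 1 ↔ i ≠ j) := by
      decide
    by_cases hij : i = j
    · subst hij
      simp [hq]
    · simp only [hq, if_true, if_pos ((key i j).2.2 hij), Prod.mk.injEq, true_and, if_neg hij]
      push_cast
      ring
  · have : d ≠ q := fun e => h (congrArg Prod.fst e)
    simp [h, this]

/-- The hypermomenta cancel the wrap-around term of the chain and the coupling to the vertex of `q`.
The constant `s` that they contain in addition is invisible to long variables and makes the value at
another leg `s` or `-s`. -/
theorem sum_coupling_path {a : V → Fin 4} (s : ℝ) {q c : V × Fin 4} (hq : a q.1 = q.2)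
    (hqS : q.1 ∈ G.verts S) (hc : c ∈ G.faceOf S q) (hcl : c ∈ G.legs S) (d : V × Fin 4) :
    ∑ d', (G.marked a).coupling s d d' * ((if d' = c then 1 else 0) +
        (G.pathFun S q c d' - G.pathFun S q c (G.across S d'))) +
      G.pathMomentum S a s q c d.1 = s * G.pathCoupling S q c d := by
  simp only [pathFun_sub_across hc hcl, mul_sub ((G.marked a).coupling s d _),
    Finset.sum_sub_distrib]
  have h := G.sum_coupling_chain a s (G.left S q c) d
  simp only [mul_sub, Finset.sum_sub_distrib] at h
  rw [h]
  simp only [mul_ite, mul_one, mul_zero, Finset.sum_ite_eq', Finset.mem_univ, if_true]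
  rw [marked_coupling_last a s d hq, pathMomentum, pathCoupling, left_prev]
  by_cases hd : d.1 ∈ G.verts S
  · rw [if_pos hd, if_pos hd, visited_eq hc d]
    ring
  · have h1 : d.1 ≠ q.1 := fun e => hd (e ▸ hqS)
    have h2 : d ≠ q := fun e => h1 (congrArg Prod.fst e)
    rw [if_neg hd, if_neg hd, ← left_prev, left_eq_zero hqS hd,
      left_eq_zero (d := prev d) hqS hd, left_eq_zero (d := (d.1, a d.1)) hqS hd]
    simp [h1, h2]

theorem sum_path_vertex {q c : V × Fin 4} (hc : c ∈ G.faceOf S q) (hcl : c ∈ G.legs S) (v : V) :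
    ∑ d : V × Fin 4, (if d.1 = v then 1 else 0) * ((if d = c then 1 else 0) +
        (G.pathFun S q c d - G.pathFun S q c (G.across S d))) = if q.1 = v then 1 else 0 := by
  simp only [pathFun_sub_across hc hcl]
  have h := sum_chain_vertex (G.left S q c) v
  simp only [mul_sub _ (ite _ _ _), Finset.sum_sub_distrib, h]
  simp

/-- Sums over a path with coefficients that agree at the ends of every line. -/
theorem sum_path_of_across {q c : V × Fin 4} (φ : V × Fin 4 → ℝ)
    (hφ : ∀ d, φ (G.across S d) = φ d) :
    ∑ d, ((if d = c then 1 else 0) +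
      (G.pathFun S q c d - G.pathFun S q c (G.across S d))) * φ d = φ c := by
  simp only [add_mul, sub_mul, Finset.sum_add_distrib, Finset.sum_sub_distrib]
  have h : ∑ d, G.pathFun S q c (G.across S d) * φ d = ∑ d, G.pathFun S q c d * φ d := by
    let σ : Equiv.Perm (V × Fin 4) :=
      ⟨G.across S, G.across S, G.across_across S, G.across_across S⟩
    rw [← Equiv.sum_comp σ]
    refine Finset.sum_congr rfl fun d _ => ?_
    change G.pathFun S q c (G.across S (G.across S d)) * φ (G.across S d) = _
    rw [across_across, hφ]
  rw [h, sub_self, add_zero]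
  simp

/-- The vertex of `q` carries no hypermomentum of the subgraph. None is needed, since the walk
leaves the sector where the numbering of that vertex starts: `1 + 1 - 2 = 0`. -/
theorem pathMomentum_self {a : V → Fin 4} (s : ℝ) {q c : V × Fin 4} (hq : a q.1 = q.2)
    (hc : c ∈ G.faceOf S q) : G.pathMomentum S a s q c q.1 = 0 := by
  rw [pathMomentum, hq, left_self hc]
  simp only [if_true]
  split_ifs <;> ring

section Contract

theorem contract_num_parity (hS : G.PrimitivelyDivergent S) {q r : V × Fin 4}
    (hq : G.IsRootMark S q) (hr : Odd (r.2 : ℕ)) (c : {c : V × Fin 4 // c ∉ G.hooked S}) :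
    Odd ((G.contract S q r).num c) ↔ Even (c.1.2 : ℕ) := by
  change Odd (if c.1.1 ∈ G.verts S then G.legNumber S q c.1 else number r c.1) ↔ _
  by_cases h : c.1.1 ∈ G.verts S
  · rw [if_pos h]
    have hcl : c.1 ∈ G.legs S := (G.mem_legs S).2 ⟨h, c.2⟩
    exact odd_card_legs_firstVisit hq.2.1 (fun x hx => hS.mem_faceOf_of_mem_legs hq hx) hq.1 _
      c.1 (hS.mem_faceOf_of_mem_legs hq hcl) rfl
  · rw [if_neg h, number_eq]
    exact marked_num_even_iff (odd_rootMarks hr _)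

theorem contract_isOriented (hS : G.PrimitivelyDivergent S) {q r : V × Fin 4}
    (hq : G.IsRootMark S q) (hr : Odd (r.2 : ℕ)) : (G.contract S q r).IsOriented := by
  refine ⟨fun ℓ => (contract_num_parity hS hq hr _).2 (G.plus_even ℓ), fun ℓ => ?_⟩
  rw [← Nat.not_odd_iff_even, contract_num_parity hS hq hr]
  exact Nat.not_even_iff_odd.2 (G.minus_odd ℓ)

theorem contract_vert (q r : V × Fin 4) (c : {c : V × Fin 4 // c ∉ G.hooked S}) :
    (G.contract S q r).vert c = G.contractVertex S c.1.1 := rfl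

theorem contractVertex_of_mem {v : V} (h : v ∈ G.verts S) : G.contractVertex S v = none :=
  dif_pos h

theorem contractVertex_of_notMem {v : V} (h : v ∉ G.verts S) :
    G.contractVertex S v = some ⟨v, h⟩ :=
  dif_neg h

theorem contractVertex_eq_iff {v w : V} (hw : w ∉ G.verts S) :
    G.contractVertex S v = G.contractVertex S w ↔ v = w := by
  refine ⟨fun h => ?_, fun h => h ▸ rfl⟩
  rw [contractVertex_of_notMem hw] at h
  by_cases hv : v ∈ G.verts S
  · rw [contractVertex_of_mem hv] at h
    simp at h
  · rw [contractVertex_of_notMem hv, Option.some.injEq, Subtype.mk.injEq] at h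
    exact h

theorem contractVertex_across (d : V × Fin 4) :
    G.contractVertex S (G.across S d).1 = G.contractVertex S d.1 := by
  by_cases h : d ∈ G.hooked S
  · have h1 : d.1 ∈ G.verts S := Finset.mem_image_of_mem _ h
    rw [contractVertex_of_mem h1, contractVertex_of_mem ((G.across_mem_verts S).2 h1)]
  · rw [G.across_of_notMem S h]

/-- A leg is fixed by `across`, so its path coupling is `-1`, `0` or `1` as it is met before, at or
after `c`. This is the order of the legs at the contracted vertex. -/
theorem contract_coupling_leg (hS : G.PrimitivelyDivergent S) {q r : V × Fin 4}
    (hq : G.IsRootMark S q) (s : ℝ) {c c' : {c : V × Fin 4 // c ∉ G.hooked S}}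
    (hc : c.1.1 ∈ G.verts S) (hc' : c'.1.1 ∈ G.verts S) :
    (G.contract S q r).coupling s c' c = s * G.pathCoupling S q c.1 c'.1 := by
  have hl : c.1 ∈ G.legs S := (G.mem_legs S).2 ⟨hc, c.2⟩
  have hl' : c'.1 ∈ G.legs S := (G.mem_legs S).2 ⟨hc', c'.2⟩
  have hlegs : ∀ x ∈ G.legs S, x ∈ G.faceOf S q := fun x hx => hS.mem_faceOf_of_mem_legs hq hx
  have hv : (G.contract S q r).vert c' = (G.contract S q r).vert c := by
    rw [contract_vert, contract_vert, contractVertex_of_mem hc, contractVertex_of_mem hc']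
  have hn : ∀ x : {c : V × Fin 4 // c ∉ G.hooked S}, x.1.1 ∈ G.verts S →
      (G.contract S q r).num x = G.legNumber S q x.1 := fun x hx => if_pos hx
  rw [MoyalGraph.coupling, if_pos hv, MoyalGraph.omega, hn c hc, hn c' hc', pathCoupling,
    if_pos hc', G.across_of_notMem S c'.2, visited]
  have h1 := legNumber_lt_iff hlegs hl' hl
  have h2 := legNumber_lt_iff hlegs hl hl'
  simp only [h1, h2, hlegs _ hl', true_and]
  rcases lt_trichotomy (G.firstVisit S q c'.1) (G.firstVisit S q c.1) with h | h | h
  · have hne : c'.1 ≠ c.1 := fun e => by rw [e] at h; exact lt_irrefl _ h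
    simp [h, h.le, hne]
  · have he : c'.1 = c.1 := firstVisit_injOn (hlegs _ hl') (hlegs _ hl) h
    simp [he]
  · have hne : c'.1 ≠ c.1 := fun e => by rw [e] at h; exact lt_irrefl _ h
    simp [h, h.not_ge, h.not_gt, hne]

theorem contract_coupling_of_notMem {q r : V × Fin 4} (s : ℝ) {a : V → Fin 4}
    (ha : ∀ v ∉ G.verts S, a v = rootMarks r v) {c c' : {c : V × Fin 4 // c ∉ G.hooked S}}
    (hc : c.1.1 ∉ G.verts S) :
    (G.contract S q r).coupling s c' c = (G.marked a).coupling s c'.1 c.1 := by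
  rw [MoyalGraph.coupling, marked_coupling]
  simp only [contract_vert, contractVertex_eq_iff hc]
  by_cases h : c'.1.1 = c.1.1
  · have hc' : c'.1.1 ∉ G.verts S := h ▸ hc
    have hn : ∀ x : {c : V × Fin 4 // c ∉ G.hooked S}, x.1.1 ∉ G.verts S →
        (G.contract S q r).num x = ((x.1.2 - a x.1.1 - 1 : Fin 4) : ℕ) + 1 := by
      intro x hx
      rw [ha _ hx, ← number_eq]
      exact if_neg hx
    rw [if_pos h, if_pos h, MoyalGraph.omega, hn c hc, hn c' hc']
    simp only [add_lt_add_iff_right, Fin.val_fin_lt]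
  · rw [if_neg h, if_neg h]

end Contract

end Phi4Graph

/-! ### Decoupling the contracted graph from the subgraph. -/

namespace Phi4Graph

variable {V L : Type*} [DecidableEq V] [Fintype V] (G : Phi4Graph V L) (S : Finset L)

/-- The vertex of `G` that stands for a vertex of `G/S`; the contracted vertex goes to `v`. -/
def rep (v : V) (x : Option {v : V // v ∉ G.verts S}) : V := x.elim v Subtype.val

/-- The coordinates of the completed paths. -/
noncomputable def pathMat (a : V → Fin 4) (s : ℝ) (q : V × Fin 4)
    (o : {v : V // v ∈ G.verts S}) :
    Matrix (({ℓ : L // ℓ ∈ S} ⊕ {ℓ : L // ℓ ∈ S}) ⊕ {v : {v : V // v ∈ G.verts S} // v ≠ o})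
      ({c : V × Fin 4 // c ∉ G.hooked S} ⊕ Option {v : V // v ∉ G.verts S}) ℝ :=
  Matrix.fromBlocks
    (Matrix.fromRows 0 (Matrix.of fun ℓ c => if c.1.1 ∈ G.verts S then
      G.pathFun S q c.1 (G.plus ℓ) - G.pathFun S q c.1 (G.minus ℓ) else 0)) 0
    (Matrix.of fun w c => if c.1.1 ∈ G.verts S then G.pathMomentum S a s q c.1 w.1.1 else 0)
    (Matrix.of fun _ x => if x = none then 1 else 0)

/-- The half-lines and vertices of `G/S` among those of `G`. -/
def repMat (q : V × Fin 4) : Matrix ((V × Fin 4) ⊕ V)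
    ({c : V × Fin 4 // c ∉ G.hooked S} ⊕ Option {v : V // v ∉ G.verts S}) ℝ :=
  (1 : Matrix ((V × Fin 4) ⊕ V) ((V × Fin 4) ⊕ V) ℝ).submatrix id
    (Sum.map Subtype.val (G.rep S q.1))

/-- The half-lines and vertices of `G/S`, decoupled from the subgraph `S`. -/
noncomputable def decoupled [Fintype L] [DecidableEq L] (a : V → Fin 4) (s : ℝ) (q : V × Fin 4)
    (o : {v : V // v ∈ G.verts S}) : Matrix ((V × Fin 4) ⊕ V)
    ({c : V × Fin 4 // c ∉ G.hooked S} ⊕ Option {v : V // v ∉ G.verts S}) ℝ :=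
  G.subIncl S o * G.pathMat S a s q o + G.repMat S q

/-- The oscillation of the decoupled half-lines and vertices with those of `G`. -/
noncomputable def decoupledForm (a : V → Fin 4) (s : ℝ) (q : V × Fin 4) :
    Matrix ((V × Fin 4) ⊕ V)
      ({c : V × Fin 4 // c ∉ G.hooked S} ⊕ Option {v : V // v ∉ G.verts S}) ℝ :=
  Matrix.fromBlocks
    (Matrix.of fun d c => if c.1.1 ∈ G.verts S then s * G.pathCoupling S q c.1 d
      else (G.marked a).coupling s d c.1)
    (Matrix.of fun d x => if G.contractVertex S d.1 = x then 1 else 0)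
    (Matrix.of fun v c => if c.1.1 ∈ G.verts S then (if q.1 = v then -1 else 0)
      else if c.1.1 = v then -1 else 0) 0

variable {G S}

theorem contractVertex_rep {v : V} (hv : v ∈ G.verts S)
    (x : Option {v : V // v ∉ G.verts S}) : G.contractVertex S (G.rep S v x) = x := by
  rcases x with - | x
  · exact contractVertex_of_mem hv
  · exact contractVertex_of_notMem x.2

variable [Fintype L] [DecidableEq L]

section Entries

variable (a : V → Fin 4) (s : ℝ) {q : V × Fin 4} (o : {v : V // v ∈ G.verts S})

theorem decoupled_leg (d : V × Fin 4) {c : {c : V × Fin 4 // c ∉ G.hooked S}}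
    (hc : c.1.1 ∈ G.verts S) : G.decoupled S a s q o (Sum.inl d) (Sum.inl c) =
      (if d = c.1 then 1 else 0) +
        (G.pathFun S q c.1 d - G.pathFun S q c.1 (G.across S d)) := by
  rw [← G.sum_lines S (G.pathFun S q c.1) d, decoupled, Matrix.add_apply, Matrix.mul_apply,
    Fintype.sum_sum_type, Fintype.sum_sum_type, add_comm]
  simp [pathMat, repMat, hc, Matrix.one_apply]

theorem decoupled_of_notMem (d : V × Fin 4) {c : {c : V × Fin 4 // c ∉ G.hooked S}}
    (hc : c.1.1 ∉ G.verts S) : G.decoupled S a s q o (Sum.inl d) (Sum.inl c) =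
      if d = c.1 then 1 else 0 := by
  rw [decoupled, Matrix.add_apply, Matrix.mul_apply, Fintype.sum_sum_type, Fintype.sum_sum_type]
  simp [pathMat, repMat, hc, Matrix.one_apply]

theorem decoupled_inl_inr (d : V × Fin 4) (x : Option {v : V // v ∉ G.verts S}) :
    G.decoupled S a s q o (Sum.inl d) (Sum.inr x) = 0 := by
  rw [decoupled, Matrix.add_apply, Matrix.mul_apply, Fintype.sum_sum_type, Fintype.sum_sum_type]
  simp [pathMat, repMat, Matrix.one_apply]

theorem sum_ne_root (f : V → ℝ) (hf : f o.1 = 0) (v : V) :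
    ∑ w : {v : {v : V // v ∈ G.verts S} // v ≠ o}, (if v = w.1.1 then 1 else 0) * f w.1.1 =
      if v ∈ G.verts S then f v else 0 := by
  by_cases hv : v ∈ G.verts S
  · rw [if_pos hv]
    by_cases hvo : (⟨v, hv⟩ : {v : V // v ∈ G.verts S}) = o
    · have h0 : f v = 0 := by
        have : v = o.1 := congrArg Subtype.val hvo
        rw [this, hf]
      rw [h0]
      refine Finset.sum_eq_zero fun w _ => ?_
      rw [if_neg, zero_mul]
      rintro rfl
      exact w.2 hvo
    · rw [Finset.sum_eq_single ⟨⟨v, hv⟩, hvo⟩]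
      · simp
      · intro w _ hw
        rw [if_neg, zero_mul]
        rintro rfl
        exact hw rfl
      · simp
  · rw [if_neg hv]
    refine Finset.sum_eq_zero fun w _ => ?_
    rw [if_neg, zero_mul]
    rintro rfl
    exact hv w.1.2

theorem decoupled_momentum_leg (hq : a q.1 = q.2) (ho : o.1 = q.1) (v : V)
    {c : {c : V × Fin 4 // c ∉ G.hooked S}} (hc : c.1.1 ∈ G.verts S)
    (hcq : c.1 ∈ G.faceOf S q) : G.decoupled S a s q o (Sum.inr v) (Sum.inl c) =
      G.pathMomentum S a s q c.1 v := by
  have h := sum_ne_root o (G.pathMomentum S a s q c.1)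
    (by rw [ho]; exact pathMomentum_self s hq hcq) v
  have h1 : (if v ∈ G.verts S then G.pathMomentum S a s q c.1 v else 0) =
      G.pathMomentum S a s q c.1 v := by
    by_cases hv : v ∈ G.verts S
    · rw [if_pos hv]
    · rw [if_neg hv, pathMomentum, if_neg hv]
  rw [decoupled, Matrix.add_apply, Matrix.mul_apply, Fintype.sum_sum_type, ← h1, ← h]
  simp [pathMat, repMat, hc, Matrix.one_apply]

theorem decoupled_momentum_of_notMem (v : V)
    {c : {c : V × Fin 4 // c ∉ G.hooked S}} (hc : c.1.1 ∉ G.verts S) :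
    G.decoupled S a s q o (Sum.inr v) (Sum.inl c) = 0 := by
  rw [decoupled, Matrix.add_apply, Matrix.mul_apply, Fintype.sum_sum_type]
  simp [pathMat, repMat, hc, Matrix.one_apply]

/-- The contracted vertex receives the total hypermomentum of `S`: `repMat` contributes the vertex
of `q` and `pathMat` all the others. -/
theorem decoupled_inr_inr (ho : o.1 = q.1) (v : V) (x : Option {v : V // v ∉ G.verts S}) :
    G.decoupled S a s q o (Sum.inr v) (Sum.inr x) =
      if G.contractVertex S v = x then 1 else 0 := by
  have h := sum_ne_root o (fun v => if x = none ∧ v ≠ o.1 then 1 else 0) (by simp) v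
  have h1 : ∀ w : {v : {v : V // v ∈ G.verts S} // v ≠ o},
      (if x = none ∧ w.1.1 ≠ o.1 then (1 : ℝ) else 0) = if x = none then 1 else 0 := by
    intro w
    have : w.1.1 ≠ o.1 := fun e => w.2 (Subtype.ext e)
    simp [this]
  simp only [h1] at h
  have h2 : G.decoupled S a s q o (Sum.inr v) (Sum.inr x) =
      (∑ w : {v : {v : V // v ∈ G.verts S} // v ≠ o}, (if v = w.1.1 then 1 else 0) *
        if x = none then 1 else 0) + if v = G.rep S q.1 x then 1 else 0 := by
    rw [decoupled, Matrix.add_apply, Matrix.mul_apply, Fintype.sum_sum_type]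
    simp [pathMat, repMat, Matrix.one_apply]
  rw [h2, h]
  have hoS := o.2
  rcases x with - | x
  · by_cases hv : v ∈ G.verts S
    · rw [contractVertex_of_mem hv]
      by_cases hvo : v = o.1
      · simp [hv, hvo, rep, ho]
      · have : v ≠ q.1 := fun e => hvo (e.trans ho.symm)
        simp [hv, hvo, rep, this]
    · rw [contractVertex_of_notMem hv]
      have : v ≠ q.1 := fun e => hv (e.trans ho.symm ▸ hoS)
      simp [hv, rep, this]
  · by_cases hv : v ∈ G.verts S
    · rw [contractVertex_of_mem hv]
      have : v ≠ x.1 := fun e => x.2 (e ▸ hv)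
      simp [hv, rep, this]
    · rw [contractVertex_of_notMem hv]
      simp only [hv, if_false, zero_add, rep, Option.elim_some, Option.some.injEq, Subtype.ext_iff]
      congr

end Entries

section Forms

variable {a : V → Fin 4} {q r : V × Fin 4}

theorem form_mul_decoupled (hS : G.PrimitivelyDivergent S) (hq : G.IsRootMark S q)
    (haq : a q.1 = q.2) (s : ℝ) :
    (G.marked a).form s * G.decoupled S a s q ⟨q.1, hq.1⟩ = G.decoupledForm S a s q := by
  have hlegs : ∀ c : {c : V × Fin 4 // c ∉ G.hooked S}, c.1.1 ∈ G.verts S → c.1 ∈ G.legs S :=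
    fun c hc => (G.mem_legs S).2 ⟨hc, c.2⟩
  have hface : ∀ x ∈ G.legs S, x ∈ G.faceOf S q := fun x hx => hS.mem_faceOf_of_mem_legs hq hx
  ext (d | v) (c | x)
  · rw [Matrix.mul_apply, Fintype.sum_sum_type]
    by_cases hc : c.1.1 ∈ G.verts S
    · simp only [decoupled_leg a s _ _ hc, MoyalGraph.form_inl_inl, marked_form_inl_inr,
        decoupled_momentum_leg a s ⟨q.1, hq.1⟩ haq rfl _ hc (hface _ (hlegs c hc)), ite_mul, one_mul,
        zero_mul, Finset.sum_ite_eq, Finset.mem_univ, if_true]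
      rw [sum_coupling_path s haq hq.1 (hface _ (hlegs c hc)) (hlegs c hc) d]
      simp [decoupledForm, hc]
    · simp only [decoupled_of_notMem a s _ _ hc, MoyalGraph.form_inl_inl,
        decoupled_momentum_of_notMem a s _ _ hc, mul_zero, Finset.sum_const_zero, add_zero,
        mul_ite, mul_one, Finset.sum_ite_eq', Finset.mem_univ, if_true]
      simp [decoupledForm, hc]
  · rw [Matrix.mul_apply, Fintype.sum_sum_type]
    simp only [decoupled_inl_inr, mul_zero, Finset.sum_const_zero, zero_add,
      decoupled_inr_inr a s ⟨q.1, hq.1⟩ rfl, marked_form_inl_inr, ite_mul, one_mul, zero_mul,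
      Finset.sum_ite_eq, Finset.mem_univ, if_true]
    simp [decoupledForm]
  · rw [Matrix.mul_apply, Fintype.sum_sum_type]
    simp only [MoyalGraph.form_inr_inr, zero_mul, Finset.sum_const_zero, add_zero,
      marked_form_inr_inl]
    by_cases hc : c.1.1 ∈ G.verts S
    · have h := sum_path_vertex (hface _ (hlegs c hc)) (hlegs c hc) v
      simp only [decoupled_leg a s _ _ hc]
      have h1 : ∀ d : V × Fin 4, (if d.1 = v then (-1 : ℝ) else 0) =
          -(if d.1 = v then 1 else 0) := by
        intro d
        split_ifs <;> simp
      simp only [h1, neg_mul, Finset.sum_neg_distrib, h]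
      simp only [decoupledForm, Matrix.fromBlocks_apply₂₁, Matrix.of_apply, if_pos hc]
      split_ifs <;> simp
    · simp only [decoupled_of_notMem a s _ _ hc, mul_ite, mul_one, mul_zero, Finset.sum_ite_eq',
        Finset.mem_univ, if_true]
      simp [decoupledForm, hc]
  · rw [Matrix.mul_apply, Fintype.sum_sum_type]
    simp [decoupled_inl_inr, decoupledForm]

/-- The columns of `decoupledForm` that meet `S` are invariant under `across`, so the paths in the
left factor drop out (`sum_path_of_across`) and only the value at the leg itself remains. The
hypermomenta of a path could contribute only at the vertex of `q`, where they vanish. -/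
theorem decoupled_transpose_mul (hS : G.PrimitivelyDivergent S) (hq : G.IsRootMark S q)
    (haq : a q.1 = q.2) (ha : ∀ v ∉ G.verts S, a v = rootMarks r v) (s : ℝ) :
    (G.decoupled S a s q ⟨q.1, hq.1⟩)ᵀ * G.decoupledForm S a s q =
      (G.contract S q r).form s := by
  have hlegs : ∀ c : {c : V × Fin 4 // c ∉ G.hooked S}, c.1.1 ∈ G.verts S → c.1 ∈ G.legs S :=
    fun c hc => (G.mem_legs S).2 ⟨hc, c.2⟩
  have hface : ∀ x ∈ G.legs S, x ∈ G.faceOf S q := fun x hx => hS.mem_faceOf_of_mem_legs hq hx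
  ext (c' | x') (c | x)
  · rw [Matrix.mul_apply, Fintype.sum_sum_type, MoyalGraph.form_inl_inl]
    simp only [Matrix.transpose_apply, decoupledForm, Matrix.fromBlocks_apply₁₁,
      Matrix.fromBlocks_apply₂₁, Matrix.of_apply]
    by_cases hc' : c'.1.1 ∈ G.verts S
    · simp only [decoupled_leg a s _ _ hc',
        decoupled_momentum_leg a s ⟨q.1, hq.1⟩ haq rfl _ hc' (hface _ (hlegs c' hc'))]
      by_cases hc : c.1.1 ∈ G.verts S
      · simp only [if_pos hc]
        rw [sum_path_of_across _ fun d => by rw [pathCoupling_across (hlegs c hc)],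
          contract_coupling_leg hS hq s hc hc']
        simp [pathMomentum_self s haq (hface _ (hlegs c' hc'))]
      · simp only [if_neg hc]
        rw [contract_coupling_of_notMem s ha hc]
        -- A completed leg is supported on half-lines of `S`, which do not oscillate with half-lines
        -- of other vertices.
        have h0 : ∀ d : V × Fin 4, d.1 ∈ G.verts S → (G.marked a).coupling s d c.1 = 0 := by
          intro d hd
          rw [marked_coupling, if_neg (show ¬d.1 = c.1.1 from fun e => hc (e ▸ hd))]
        rw [h0 _ hc', Finset.sum_eq_zero fun d _ => ?_, zero_add]
        · simp only [mul_ite, mul_neg, mul_one, mul_zero, Finset.sum_ite_eq, Finset.mem_univ,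
            if_true]
          rw [pathMomentum, if_neg hc, neg_zero]
        · by_cases hd : d.1 ∈ G.verts S
          · rw [h0 d hd, mul_zero]
          · rw [pathFun_sub_across (hface _ (hlegs c' hc')) (hlegs c' hc'),
              left_eq_zero hq.1 hd, left_eq_zero (d := prev d) hq.1 hd, if_neg]
            · simp
            · rintro rfl
              exact hd hq.1
    · simp only [decoupled_of_notMem a s _ _ hc', decoupled_momentum_of_notMem a s _ _ hc',
        zero_mul, Finset.sum_const_zero, add_zero, ite_mul, one_mul, Finset.sum_ite_eq',
        Finset.mem_univ, if_true]
      by_cases hc : c.1.1 ∈ G.verts S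
      · rw [if_pos hc, pathCoupling, if_neg hc', mul_zero, MoyalGraph.coupling, if_neg]
        rw [contract_vert, contract_vert, contractVertex_of_mem hc, contractVertex_of_notMem hc']
        simp
      · rw [if_neg hc, contract_coupling_of_notMem s ha hc]
  · rw [Matrix.mul_apply, Fintype.sum_sum_type, MoyalGraph.form_inl_inr]
    simp only [Matrix.transpose_apply, decoupledForm, Matrix.fromBlocks_apply₁₂,
      Matrix.fromBlocks_apply₂₂, Matrix.of_apply, Matrix.zero_apply, mul_zero,
      Finset.sum_const_zero, add_zero]
    by_cases hc' : c'.1.1 ∈ G.verts S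
    · simp only [decoupled_leg a s _ _ hc']
      rw [sum_path_of_across _ fun d => by rw [contractVertex_across]]
      rfl
    · simp only [decoupled_of_notMem a s _ _ hc', ite_mul, one_mul, zero_mul, Finset.sum_ite_eq',
        Finset.mem_univ, if_true]
      rfl
  · rw [Matrix.mul_apply, Fintype.sum_sum_type, MoyalGraph.form_inr_inl]
    simp only [Matrix.transpose_apply, decoupledForm, Matrix.fromBlocks_apply₂₁, Matrix.of_apply,
      decoupled_inl_inr, zero_mul, Finset.sum_const_zero, zero_add,
      decoupled_inr_inr a s ⟨q.1, hq.1⟩ rfl]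
    by_cases hc : c.1.1 ∈ G.verts S
    · simp only [if_pos hc, mul_ite, mul_neg, mul_one, mul_zero, Finset.sum_ite_eq,
        Finset.mem_univ, if_true]
      rw [contract_vert, contractVertex_of_mem hc, contractVertex_of_mem hq.1]
      split_ifs <;> simp
    · simp only [if_neg hc, mul_ite, mul_neg, mul_one, mul_zero, Finset.sum_ite_eq,
        Finset.mem_univ, if_true]
      rw [contract_vert]
      split_ifs <;> simp
  · rw [Matrix.mul_apply, Fintype.sum_sum_type]
    simp [decoupled_inl_inr, decoupledForm]

/-- Long variables see differences across lines of `S`, which vanish here. The total displacement of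
a completed leg is concentrated at the vertex of `q`, whose hypermomentum is not among those of `S`.
-/
theorem subIncl_transpose_mul_decoupledForm (hq : G.IsRootMark S q) (s : ℝ)
    (x : {c : V × Fin 4 // c ∉ G.hooked S} ⊕ Option {v : V // v ∉ G.verts S}) :
    (∀ ℓ, ((G.subIncl S ⟨q.1, hq.1⟩)ᵀ * G.decoupledForm S a s q) (Sum.inl (Sum.inr ℓ)) x = 0) ∧
      ∀ w, ((G.subIncl S ⟨q.1, hq.1⟩)ᵀ * G.decoupledForm S a s q) (Sum.inr w) x = 0 := by
  constructor
  · intro ℓ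
    rw [Matrix.mul_apply, Fintype.sum_sum_type]
    simp only [Matrix.transpose_apply, subIncl_long, subIncl_inr_inl, zero_mul,
      Finset.sum_const_zero, add_zero, sub_mul, ite_mul, one_mul, Finset.sum_sub_distrib,
      Finset.sum_ite_eq', Finset.mem_univ, if_true]
    rw [sub_eq_zero, ← G.across_plus S ℓ.2]
    rcases x with c | x
    · simp only [decoupledForm, Matrix.fromBlocks_apply₁₁, Matrix.of_apply]
      by_cases hc : c.1.1 ∈ G.verts S
      · rw [if_pos hc, if_pos hc, pathCoupling_across ((G.mem_legs S).2 ⟨hc, c.2⟩)]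
      · rw [if_neg hc, if_neg hc, marked_coupling, marked_coupling, if_neg, if_neg]
        · exact fun e => hc (e ▸ (G.across_mem_verts S).2 (G.plus_mem_verts S ℓ.2))
        · exact fun e => hc (e ▸ G.plus_mem_verts S ℓ.2)
    · simp only [decoupledForm, Matrix.fromBlocks_apply₁₂, Matrix.of_apply, contractVertex_across]
  · intro w
    rw [Matrix.mul_apply, Fintype.sum_sum_type]
    simp only [Matrix.transpose_apply, subIncl_inl_inr, zero_mul, Finset.sum_const_zero, zero_add,
      subIncl_inr_inr, ite_mul, one_mul, Finset.sum_ite_eq', Finset.mem_univ, if_true]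
    rcases x with c | x
    · simp only [decoupledForm, Matrix.fromBlocks_apply₂₁, Matrix.of_apply]
      by_cases hc : c.1.1 ∈ G.verts S
      · rw [if_pos hc, if_neg]
        exact fun e => w.2 (Subtype.ext e.symm)
      · rw [if_neg hc, if_neg]
        exact fun e => hc (e ▸ w.1.2)
    · simp [decoupledForm]

end Forms

end Phi4Graph

/-! ### Rotating the numbering at a vertex. -/

namespace Phi4Graph

variable {V L : Type*} [DecidableEq V] [Fintype V] (G : Phi4Graph V L) (S : Finset L)

/-- The change of the oscillation at a vertex when its numbering is rotated. -/
noncomputable def twist (a b : V → Fin 4) (s : ℝ) (c : V × Fin 4) : ℝ :=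
  (G.marked a).coupling s c (c.1, 0) - (G.marked b).coupling s c (c.1, 0)

theorem sign_rotate (a b i j : Fin 4) :
    ((if i - a - 1 < j - a - 1 then 1 else if j - a - 1 < i - a - 1 then -1 else 0 : ℤ)) -
      (if i - b - 1 < j - b - 1 then 1 else if j - b - 1 < i - b - 1 then -1 else 0) =
    (((if i - a - 1 < 0 - a - 1 then 1 else if 0 - a - 1 < i - a - 1 then -1 else 0 : ℤ)) -
      (if i - b - 1 < 0 - b - 1 then 1 else if 0 - b - 1 < i - b - 1 then -1 else 0)) -
    (((if j - a - 1 < 0 - a - 1 then 1 else if 0 - a - 1 < j - a - 1 then -1 else 0 : ℤ)) -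
      (if j - b - 1 < 0 - b - 1 then 1 else if 0 - b - 1 < j - b - 1 then -1 else 0)) := by
  revert a b i j
  decide

/-- A rotation of a cyclic order changes the order of pairs by a difference of values at the two
half-lines. Such a change can be absorbed in the hypermomentum of the vertex. -/
theorem marked_coupling_rotate (a b : V → Fin 4) (s : ℝ) (c d : V × Fin 4) :
    (G.marked a).coupling s c d = (G.marked b).coupling s c d +
      if c.1 = d.1 then G.twist a b s c - G.twist a b s d else 0 := by
  obtain ⟨v, i⟩ := c
  obtain ⟨w, j⟩ := d
  by_cases h : v = w
  · subst h
    have h := congrArg (Int.cast : ℤ → ℝ) (sign_rotate (a v) (b v) i j)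
    simp only [Int.cast_sub] at h
    simp only [twist, marked_coupling, if_true]
    linear_combination (-s) * h
  · simp [marked_coupling, h]

theorem twist_eq_zero {a b : V → Fin 4} (s : ℝ) {c : V × Fin 4} (h : a c.1 = b c.1) :
    G.twist a b s c = 0 := by
  rw [twist, G.marked_coupling_congr s h, sub_self]

/-- The shift of the hypermomenta that compensates the rotation of numberings. -/
noncomputable def shift (a b : V → Fin 4) (s : ℝ) :
    Matrix ((V × Fin 4) ⊕ V) ((V × Fin 4) ⊕ V) ℝ :=
  Matrix.fromBlocks 1 0 (Matrix.of fun v c => if c.1 = v then -G.twist a b s c else 0) 1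

theorem form_rotate (a b : V → Fin 4) (s : ℝ) :
    (G.marked a).form s = (G.shift a b s)ᵀ * (G.marked b).form s * G.shift a b s := by
  rw [Matrix.mul_assoc]
  ext (c | v) (d | w)
  · simp [shift, Matrix.mul_apply, Fintype.sum_sum_type, Matrix.one_apply, marked_form_inl_inr,
      marked_form_inr_inl, G.marked_coupling_rotate a b s c d, -MoyalGraph.form_inl_inr,
      -MoyalGraph.form_inr_inl]
    split_ifs <;> simp_all <;> ring
  · simp [shift, Matrix.mul_apply, Fintype.sum_sum_type, Matrix.one_apply, marked_form_inl_inr,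
      marked_form_inr_inl, -MoyalGraph.form_inl_inr, -MoyalGraph.form_inr_inl]
    rw [Finset.sum_eq_single c]
    · simp
    · intro d _ hd
      simp [hd]
    · simp
  · simp [shift, Matrix.mul_apply, Fintype.sum_sum_type, Matrix.one_apply, marked_form_inl_inr,
      marked_form_inr_inl, -MoyalGraph.form_inl_inr, -MoyalGraph.form_inr_inl]
    split_ifs <;> simp
  · simp [shift, Matrix.mul_apply, Fintype.sum_sum_type, Matrix.one_apply, marked_form_inl_inr,
      marked_form_inr_inl, -MoyalGraph.form_inl_inr, -MoyalGraph.form_inr_inl]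

variable [Fintype L] [DecidableEq L]

/-- The shift of the hypermomenta in the variables of the graph. -/
noncomputable def shiftIdx (a b : V → Fin 4) (s : ℝ) (root : V) :
    Matrix ((L ⊕ L) ⊕ {v : V // v ≠ root}) ((L ⊕ L) ⊕ {v : V // v ≠ root}) ℝ :=
  Matrix.fromBlocks 1 0 (Matrix.of fun v x => ∑ c : V × Fin 4,
    (if c.1 = v.1 then -G.twist a b s c else 0) *
      (G.marked a).incl root (Sum.inl c) (Sum.inl x)) 1

/-- The shift preserves the variables of the graph because it is trivial at the root, the one vertex
without a hypermomentum. -/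
theorem shift_mul_incl {a b : V → Fin 4} (s : ℝ) {root : V} (h : a root = b root) :
    G.shift a b s * (G.marked b).incl root = (G.marked b).incl root * G.shiftIdx a b s root := by
  ext (c | v) (x | w)
  · rw [Matrix.mul_apply, Matrix.mul_apply, Fintype.sum_sum_type, Fintype.sum_sum_type]
    simp [shift, shiftIdx, Matrix.one_apply]
  · rw [Matrix.mul_apply, Matrix.mul_apply, Fintype.sum_sum_type, Fintype.sum_sum_type]
    simp [shift, shiftIdx]
  · rw [Matrix.mul_apply, Matrix.mul_apply, Fintype.sum_sum_type, Fintype.sum_sum_type]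
    simp only [shift, shiftIdx, Matrix.fromBlocks_apply₂₁, Matrix.fromBlocks_apply₂₂, Matrix.of_apply,
      MoyalGraph.incl_inr_inl, MoyalGraph.incl_inr_inr, mul_zero, zero_mul,
      Finset.sum_const_zero, add_zero, zero_add, ite_mul, one_mul]
    by_cases hv : v = root
    · rw [Finset.sum_eq_zero, Finset.sum_eq_zero]
      · intro w _
        rw [if_neg]
        exact fun e => w.2 (e.symm.trans hv)
      · intro c _
        split_ifs with hc
        · rw [G.twist_eq_zero s (by rw [hc, hv, h]), neg_zero, zero_mul]
        · rfl
    · rw [Finset.sum_eq_single (⟨v, hv⟩ : {v : V // v ≠ root})]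
      · rw [if_pos rfl]
        rfl
      · intro w _ hw
        rw [if_neg]
        exact fun e => hw (Subtype.ext e.symm)
      · simp
  · rw [Matrix.mul_apply, Matrix.mul_apply, Fintype.sum_sum_type, Fintype.sum_sum_type]
    simp [shift, shiftIdx, Matrix.one_apply]

/-- The diagonal part vanishes on hypermomenta and so does not notice their shift. -/
theorem shiftIdx_congr_A (a b : V → Fin 4) (s : ℝ) (root : V) (t : L → ℝ) :
    (G.shiftIdx a b s root)ᵀ * (G.marked b).A root t * G.shiftIdx a b s root =
      (G.marked a).A root t := by
  have h : ∀ c : V → Fin 4, (G.marked c).A root t =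
      Matrix.fromBlocks (Matrix.diagonal (Sum.elim (fun ℓ => 1 / t ℓ) t)) 0 0 0 := by
    intro c
    rw [MoyalGraph.A, ← Matrix.fromBlocks_diagonal]
    simp
  rw [h, h, shiftIdx, Matrix.fromBlocks_transpose, Matrix.fromBlocks_multiply,
    Matrix.fromBlocks_multiply]
  simp

/-- The numberings at the vertices other than the root may be rotated. -/
theorem det_M_rotate {a b : V → Fin 4} (ha : ∀ v, Odd (a v : ℕ)) (hb : ∀ v, Odd (b v : ℕ))
    {root : V} (h : a root = b root) (s : ℝ) (t : L → ℝ) :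
    ((G.marked a).M root s t).det = ((G.marked b).M root s t).det := by
  have hB : (G.marked a).B root s =
      (G.shiftIdx a b s root)ᵀ * (G.marked b).B root s * G.shiftIdx a b s root := by
    rw [MoyalGraph.B_eq_congr_form _ (G.marked_isOriented ha),
      MoyalGraph.B_eq_congr_form _ (G.marked_isOriented hb), G.form_rotate a b s]
    have h1 : (G.marked a).incl root = (G.marked b).incl root := rfl
    have h2 := congrArg Matrix.transpose (G.shift_mul_incl s h)
    rw [Matrix.transpose_mul, Matrix.transpose_mul] at h2
    rw [h1]
    calc _ = (((G.marked b).incl root)ᵀ * (G.shift a b s)ᵀ) * (G.marked b).form s *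
          (G.shift a b s * (G.marked b).incl root) := by simp only [Matrix.mul_assoc]
      _ = _ := by
        rw [h2, G.shift_mul_incl s h]
        simp only [Matrix.mul_assoc]
  have hM : (G.marked a).M root s t =
      (G.shiftIdx a b s root)ᵀ * (G.marked b).M root s t * G.shiftIdx a b s root := by
    rw [MoyalGraph.M, MoyalGraph.M, hB, ← G.shiftIdx_congr_A a b s root t, ← Matrix.add_mul,
      ← Matrix.mul_add]
  have hdet : (G.shiftIdx a b s root).det = 1 := by
    rw [shiftIdx, Matrix.det_fromBlocks_zero₁₂]
    simp
  rw [hM, Matrix.det_mul, Matrix.det_mul, Matrix.det_transpose, hdet, one_mul, mul_one]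

end Phi4Graph

/-! ### The limit of a block determinant. -/

section BlockLimit

variable {Λ P J : Type*} [Fintype Λ] [DecidableEq Λ] [Fintype P] [DecidableEq P] [Fintype J]
  [DecidableEq J]

theorem diagPart_transpose (t : Λ → ℝ) : (diagPart P t)ᵀ = diagPart P t := by
  rw [diagPart, Matrix.diagonal_transpose]

/-- Conjugation by `T ρ` on the first block makes the off-diagonal blocks vanish in the limit. `F`
has only short rows, where `T ρ` tends to zero. The diagonal part meets `Q` only in long rows, where
`T ρ` grows more slowly than `ρ⁻²`. The correction of the last block is of order `ρ²`. -/
theorem tendsto_det_blocks {B N₀ : Matrix ((Λ ⊕ Λ) ⊕ P) ((Λ ⊕ Λ) ⊕ P) ℝ}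
    {F Q : Matrix ((Λ ⊕ Λ) ⊕ P) J ℝ} {X : Matrix J J ℝ} {t : Λ → ℝ}
    {T : ℝ → Matrix ((Λ ⊕ Λ) ⊕ P) ((Λ ⊕ Λ) ⊕ P) ℝ}
    (hN : Tendsto (fun ρ => (T ρ)ᵀ * (diagPart P (fun ℓ => ρ ^ 2 * t ℓ) + B) * T ρ) (𝓝[>] 0)
      (𝓝 N₀))
    (hTu : ∀ ℓ k, Tendsto (fun ρ => T ρ (Sum.inl (Sum.inl ℓ)) k) (𝓝[>] 0) (𝓝 0))
    (hTv : ∀ ℓ k, Tendsto (fun ρ => ρ ^ 2 * T ρ (Sum.inl (Sum.inr ℓ)) k) (𝓝[>] 0) (𝓝 0))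
    (hFv : ∀ ℓ j, F (Sum.inl (Sum.inr ℓ)) j = 0) (hFp : ∀ w j, F (Sum.inr w) j = 0)
    (hQu : ∀ ℓ j, Q (Sum.inl (Sum.inl ℓ)) j = 0) :
    Tendsto (fun ρ => (Matrix.fromBlocks (diagPart P (fun ℓ => ρ ^ 2 * t ℓ) + B)
        (diagPart P (fun ℓ => ρ ^ 2 * t ℓ) * Q + F)
        (Qᵀ * diagPart P (fun ℓ => ρ ^ 2 * t ℓ) - Fᵀ)
        (Qᵀ * diagPart P (fun ℓ => ρ ^ 2 * t ℓ) * Q + X)).det * (T ρ).det ^ 2) (𝓝[>] 0)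
      (𝓝 (N₀.det * X.det)) := by
  have hsq : Tendsto (fun ρ : ℝ => ρ ^ 2) (𝓝[>] 0) (𝓝 0) := by
    have : Tendsto (fun ρ : ℝ => ρ ^ 2) (𝓝 0) (𝓝 (0 ^ 2)) := (continuous_pow 2).continuousAt
    rw [zero_pow two_ne_zero] at this
    exact this.mono_left nhdsWithin_le_nhds
  have hF : Tendsto (fun ρ => (T ρ)ᵀ * F) (𝓝[>] 0) (𝓝 0) := by
    refine tendsto_pi_nhds.2 fun k => tendsto_pi_nhds.2 fun j => ?_
    simp only [Matrix.mul_apply, Matrix.transpose_apply, Fintype.sum_sum_type, hFv, hFp, mul_zero,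
      Finset.sum_const_zero, add_zero]
    have := tendsto_finsetSum Finset.univ fun ℓ (_ : ℓ ∈ Finset.univ) =>
      (hTu ℓ k).mul_const (F (Sum.inl (Sum.inl ℓ)) j)
    simpa using this
  have hD : Tendsto (fun ρ => (T ρ)ᵀ * (diagPart P (fun ℓ => ρ ^ 2 * t ℓ) * Q)) (𝓝[>] 0)
      (𝓝 0) := by
    refine tendsto_pi_nhds.2 fun k => tendsto_pi_nhds.2 fun j => ?_
    simp only [Matrix.mul_apply (M := (T _)ᵀ), diagPart, Matrix.diagonal_mul, Matrix.transpose_apply,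
      Fintype.sum_sum_type, hQu, mul_zero, zero_mul, Finset.sum_const_zero, add_zero, zero_add,
      Sum.elim_inl, Sum.elim_inr]
    have := tendsto_finsetSum Finset.univ fun ℓ (_ : ℓ ∈ Finset.univ) =>
      (hTv ℓ k).mul_const (t ℓ * Q (Sum.inl (Sum.inr ℓ)) j)
    simp only [zero_mul, Finset.sum_const_zero] at this
    refine this.congr fun ρ => Finset.sum_congr rfl fun ℓ _ => by ring
  have hQ : Tendsto (fun ρ : ℝ => Qᵀ * diagPart P (fun ℓ => ρ ^ 2 * t ℓ) * Q) (𝓝[>] 0)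
      (𝓝 0) := by
    refine tendsto_pi_nhds.2 fun k => tendsto_pi_nhds.2 fun j => ?_
    simp only [Matrix.mul_assoc]
    simp only [Matrix.mul_apply (M := Qᵀ), diagPart, Matrix.diagonal_mul, Matrix.transpose_apply,
      Fintype.sum_sum_type, hQu, mul_zero, zero_mul, Finset.sum_const_zero, add_zero, zero_add,
      Sum.elim_inl, Sum.elim_inr]
    have := tendsto_finsetSum Finset.univ fun ℓ (_ : ℓ ∈ Finset.univ) =>
      hsq.mul_const (Q (Sum.inl (Sum.inr ℓ)) k * (t ℓ * Q (Sum.inl (Sum.inr ℓ)) j))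
    simp only [zero_mul, Finset.sum_const_zero] at this
    refine this.congr fun ρ => Finset.sum_congr rfl fun ℓ _ => by ring
  have h12 : Tendsto (fun ρ => (T ρ)ᵀ * (diagPart P (fun ℓ => ρ ^ 2 * t ℓ) * Q + F)) (𝓝[>] 0)
      (𝓝 0) := by
    simpa [Matrix.mul_add] using hD.add hF
  have h21 : Tendsto (fun ρ => (Qᵀ * diagPart P (fun ℓ => ρ ^ 2 * t ℓ) - Fᵀ) * T ρ) (𝓝[>] 0)
      (𝓝 0) := by
    have h := ((continuous_id.matrix_transpose).tendsto _).comp (hD.sub hF)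
    simp only [sub_zero, id, Matrix.transpose_zero] at h
    refine h.congr fun ρ => ?_
    simp [Matrix.transpose_mul, Matrix.sub_mul, diagPart_transpose]
  have h22 := hQ.add_const X
  rw [zero_add] at h22
  have hblock : Tendsto (fun ρ => Matrix.fromBlocks
      ((T ρ)ᵀ * (diagPart P (fun ℓ => ρ ^ 2 * t ℓ) + B) * T ρ)
      ((T ρ)ᵀ * (diagPart P (fun ℓ => ρ ^ 2 * t ℓ) * Q + F))
      ((Qᵀ * diagPart P (fun ℓ => ρ ^ 2 * t ℓ) - Fᵀ) * T ρ)
      (Qᵀ * diagPart P (fun ℓ => ρ ^ 2 * t ℓ) * Q + X)) (𝓝[>] 0)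
      (𝓝 (Matrix.fromBlocks N₀ 0 0 X)) := by
    refine tendsto_pi_nhds.2 fun k => tendsto_pi_nhds.2 fun j => ?_
    rcases k with k | k <;> rcases j with j | j
    · exact tendsto_pi_nhds.1 (tendsto_pi_nhds.1 hN k) j
    · exact tendsto_pi_nhds.1 (tendsto_pi_nhds.1 h12 k) j
    · exact tendsto_pi_nhds.1 (tendsto_pi_nhds.1 h21 k) j
    · exact tendsto_pi_nhds.1 (tendsto_pi_nhds.1 h22 k) j
  have h := ((continuous_id.matrix_det).tendsto _).comp hblock
  rw [id, Matrix.det_fromBlocks_zero₂₁] at h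
  refine h.congr fun ρ => ?_
  have hconj : Matrix.fromBlocks
      ((T ρ)ᵀ * (diagPart P (fun ℓ => ρ ^ 2 * t ℓ) + B) * T ρ)
      ((T ρ)ᵀ * (diagPart P (fun ℓ => ρ ^ 2 * t ℓ) * Q + F))
      ((Qᵀ * diagPart P (fun ℓ => ρ ^ 2 * t ℓ) - Fᵀ) * T ρ)
      (Qᵀ * diagPart P (fun ℓ => ρ ^ 2 * t ℓ) * Q + X) =
      Matrix.fromBlocks (T ρ)ᵀ 0 0 1 *
        Matrix.fromBlocks (diagPart P (fun ℓ => ρ ^ 2 * t ℓ) + B)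
          (diagPart P (fun ℓ => ρ ^ 2 * t ℓ) * Q + F)
          (Qᵀ * diagPart P (fun ℓ => ρ ^ 2 * t ℓ) - Fᵀ)
          (Qᵀ * diagPart P (fun ℓ => ρ ^ 2 * t ℓ) * Q + X) * Matrix.fromBlocks (T ρ) 0 0 1 := by
    rw [Matrix.fromBlocks_multiply, Matrix.fromBlocks_multiply]
    simp
  rw [Function.comp_apply, id, hconj, Matrix.det_mul, Matrix.det_mul, Matrix.det_fromBlocks_zero₂₁,
    Matrix.det_fromBlocks_zero₂₁, Matrix.det_transpose, Matrix.det_one]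
  ring

end BlockLimit

/-! ### Sorting the variables of the graph. -/

namespace Phi4Graph

variable {V L : Type*} [DecidableEq V] [Fintype V] {G : Phi4Graph V L} {S : Finset L}
  {q r : V × Fin 4}

section IdxEquiv

variable [DecidableEq L]

/-- The variables of `S` and those of `G/S`, as variables of `G`. -/
def idxMap (hq : q.1 ∈ G.verts S) (hqr : r.1 ∈ G.verts S → q = r) :
    ((({ℓ : L // ℓ ∈ S} ⊕ {ℓ : L // ℓ ∈ S}) ⊕ {v : {v : V // v ∈ G.verts S} // v ≠ ⟨q.1, hq⟩}) ⊕
      (({ℓ : L // ℓ ∉ S} ⊕ {ℓ : L // ℓ ∉ S}) ⊕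
        {x : Option {v : V // v ∉ G.verts S} // x ≠ G.contractVertex S r.1})) →
      (L ⊕ L) ⊕ {v : V // v ≠ r.1} :=
  Sum.elim
    (Sum.map (Sum.map Subtype.val Subtype.val) fun w => ⟨w.1.1, fun e =>
      w.2 (Subtype.ext (e.trans (congrArg Prod.fst (hqr (e ▸ w.1.2))).symm))⟩)
    (Sum.map (Sum.map Subtype.val Subtype.val) fun x => ⟨G.rep S q.1 x.1, fun e =>
      x.2 ((contractVertex_rep hq x.1).symm.trans (congrArg (G.contractVertex S) e))⟩)

/-- The vertex of `q` is the one vertex of `S` without a hypermomentum in `S`, and it represents the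
contracted vertex. If the root of `G` lies in `S`, then `hqr` makes it this vertex, and the
hypermomentum is absent from `G` and `G/S` alike. -/
theorem idxMap_bijective (hq : q.1 ∈ G.verts S) (hqr : r.1 ∈ G.verts S → q = r) :
    Function.Bijective (idxMap (G := G) (S := S) hq hqr) := by
  have hrep : ∀ x y, G.rep S q.1 x = G.rep S q.1 y → x = y := fun x y h => by
    rw [← contractVertex_rep hq x, h, contractVertex_rep hq]
  have hsub : ∀ (w : {v : {v : V // v ∈ G.verts S} // v ≠ ⟨q.1, hq⟩}) x,
      w.1.1 ≠ G.rep S q.1 x := by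
    intro w x
    rcases x with - | x
    · exact fun e => w.2 (Subtype.ext e)
    · exact fun e => x.2 ((show w.1.1 = x.1 from e) ▸ w.1.2)
  constructor
  · rintro (((ℓ | ℓ) | w) | ((ℓ | ℓ) | x)) (((m | m) | w') | ((m | m) | x')) h
    all_goals simp only [idxMap, Sum.elim_inl, Sum.elim_inr, Sum.map_inl, Sum.map_inr, Sum.inl.injEq,
      Sum.inr.injEq, reduceCtorEq, Subtype.mk.injEq] at h
    · rw [Subtype.ext h]
    · exact absurd ℓ.2 (h ▸ m.2)
    · rw [Subtype.ext h]
    · exact absurd ℓ.2 (h ▸ m.2)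
    · rw [Subtype.ext (Subtype.ext h)]
    · exact absurd h (hsub _ _)
    · exact absurd m.2 (h ▸ ℓ.2)
    · rw [Subtype.ext h]
    · exact absurd m.2 (h ▸ ℓ.2)
    · rw [Subtype.ext h]
    · exact absurd h.symm (hsub _ _)
    · rw [Subtype.ext (hrep _ _ h)]
  · rintro ((ℓ | ℓ) | v)
    · by_cases h : ℓ ∈ S
      · exact ⟨Sum.inl (Sum.inl (Sum.inl ⟨ℓ, h⟩)), rfl⟩
      · exact ⟨Sum.inr (Sum.inl (Sum.inl ⟨ℓ, h⟩)), rfl⟩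
    · by_cases h : ℓ ∈ S
      · exact ⟨Sum.inl (Sum.inl (Sum.inr ⟨ℓ, h⟩)), rfl⟩
      · exact ⟨Sum.inr (Sum.inl (Sum.inr ⟨ℓ, h⟩)), rfl⟩
    · obtain ⟨v, hv⟩ := v
      by_cases h : v ∈ G.verts S
      · by_cases hvq : v = q.1
        · subst hvq
          refine ⟨Sum.inr (Sum.inr ⟨none, fun e => ?_⟩), rfl⟩
          by_cases hr : r.1 ∈ G.verts S
          · exact hv (congrArg Prod.fst (hqr hr))
          · rw [contractVertex_of_notMem hr] at e
            exact absurd e (by simp)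
        · exact ⟨Sum.inl (Sum.inr ⟨⟨v, h⟩, fun e => hvq (congrArg Subtype.val e)⟩), rfl⟩
      · refine ⟨Sum.inr (Sum.inr ⟨some ⟨v, h⟩, fun e => ?_⟩), rfl⟩
        by_cases hr : r.1 ∈ G.verts S
        · rw [contractVertex_of_mem hr] at e
          exact absurd e (by simp)
        · rw [contractVertex_of_notMem hr, Option.some.injEq, Subtype.mk.injEq] at e
          exact hv e

/-- The variables of `G` are those of `S` and those of `G/S`. -/
noncomputable def idxEquiv (hq : q.1 ∈ G.verts S) (hqr : r.1 ∈ G.verts S → q = r) :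
    ((({ℓ : L // ℓ ∈ S} ⊕ {ℓ : L // ℓ ∈ S}) ⊕ {v : {v : V // v ∈ G.verts S} // v ≠ ⟨q.1, hq⟩}) ⊕
      (({ℓ : L // ℓ ∉ S} ⊕ {ℓ : L // ℓ ∉ S}) ⊕
        {x : Option {v : V // v ∉ G.verts S} // x ≠ G.contractVertex S r.1})) ≃
      (L ⊕ L) ⊕ {v : V // v ≠ r.1} :=
  Equiv.ofBijective _ (idxMap_bijective hq hqr)

end IdxEquiv

end Phi4Graph

theorem Matrix.congr_fromCols {I J K : Type*} [Fintype I] (H : Matrix I I ℝ) (W : Matrix I J ℝ)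
    (Y : Matrix I K ℝ) : (Matrix.fromCols W Y)ᵀ * H * Matrix.fromCols W Y =
      Matrix.fromBlocks (Wᵀ * H * W) (Wᵀ * (H * Y)) (Yᵀ * H * W) (Yᵀ * (H * Y)) := by
  ext (i | i) (j | j) <;> simp [Matrix.mul_apply, Finset.sum_mul, Finset.mul_sum, mul_assoc]
  all_goals exact Finset.sum_comm

theorem Matrix.fromCols_mul_unitriangular {I J K : Type*} [Fintype J] [DecidableEq J]
    [Fintype K] [DecidableEq K] (W : Matrix I J ℝ) (Y : Matrix I K ℝ) (Q : Matrix J K ℝ) :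
    (Matrix.fromCols W Y : Matrix I (J ⊕ K) ℝ) *
      (Matrix.fromBlocks 1 Q 0 1 : Matrix (J ⊕ K) (J ⊕ K) ℝ) = Matrix.fromCols W (W * Q + Y) := by
  ext i (j | j)
  · rw [Matrix.mul_apply, Fintype.sum_sum_type]
    simp [Matrix.one_apply]
  · rw [Matrix.mul_apply, Fintype.sum_sum_type]
    simp [Matrix.one_apply, Matrix.mul_apply]

/-- Change of variables by a unitriangular matrix in a form with antisymmetric part `H`. -/
theorem Matrix.det_add_eq_of_unitriangular {I N J K : Type*} [Fintype I] [DecidableEq I]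
    [Fintype N] [Fintype J] [DecidableEq J] [Fintype K] [DecidableEq K] (e : J ⊕ K ≃ I)
    {D B : Matrix I I ℝ} {H : Matrix N N ℝ} {D₁ : Matrix J J ℝ} {D₂ X : Matrix K K ℝ}
    {W : Matrix N J ℝ} {Y R : Matrix N K ℝ} {Q : Matrix J K ℝ} (hH : Hᵀ = -H)
    (hD : D.submatrix e e = Matrix.fromBlocks D₁ 0 0 D₂)
    (hB : B.submatrix e e = (Matrix.fromCols W Y)ᵀ * H * Matrix.fromCols W Y)
    (hR : H * (W * Q + Y) = R) (hX : (W * Q + Y)ᵀ * R = X) :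
    (D + B).det = (Matrix.fromBlocks (D₁ + Wᵀ * H * W) (D₁ * Q + Wᵀ * R) (Qᵀ * D₁ - (Wᵀ * R)ᵀ)
      (Qᵀ * D₁ * Q + (D₂ + X))).det := by
  set U : Matrix (J ⊕ K) (J ⊕ K) ℝ := Matrix.fromBlocks 1 Q 0 1 with hU'
  have hU : U.det = 1 := by
    rw [hU', Matrix.det_fromBlocks_zero₂₁]
    simp
  have hBU : Uᵀ * B.submatrix e e * U =
      Matrix.fromBlocks (Wᵀ * H * W) (Wᵀ * R) (-(Wᵀ * R)ᵀ) X := by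
    have h21 : (W * Q + Y)ᵀ * H * W = -(Wᵀ * R)ᵀ := by
      rw [← hR, Matrix.transpose_mul, Matrix.transpose_mul H, hH, Matrix.transpose_transpose,
        Matrix.mul_neg, Matrix.neg_mul, neg_neg]
    calc _ = ((Matrix.fromCols W Y : Matrix N (J ⊕ K) ℝ) * U)ᵀ * H *
          ((Matrix.fromCols W Y : Matrix N (J ⊕ K) ℝ) * U) := by
          rw [hB, Matrix.transpose_mul (Matrix.fromCols W Y)]
          simp only [Matrix.mul_assoc]
      _ = _ := by
          rw [hU', Matrix.fromCols_mul_unitriangular, Matrix.congr_fromCols, h21, hR, hX]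
  have hDU : Uᵀ * D.submatrix e e * U = Matrix.fromBlocks D₁ (D₁ * Q) (Qᵀ * D₁)
      (Qᵀ * D₁ * Q + D₂) := by
    rw [hD, hU', Matrix.fromBlocks_transpose, Matrix.fromBlocks_multiply,
      Matrix.fromBlocks_multiply]
    simp
  have h : Uᵀ * (D + B).submatrix e e * U = Matrix.fromBlocks (D₁ + Wᵀ * H * W)
      (D₁ * Q + Wᵀ * R) (Qᵀ * D₁ - (Wᵀ * R)ᵀ) (Qᵀ * D₁ * Q + (D₂ + X)) := by
    rw [Matrix.submatrix_add, Pi.add_apply, Pi.add_apply, Matrix.mul_add, Matrix.add_mul, hBU, hDU,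
      Matrix.fromBlocks_add, sub_eq_add_neg, add_assoc]
  rw [← h, Matrix.det_mul, Matrix.det_mul, Matrix.det_transpose, hU, one_mul, mul_one,
    Matrix.det_submatrix_equiv_self]

/-! ### The determinant of the graph in decoupled variables. -/

namespace Phi4Graph

variable {V L : Type*} [DecidableEq V] [Fintype V] [DecidableEq L] [Fintype L]
  (G : Phi4Graph V L) (S : Finset L)

/-- The variables of `G/S` as combinations of the positions of its half-lines. -/
noncomputable def contractIncl (q r : V × Fin 4) :
    Matrix ({c : V × Fin 4 // c ∉ G.hooked S} ⊕ Option {v : V // v ∉ G.verts S})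
      (({ℓ : L // ℓ ∉ S} ⊕ {ℓ : L // ℓ ∉ S}) ⊕
        {x : Option {v : V // v ∉ G.verts S} // x ≠ G.contractVertex S r.1}) ℝ :=
  (G.contract S q r).incl (G.contractVertex S r.1)

variable {G S} {q r : V × Fin 4}

theorem incl_submatrix_idxEquiv (a : V → Fin 4) (hq : q.1 ∈ G.verts S)
    (hqr : r.1 ∈ G.verts S → q = r) :
    ((G.marked a).incl r.1).submatrix id (idxEquiv hq hqr) =
      Matrix.fromCols (G.subIncl S ⟨q.1, hq⟩) (G.repMat S q * G.contractIncl S q r) := by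
  ext (c | v) (((ℓ | ℓ) | w) | ((ℓ | ℓ) | x))
  · rfl
  · rfl
  · rfl
  · have h : ∀ x : {c : V × Fin 4 // c ∉ G.hooked S}, ∀ α β : ℝ,
        (if c = x.1 then α + β else 0) = (if c = x.1 then α else 0) + if c = x.1 then β else 0 := by
      intro x α β
      split_ifs <;> simp
    simp only [Matrix.fromCols_apply_inr, contractIncl, repMat, Matrix.mul_apply, Matrix.one_apply,
      Fintype.sum_sum_type, Matrix.submatrix_apply, id, Sum.map_inl, Sum.map_inr, Sum.inl.injEq,
      reduceCtorEq, if_false, MoyalGraph.incl_short, MoyalGraph.incl_inr_inl, mul_zero,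
      Finset.sum_const_zero, add_zero, ite_mul, one_mul, zero_mul, h, Finset.sum_add_distrib,
      Finset.sum_ite_eq_ite]
    rfl
  · have h : ∀ x : {c : V × Fin 4 // c ∉ G.hooked S}, ∀ α β : ℝ,
        (if c = x.1 then α - β else 0) = (if c = x.1 then α else 0) - if c = x.1 then β else 0 := by
      intro x α β
      split_ifs <;> simp
    simp only [Matrix.fromCols_apply_inr, contractIncl, repMat, Matrix.mul_apply, Matrix.one_apply,
      Fintype.sum_sum_type, Matrix.submatrix_apply, id, Sum.map_inl, Sum.map_inr, Sum.inl.injEq,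
      reduceCtorEq, if_false, MoyalGraph.incl_long, MoyalGraph.incl_inr_inl, mul_zero,
      Finset.sum_const_zero, add_zero, ite_mul, one_mul, zero_mul, h, Finset.sum_sub_distrib,
      Finset.sum_ite_eq_ite]
    rfl
  · simp only [Matrix.fromCols_apply_inr, contractIncl, repMat, Matrix.mul_apply, Matrix.one_apply,
      Fintype.sum_sum_type, Matrix.submatrix_apply, id, Sum.map_inl, Sum.map_inr, Sum.inl.injEq,
      reduceCtorEq, if_false, MoyalGraph.incl_inl_inr, mul_zero, zero_mul,
      Finset.sum_const_zero, add_zero]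
    rfl
  · rfl
  · rfl
  · rfl
  · simp only [Matrix.fromCols_apply_inr, contractIncl, repMat, Matrix.mul_apply, Matrix.one_apply,
      Fintype.sum_sum_type, Matrix.submatrix_apply, id, Sum.map_inl, Sum.map_inr, Sum.inr.injEq,
      reduceCtorEq, if_false, MoyalGraph.incl_inr_inl, mul_zero, zero_mul,
      Finset.sum_const_zero, add_zero]
    rfl
  · simp only [Matrix.fromCols_apply_inr, contractIncl, repMat, Matrix.mul_apply, Matrix.one_apply,
      Fintype.sum_sum_type, Matrix.submatrix_apply, id, Sum.map_inl, Sum.map_inr, Sum.inr.injEq,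
      reduceCtorEq, if_false, MoyalGraph.incl_inr_inl, mul_zero, zero_mul,
      Finset.sum_const_zero, add_zero]
    rfl
  · simp only [Matrix.fromCols_apply_inr, contractIncl, repMat, Matrix.mul_apply, Matrix.one_apply,
      Fintype.sum_sum_type, Matrix.submatrix_apply, id, Sum.map_inl, Sum.map_inr, Sum.inr.injEq,
      reduceCtorEq, if_false, MoyalGraph.incl_inr_inr, zero_mul, ite_mul, one_mul,
      Finset.sum_const_zero, zero_add, Finset.sum_ite_eq_ite]
    rfl

set_option synthInstance.maxSize 1000 in
set_option synthInstance.maxHeartbeats 200000 in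
theorem A_submatrix_idxEquiv (a : V → Fin 4) (hq : q.1 ∈ G.verts S)
    (hqr : r.1 ∈ G.verts S → q = r) (t : L → ℝ) :
    ((G.marked a).A r.1 t).submatrix (idxEquiv hq hqr) (idxEquiv hq hqr) =
      Matrix.fromBlocks (diagPart _ fun ℓ : {ℓ : L // ℓ ∈ S} => t ℓ) 0 0
        (diagPart _ fun ℓ : {ℓ : L // ℓ ∉ S} => t ℓ) := by
  rw [MoyalGraph.A, Matrix.submatrix_diagonal_equiv, diagPart, diagPart, Matrix.fromBlocks_diagonal]
  congr 1
  ext (((ℓ | ℓ) | w) | ((ℓ | ℓ) | x)) <;> rfl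

/-- The coupling of the subgraph with the variables of `G/S`. -/
noncomputable def subCoupling (a : V → Fin 4) (s : ℝ) (r : V × Fin 4) (hq : q.1 ∈ G.verts S) :
    Matrix (({ℓ : L // ℓ ∈ S} ⊕ {ℓ : L // ℓ ∈ S}) ⊕ {v : {v : V // v ∈ G.verts S} // v ≠ ⟨q.1, hq⟩})
      (({ℓ : L // ℓ ∉ S} ⊕ {ℓ : L // ℓ ∉ S}) ⊕
        {x : Option {v : V // v ∉ G.verts S} // x ≠ G.contractVertex S r.1}) ℝ :=
  (G.subIncl S ⟨q.1, hq⟩)ᵀ * (G.decoupledForm S a s q * G.contractIncl S q r)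

/-- The completed paths in the variables of `G/S`. -/
noncomputable def pathIncl (a : V → Fin 4) (s : ℝ) (r : V × Fin 4) (hq : q.1 ∈ G.verts S) :
    Matrix (({ℓ : L // ℓ ∈ S} ⊕ {ℓ : L // ℓ ∈ S}) ⊕ {v : {v : V // v ∈ G.verts S} // v ≠ ⟨q.1, hq⟩})
      (({ℓ : L // ℓ ∉ S} ⊕ {ℓ : L // ℓ ∉ S}) ⊕
        {x : Option {v : V // v ∉ G.verts S} // x ≠ G.contractVertex S r.1}) ℝ :=
  G.pathMat S a s q ⟨q.1, hq⟩ * G.contractIncl S q r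

/-- The antisymmetric part of `G/S`. -/
noncomputable def contractB (G : Phi4Graph V L) (S : Finset L) (s : ℝ) (q r : V × Fin 4) :
    Matrix (({ℓ : L // ℓ ∉ S} ⊕ {ℓ : L // ℓ ∉ S}) ⊕
        {x : Option {v : V // v ∉ G.verts S} // x ≠ G.contractVertex S r.1})
      (({ℓ : L // ℓ ∉ S} ⊕ {ℓ : L // ℓ ∉ S}) ⊕
        {x : Option {v : V // v ∉ G.verts S} // x ≠ G.contractVertex S r.1}) ℝ :=
  (G.contract S q r).B (G.contractVertex S r.1) s

theorem contractB_eq (hS : G.PrimitivelyDivergent S) (hq : G.IsRootMark S q)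
    (hr : Odd (r.2 : ℕ)) (s : ℝ) : G.contractB S s q r =
      (G.contractIncl S q r)ᵀ * (G.contract S q r).form s * G.contractIncl S q r :=
  MoyalGraph.B_eq_congr_form _ (contract_isOriented hS hq hr) _ s

set_option synthInstance.maxSize 1000 in
set_option synthInstance.maxHeartbeats 200000 in
-- Adding the completed paths to the variables of `G/S` is unitriangular and costs no determinant.
-- The antisymmetric part of the last block becomes exactly that of `G/S`; the diagonal part
-- contributes the terms with `pathIncl`.
theorem det_marked_M (hS : G.PrimitivelyDivergent S) (hq : G.IsRootMark S q)
    (hr : Odd (r.2 : ℕ)) (hqr : r.1 ∈ G.verts S → q = r) {a : V → Fin 4}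
    (hodd : ∀ v, Odd (a v : ℕ)) (haq : a q.1 = q.2) (ha : ∀ v ∉ G.verts S, a v = rootMarks r v)
    (s : ℝ) (t : L → ℝ) : ((G.marked a).M r.1 s t).det =
      (Matrix.fromBlocks
        (diagPart _ (fun ℓ : {ℓ : L // ℓ ∈ S} => t ℓ) + G.subForm S a ⟨q.1, hq.1⟩ s)
        (diagPart _ (fun ℓ : {ℓ : L // ℓ ∈ S} => t ℓ) * pathIncl a s r hq.1 +
          subCoupling a s r hq.1)
        ((pathIncl a s r hq.1)ᵀ * diagPart _ (fun ℓ : {ℓ : L // ℓ ∈ S} => t ℓ) -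
          (subCoupling a s r hq.1)ᵀ)
        ((pathIncl a s r hq.1)ᵀ *
          diagPart {v : {v : V // v ∈ G.verts S} // v ≠ ⟨q.1, hq.1⟩}
            (fun ℓ : {ℓ : L // ℓ ∈ S} => t ℓ) * pathIncl a s r hq.1 + (diagPart _ (fun ℓ : {ℓ : L // ℓ ∉ S} => t ℓ) +
            G.contractB S s q r))).det := by
  have hY : G.subIncl S ⟨q.1, hq.1⟩ * pathIncl a s r hq.1 + G.repMat S q * G.contractIncl S q r =
      G.decoupled S a s q ⟨q.1, hq.1⟩ * G.contractIncl S q r := by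
    rw [pathIncl, decoupled, Matrix.add_mul, Matrix.mul_assoc]
  have hB : ((G.marked a).B r.1 s).submatrix (idxEquiv hq.1 hqr) (idxEquiv hq.1 hqr) =
      (Matrix.fromCols (G.subIncl S ⟨q.1, hq.1⟩) (G.repMat S q * G.contractIncl S q r))ᵀ *
        (G.marked a).form s *
        Matrix.fromCols (G.subIncl S ⟨q.1, hq.1⟩) (G.repMat S q * G.contractIncl S q r) := by
    rw [MoyalGraph.B_eq_congr_form _ (G.marked_isOriented hodd),
      ← incl_submatrix_idxEquiv a hq.1 hqr]
    rfl
  refine Matrix.det_add_eq_of_unitriangular (idxEquiv hq.1 hqr) ((G.marked a).form_transpose s)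
    (A_submatrix_idxEquiv a hq.1 hqr t) hB (Q := pathIncl a s r hq.1) ?_ ?_
  · rw [hY, ← Matrix.mul_assoc, form_mul_decoupled hS hq haq]
  · rw [hY, contractB_eq hS hq hr, ← decoupled_transpose_mul hS hq haq ha, Matrix.transpose_mul]
    simp only [Matrix.mul_assoc]

theorem PrimitivelyDivergent.tendsto_det (hS : G.PrimitivelyDivergent S) (hq : G.IsRootMark S q)
    (hr : Odd (r.2 : ℕ)) (hqr : r.1 ∈ G.verts S → q = r) (s : ℝ) (t : L → ℝ) :
    Tendsto (fun ρ : ℝ => ((G.toMoyal r).M r.1 s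
        (fun ℓ => if ℓ ∈ S then ρ ^ 2 * t ℓ else t ℓ)).det *
        ρ ^ (2 * Fintype.card {v : {v : V // v ∈ G.verts S} // v ≠ ⟨q.1, hq.1⟩}))
      (𝓝[>] 0) (𝓝 (G.leadCoeff S ⟨q.1, hq.1⟩ s (fun ℓ => t ℓ) *
        ((G.contract S q r).M (G.contractVertex S r.1) s (fun ℓ => t ℓ)).det)) := by
  -- Inside `S` the vertices are numbered from `q`. If the root of `G` lies outside `S`, this may
  -- differ from the given numbering, but not at the root, so the determinant is the same.
  set a : V → Fin 4 := fun v => if v ∈ G.verts S then rootMarks q v else rootMarks r v with ha'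
  have haS : ∀ v ∈ G.verts S, a v = rootMarks q v := fun v hv => by rw [ha']; exact if_pos hv
  have ha : ∀ v ∉ G.verts S, a v = rootMarks r v := fun v hv => by rw [ha']; exact if_neg hv
  have haq : a q.1 = q.2 := by rw [haS _ hq.1, rootMarks, Function.update_self]
  have har : a r.1 = rootMarks r r.1 := by
    by_cases h : r.1 ∈ G.verts S
    · rw [haS _ h, hqr h]
    · exact ha _ h
  have hodd : ∀ v, Odd (a v : ℕ) := by
    intro v
    by_cases h : v ∈ G.verts S
    · rw [haS _ h]
      exact odd_rootMarks hq.2.1 v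
    · rw [ha _ h]
      exact odd_rootMarks hr v
  obtain ⟨T, κ, N₀, hκ, hT, hN, hdet, hTu, hTv⟩ :=
    hS.exists_rescaling hq haS s (fun ℓ : {ℓ : L // ℓ ∈ S} => t ℓ)
  have hF : ∀ (i) (j), (∀ x, ((G.subIncl S ⟨q.1, hq.1⟩)ᵀ * G.decoupledForm S a s q) i x = 0) →
      subCoupling a s r hq.1 i j = 0 := by
    intro i j h
    rw [subCoupling, ← Matrix.mul_assoc, Matrix.mul_apply]
    exact Finset.sum_eq_zero fun x _ => by rw [h x, zero_mul]
  have hQu : ∀ ℓ j, pathIncl a s r hq.1 (Sum.inl (Sum.inl ℓ)) j = 0 := by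
    intro ℓ j
    rw [pathIncl, Matrix.mul_apply, Fintype.sum_sum_type]
    simp [pathMat]
  have h := (tendsto_det_blocks (X := diagPart _ (fun ℓ : {ℓ : L // ℓ ∉ S} => t ℓ) +
    G.contractB S s q r) hN hTu hTv
    (fun ℓ j => hF _ j fun x => (subIncl_transpose_mul_decoupledForm hq s x).1 ℓ)
    (fun w j => hF _ j fun x => (subIncl_transpose_mul_decoupledForm hq s x).2 w) hQu).mul_const κ⁻¹
  have hmul : ∀ x y : ℝ, κ * x * y * κ⁻¹ = x * y := fun x y => by field_simp
  rw [hdet, hmul] at h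
  refine h.congr' ?_
  filter_upwards [self_mem_nhdsWithin] with ρ hρ
  have htS : (fun ℓ : {ℓ : L // ℓ ∈ S} => if ℓ.1 ∈ S then ρ ^ 2 * t ℓ else t ℓ) =
      fun ℓ : {ℓ : L // ℓ ∈ S} => ρ ^ 2 * t ℓ := funext fun ℓ => if_pos ℓ.2
  have htX : (fun ℓ : {ℓ : L // ℓ ∉ S} => if ℓ.1 ∈ S then ρ ^ 2 * t ℓ else t ℓ) =
      fun ℓ : {ℓ : L // ℓ ∉ S} => t ℓ := funext fun ℓ => if_neg ℓ.2
  rw [toMoyal_eq, ← G.det_M_rotate hodd (odd_rootMarks hr) har,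
    det_marked_M hS hq hr hqr hodd haq ha, htS, htX, hT ρ (ne_of_gt hρ)]
  rw [mul_assoc, mul_assoc, mul_inv_cancel₀ hκ, mul_one]
  congr!

end Phi4Graph

/-! ### Asymptotics of the polynomials and conclusion. -/

namespace Phi4Graph

variable {V L : Type*} [DecidableEq V] [Fintype V] [DecidableEq L] [Fintype L]
  {G : Phi4Graph V L} {S : Finset L} {q r : V × Fin 4}

/-- A function on the vertices of `G/S` pulls back to `G`, where it is also constant along the
contracted lines. -/
theorem contract_eq_of_lines (hG : (G.toMoyal r).IsConnected) (hq : q.1 ∈ G.verts S)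
    (g : Option {v : V // v ∉ G.verts S} → ℝ)
    (hg : ∀ ℓ, g ((G.contract S q r).vert ((G.contract S q r).plus ℓ)) =
      g ((G.contract S q r).vert ((G.contract S q r).minus ℓ))) (x y) : g x = g y := by
  have h := hG.eq_of_lines (fun v => g (G.contractVertex S v)) (fun ℓ => ?_)
    (G.rep S q.1 x) (G.rep S q.1 y)
  · simpa only [contractVertex_rep hq] using h
  · by_cases hℓ : ℓ ∈ S
    · have h1 := contractVertex_of_mem (G.plus_mem_verts S hℓ)
      have h2 := contractVertex_of_mem (G.minus_mem_verts S hℓ)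
      exact congrArg g (h1.trans h2.symm)
    · exact hg ⟨ℓ, hℓ⟩

theorem det_contract_M_ne_zero (hG : (G.toMoyal r).IsConnected) (hS : G.PrimitivelyDivergent S)
    (hq : G.IsRootMark S q) (hr : Odd (r.2 : ℕ)) (s : ℝ) {t : {ℓ : L // ℓ ∉ S} → ℝ}
    (ht : ∀ ℓ, 0 < t ℓ) :
    ((G.contract S q r).M (G.contractVertex S r.1) s t).det ≠ 0 :=
  MoyalGraph.det_M_ne_zero _ (contract_isOriented hS hq hr) _ s
    (contract_eq_of_lines hG hq.1) ht

/-- The first power of `ρ` normalizes the determinant; the second, twice the number of internal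
faces, is the lowest degree of the polynomials. -/
theorem PrimitivelyDivergent.prod_rescaled (hS : G.PrimitivelyDivergent S)
    (o : {v : V // v ∈ G.verts S}) (t : {ℓ : L // ℓ ∈ S} → ℝ) (ρ : ℝ) :
    ∏ ℓ, ρ ^ 2 * t ℓ = ρ ^ (2 * Fintype.card {v // v ≠ o}) * (∏ ℓ, t ℓ) *
      ρ ^ (2 * Fintype.card (G.InternalFace S)) := by
  rw [Finset.prod_mul_distrib, Finset.prod_const, Finset.card_univ, hS.card_internalFace o]
  ring

/-- The asymptotics of the polynomial of the subgraph. -/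
theorem PrimitivelyDivergent.tendsto_rescale_sub (hS : G.PrimitivelyDivergent S)
    {o : V × Fin 4} (ho : G.IsRootMark S o) (s : ℝ) {t : L → ℝ} (ht : ∀ ℓ, 0 < t ℓ) :
    Tendsto (fun ρ : ℝ => ((rescale S (MvPolynomial.rename Subtype.val
        ((G.sub S o).HU ⟨o.1, ho.1⟩ s))).map (MvPolynomial.eval t)).eval ρ /
        ρ ^ (2 * Fintype.card (G.InternalFace S))) (𝓝[>] 0)
      (𝓝 (G.leadCoeff S ⟨o.1, ho.1⟩ s (fun ℓ => t ℓ) * ∏ ℓ : {ℓ : L // ℓ ∈ S}, t ℓ)) := by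
  refine ((hS.tendsto_det_sub ho s fun ℓ => t ℓ).mul_const _).congr' ?_
  filter_upwards [self_mem_nhdsWithin] with ρ hρ
  have hρ' : ρ ≠ 0 := ne_of_gt hρ
  have htS : (fun ℓ => if ℓ ∈ S then ρ ^ 2 * t ℓ else t ℓ) ∘ Subtype.val =
      fun ℓ : {ℓ : L // ℓ ∈ S} => ρ ^ 2 * t ℓ := funext fun ℓ => if_pos ℓ.2
  rw [eval_rescale, MvPolynomial.eval_rename, htS,
    MoyalGraph.eval_HU (G.sub S o) _ _ _ fun ℓ => mul_ne_zero (pow_ne_zero 2 hρ') (ht ℓ.1).ne',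
    hS.prod_rescaled ⟨o.1, ho.1⟩, ← mul_assoc, ← mul_assoc,
    mul_div_cancel_right₀ _ (pow_ne_zero _ hρ')]

theorem eval_rename_contract (s : ℝ) {t : L → ℝ} (ht : ∀ ℓ, 0 < t ℓ) :
    MvPolynomial.eval t (MvPolynomial.rename Subtype.val
      ((G.contract S q r).HU (G.contractVertex S r.1) s)) =
    ((G.contract S q r).M (G.contractVertex S r.1) s (fun ℓ => t ℓ)).det *
      ∏ ℓ : {ℓ : L // ℓ ∉ S}, t ℓ := by
  rw [MvPolynomial.eval_rename]
  exact MoyalGraph.eval_HU _ _ _ _ fun ℓ => (ht ℓ).ne'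

/-- The asymptotics of the polynomial of the graph. -/
theorem PrimitivelyDivergent.tendsto_rescale (hS : G.PrimitivelyDivergent S)
    (hq : G.IsRootMark S q) (hr : Odd (r.2 : ℕ)) (hqr : r.1 ∈ G.verts S → q = r) (s : ℝ)
    {t : L → ℝ} (ht : ∀ ℓ, 0 < t ℓ) :
    Tendsto (fun ρ : ℝ => ((rescale S ((G.toMoyal r).HU r.1 s)).map
        (MvPolynomial.eval t)).eval ρ / ρ ^ (2 * Fintype.card (G.InternalFace S))) (𝓝[>] 0)
      (𝓝 ((G.leadCoeff S ⟨q.1, hq.1⟩ s (fun ℓ => t ℓ) * ∏ ℓ : {ℓ : L // ℓ ∈ S}, t ℓ) *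
        MvPolynomial.eval t (MvPolynomial.rename Subtype.val
          ((G.contract S q r).HU (G.contractVertex S r.1) s)))) := by
  have h := (hS.tendsto_det hq hr hqr s t).mul_const
    ((∏ ℓ : {ℓ : L // ℓ ∈ S}, t ℓ) * ∏ ℓ : {ℓ : L // ℓ ∉ S}, t ℓ)
  rw [eval_rename_contract s ht, mul_mul_mul_comm]
  refine h.congr' ?_
  filter_upwards [self_mem_nhdsWithin] with ρ hρ
  have hρ' : ρ ≠ 0 := ne_of_gt hρ
  have hprod : ∏ ℓ, (if ℓ ∈ S then ρ ^ 2 * t ℓ else t ℓ) =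
      (∏ ℓ : {ℓ : L // ℓ ∈ S}, ρ ^ 2 * t ℓ) * ∏ ℓ : {ℓ : L // ℓ ∉ S}, t ℓ := by
    rw [← Fintype.prod_subtype_mul_prod_subtype fun ℓ => ℓ ∈ S]
    congr 1
    · exact Finset.prod_congr (by ext; simp) fun ℓ _ => if_pos ℓ.2
    · exact Finset.prod_congr (by ext; simp) fun ℓ _ => if_neg ℓ.2
  have hne : ∀ ℓ, (if ℓ ∈ S then ρ ^ 2 * t ℓ else t ℓ) ≠ 0 := by
    intro ℓ
    split_ifs
    · exact mul_ne_zero (pow_ne_zero 2 hρ') (ht ℓ).ne'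
    · exact (ht ℓ).ne'
  rw [eval_rescale, MoyalGraph.eval_HU _ _ _ _ hne, hprod, hS.prod_rescaled ⟨q.1, hq.1⟩,
    eq_div_iff (pow_ne_zero _ hρ')]
  ring

end Phi4Graph

end

theorem mainTheorem9 {V L : Type*} [Fintype V] [DecidableEq V] [Fintype L] [DecidableEq L]
    (G : Phi4Graph V L) (s : ℝ) (r : V × Fin 4) (hr : Odd (r.2 : ℕ))
    (hG : (G.toMoyal r).IsConnected)
    (S : Finset L) (hS : G.PrimitivelyDivergent S)
    (hrS : r.1 ∈ G.verts S → G.IsRootMark S r)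
    (rS : V × Fin 4) (hrootS : G.IsRootMark S rS)
    (q : V × Fin 4) (hq : G.IsRootMark S q) (hqr : r.1 ∈ G.verts S → q = r) :
    lowestTerm (rescale S ((G.toMoyal r).HU r.1 s)) =
      lowestTerm (rescale S
          (MvPolynomial.rename Subtype.val ((G.sub S rS).HU ⟨rS.1, hrootS.1⟩ s))) *
        Polynomial.C (MvPolynomial.rename Subtype.val
          ((G.contract S q r).HU (G.contractVertex S r.1) s)) := by
  refine lowestTerm_eq_mul_of_tendsto (2 * Fintype.card (G.InternalFace S))
    (fun t => G.leadCoeff S ⟨q.1, hq.1⟩ s (fun ℓ => t ℓ) * ∏ ℓ : {ℓ : L // ℓ ∈ S}, t ℓ)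
    (fun t ht => mul_ne_zero (hS.leadCoeff_ne_zero hq _ s fun ℓ => ht ℓ)
      (Finset.prod_ne_zero_iff.2 fun ℓ _ => (ht ℓ).ne')) (fun t ht => ?_) (fun t ht => ?_)
    fun t ht => hS.tendsto_rescale hq hr hqr s ht
  · rw [Phi4Graph.eval_rename_contract s ht]
    exact mul_ne_zero (Phi4Graph.det_contract_M_ne_zero hG hS hq hr s fun ℓ => ht ℓ)
      (Finset.prod_ne_zero_iff.2 fun ℓ _ => (ht ℓ).ne')
  -- The root marks of `S` and of `G/S` need not agree: `leadCoeff` contains no numbering and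
  -- depends on the root only through a minor of the Laplacian.
  · rw [hS.leadCoeff_eq _ ⟨rS.1, hrootS.1⟩]
    exact hS.tendsto_rescale_sub hrootS s ht
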